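/- Let $G=PO(3)$ be the affine algebraic group over $\mathbb Q$ obtained from the orthogonal group $O(3)$ of the form $x^2+y^2+z^2$ by dividing out the scalar matrices. For a group $\Gamma$ let $\mathrm{Hom}(\Gamma,G)$ be the affine $\mathbb Q$-scheme whose $R$-points are the homomorphisms $\Gamma\to PO(3,R)$, on which $G$ acts by conjugation, and let $X(\Gamma,G)=\mathrm{Hom}(\Gamma,G)/\!/G=\operatorname{Spec}\,\mathcal O(\mathrm{Hom}(\Gamma,G))^G$ be the character scheme. For a Coxeter group $\Gamma$ with generators $g_v$, $v\in V$ ($V$ finite), relations $g_v^2=1$, and $(g_vg_w)^{m}=1$ for each edge $[v,w]$ of label $m$ of a labelled graph on $V$, an elementary subgroup is a finite subgroup generated by at most two of the $g_v$. Let $\mathrm{Hom}_o(\Gamma,G)\subset\mathrm{Hom}(\Gamma,G)$ be the open subscheme of the representations which are injective on every elementary subgroup, and let $X_o(\Gamma,G)$ be its image in $X(\Gamma,G)$. **Theorem.** Let $X$ be an affine scheme of finite type over $\mathbb Q$ and let $x\in X(\mathbb Q)$ be a rational point. Then there exist an open subscheme $X'\subset X$ containing $x$, a finitely generated Coxeter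 group $\Gamma$ all of whose edge labels are $2$ or $4$, and a representation $\rho_c:\Gamma\to PO(3,\mathbb R)$ with dense image, such that: 1. For every $\rho:\Gamma\to PO(3,\mathbb C)$ which is injective on all elementary subgroups, the centralizer of $\rho(\Gamma)$ in $PO(3,\mathbb C)$ is the center of $PO(3,\mathbb C)$, and $\rho$ is a stable point (its conjugation orbit is Zariski closed in $\mathrm{Hom}(\Gamma,PO(3,\mathbb C))$ and its stabilizer is finite); moreover $X_o(\Gamma,G)$ is open in $X(\Gamma,G)$, and is regarded as an open subscheme. 2. $X'$ is isomorphic, as a scheme over $\mathbb Q$, to an open subscheme $S\subset X_o(\Gamma,G)$, by an isomorphism under which $x$ corresponds to the class $[\rho_c]$ (as complex points). 3. The action of $G$ on $\mathrm{Hom}_o(\Gamma,G)$ has a cross-section $S_c$ containing $\rho_c$, i.e. a closed subscheme $S_c\subset\mathrm{Hom}_o(\Gamma,G)$ which the quotient morphism maps isomorphically onto $X_o(\Gamma,G)$. -/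

import Mathlib

open AlgebraicGeometry CategoryTheory
open scoped TensorProduct

noncomputable section

namespace KM

/-! ### The algebraic group `PO(3)` over `ℚ`, through its functor of points -/

section PO3

variable (R : Type*) [CommRing R]

/-- The `R`-points of the orthogonal group of the form `x² + y² + z²`. -/
abbrev O3 : Type _ := Matrix.orthogonalGroup (Fin 3) R

variable {R} in
theorem O3.mul_transpose (g : O3 R) :
    (g : Matrix (Fin 3) (Fin 3) R) * (g : Matrix (Fin 3) (Fin 3) R).transpose = 1 :=
  (Matrix.mem_orthogonalGroup_iff _ _).1 g.2

variable {R} in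
theorem O3.det_mul_det (g : O3 R) :
    (g : Matrix (Fin 3) (Fin 3) R).det * (g : Matrix (Fin 3) (Fin 3) R).det = 1 := by
  have := congrArg Matrix.det (O3.mul_transpose g)
  simpa using this

/-- The scalar matrices in the orthogonal group (over a field: `{1, -1}`). -/
def scalarO3 : Subgroup (O3 R) where
  carrier := {g | ∃ c : R, (g : Matrix (Fin 3) (Fin 3) R) = c • 1}
  one_mem' := ⟨1, by simp⟩
  mul_mem' := by
    rintro a b ⟨c, hc⟩ ⟨d, hd⟩
    exact ⟨c * d, by simp [hc, hd, smul_smul, mul_comm]⟩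
  inv_mem' := by
    rintro a ⟨c, hc⟩
    refine ⟨c, ?_⟩
    have h1 := O3.mul_transpose a
    have h2 : (a : Matrix (Fin 3) (Fin 3) R) * ((a⁻¹ : O3 R) : Matrix (Fin 3) (Fin 3) R) = 1 := by
      rw [← Submonoid.coe_mul]; simp
    have h3 : ((a⁻¹ : O3 R) : Matrix (Fin 3) (Fin 3) R) * (a : Matrix (Fin 3) (Fin 3) R) = 1 := by
      rw [← Submonoid.coe_mul]; simp
    have h4 := left_inv_eq_right_inv h3 h1
    rw [h4, hc]; simp

instance : (scalarO3 R).Normal where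
  conj_mem := by
    rintro a ⟨c, hc⟩ g
    refine ⟨c, ?_⟩
    have h2 : (g : Matrix (Fin 3) (Fin 3) R) * ((g⁻¹ : O3 R) : Matrix (Fin 3) (Fin 3) R) = 1 := by
      rw [← Submonoid.coe_mul]; simp
    rw [Submonoid.coe_mul, Submonoid.coe_mul, hc, Matrix.mul_smul, Matrix.mul_one, Matrix.smul_mul,
      h2]

/-- The `R`-points of `PO(3) = O(3) / {scalars}`. No sheafification is needed: every class
has exactly one representative of determinant one (`PO3.equivSO`), so this functor is represented
by an affine group scheme. For `R = ℝ` and `R = ℂ` these are the groups `PO(3, ℝ)`, `PO(3, ℂ)`. -/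
abbrev PO3 : Type _ := O3 R ⧸ scalarO3 R

variable {R} {S : Type*} [CommRing S]

/-- Entrywise base change of orthogonal matrices. -/
def O3.map (f : R →+* S) : O3 R →* O3 S where
  toFun g := ⟨(g : Matrix (Fin 3) (Fin 3) R).map f, (Matrix.mem_orthogonalGroup_iff _ _).2 (by
    rw [← Matrix.transpose_map, ← Matrix.map_mul, O3.mul_transpose g]
    simp [Matrix.map_one])⟩
  map_one' := Subtype.ext (by simp [Matrix.map_one])
  map_mul' a b := Subtype.ext (by simp [Matrix.map_mul])

/-- Base change `PO(3, R) → PO(3, S)`. -/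
def PO3.map (f : R →+* S) : PO3 R →* PO3 S :=
  QuotientGroup.map _ _ (O3.map f) (by
    rintro a ⟨c, hc⟩
    refine ⟨f c, ?_⟩
    change (a : Matrix (Fin 3) (Fin 3) R).map f = _
    rw [hc]
    ext i j
    by_cases h : i = j <;> simp [h])

/-- The homomorphism `O(3) → SO(3)`, `g ↦ det(g) g`. -/
def O3.toSO : O3 R →* Matrix.specialOrthogonalGroup (Fin 3) R where
  toFun g := ⟨(g : Matrix (Fin 3) (Fin 3) R).det • (g : Matrix (Fin 3) (Fin 3) R),
    Matrix.mem_specialOrthogonalGroup_iff.2 ⟨(Matrix.mem_orthogonalGroup_iff _ _).2 (by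
      rw [Matrix.transpose_smul, Matrix.smul_mul, Matrix.mul_smul, smul_smul, O3.mul_transpose g,
        O3.det_mul_det g, one_smul]), by
      rw [Matrix.det_smul, Fintype.card_fin]
      linear_combination ((g : Matrix (Fin 3) (Fin 3) R).det ^ 2 + 1) * O3.det_mul_det g⟩⟩
  map_one' := Subtype.ext (by simp)
  map_mul' a b := Subtype.ext (by
    simp [Matrix.det_mul, smul_smul, mul_comm])

/-- The canonical isomorphism `PO(3, R) ≃ SO(3, R)` of groups: the class of `g` goes to its
unique representative `det(g) g` of determinant one. -/
def PO3.equivSO : PO3 R ≃* Matrix.specialOrthogonalGroup (Fin 3) R :=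
  MulEquiv.ofBijective (QuotientGroup.lift (scalarO3 R) O3.toSO (by
    rintro a ⟨c, hc⟩
    have h := O3.det_mul_det a
    apply Subtype.ext
    change (a : Matrix (Fin 3) (Fin 3) R).det • (a : Matrix (Fin 3) (Fin 3) R) = 1
    have h1 := O3.mul_transpose a
    rw [hc] at h h1 ⊢
    have h2 := congrFun (congrFun h1 0) 0
    simp at h2
    rw [Matrix.det_smul, Fintype.card_fin, Matrix.det_one, smul_smul,
      show c ^ 3 * 1 * c = (c * c) * (c * c) by ring, h2]
    simp)) (by
    constructor
    · rw [injective_iff_map_eq_one]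
      intro a
      induction a using QuotientGroup.induction_on with
      | H g =>
        intro h
        rw [QuotientGroup.eq_one_iff]
        have h1 : (g : Matrix (Fin 3) (Fin 3) R).det • (g : Matrix (Fin 3) (Fin 3) R) = 1 :=
          congrArg Subtype.val h
        refine ⟨(g : Matrix (Fin 3) (Fin 3) R).det, ?_⟩
        rw [← h1, smul_smul, O3.det_mul_det, one_smul]
    · intro a
      have ha := Matrix.mem_specialOrthogonalGroup_iff.1 a.2
      refine ⟨QuotientGroup.mk ⟨a.1, ha.1⟩, Subtype.ext ?_⟩
      change (a.1).det • a.1 = a.1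
      rw [ha.2, one_smul])

theorem PO3.equivSO_map (f : R →+* S) (a : PO3 R) :
    (PO3.equivSO (PO3.map f a)).1 = (PO3.equivSO a).1.map f := by
  induction a using QuotientGroup.induction_on with
  | H g =>
    change ((g : Matrix (Fin 3) (Fin 3) R).map f).det • ((g : Matrix (Fin 3) (Fin 3) R).map f) =
      ((g : Matrix (Fin 3) (Fin 3) R).det • (g : Matrix (Fin 3) (Fin 3) R)).map f
    have : ((g : Matrix (Fin 3) (Fin 3) R).map f).det = f (g : Matrix (Fin 3) (Fin 3) R).det :=
      (RingHom.map_det f _).symm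
    rw [this]
    ext i j
    simp

end PO3

/-! ### The representation scheme `Hom(Γ, PO(3))` -/

section Rep

variable (Γ : Type) [Group Γ]

/-- The matrix of indeterminates attached to `γ`. -/
def genericMatrix (γ : Γ) : Matrix (Fin 3) (Fin 3) (MvPolynomial (Γ × Fin 3 × Fin 3) ℚ) :=
  Matrix.of fun i j => MvPolynomial.X (γ, i, j)

/-- The equations saying that the matrices attached to the elements of `Γ` are orthogonal of
determinant one and multiply as the elements of `Γ` do. -/
def repRelations : Set (MvPolynomial (Γ × Fin 3 × Fin 3) ℚ) :=
  {p | ∃ γ δ i j, p = (genericMatrix Γ (γ * δ) - genericMatrix Γ γ * genericMatrix Γ δ) i j} ∪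
  {p | ∃ γ i j, p = (genericMatrix Γ γ * (genericMatrix Γ γ).transpose - 1) i j} ∪
  {p | ∃ γ, p = (genericMatrix Γ γ).det - 1}

/-- The coordinate ring of the representation scheme `Hom(Γ, PO(3))` over `ℚ`, written with the
identification `PO(3) = SO(3)`. See `points` for the functor it represents. -/
def RepRing : Type := MvPolynomial (Γ × Fin 3 × Fin 3) ℚ ⧸ Ideal.span (repRelations Γ)

instance : CommRing (RepRing Γ) :=
  inferInstanceAs (CommRing (MvPolynomial (Γ × Fin 3 × Fin 3) ℚ ⧸ Ideal.span (repRelations Γ)))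

instance : Algebra ℚ (RepRing Γ) :=
  inferInstanceAs (Algebra ℚ (MvPolynomial (Γ × Fin 3 × Fin 3) ℚ ⧸ Ideal.span (repRelations Γ)))

/-- The projection from the polynomial ring. -/
def RepRing.mk : MvPolynomial (Γ × Fin 3 × Fin 3) ℚ →ₐ[ℚ] RepRing Γ :=
  Ideal.Quotient.mkₐ ℚ (Ideal.span (repRelations Γ))

theorem RepRing.mk_eq_zero {p : MvPolynomial (Γ × Fin 3 × Fin 3) ℚ} (hp : p ∈ repRelations Γ) :
    RepRing.mk Γ p = 0 :=
  Ideal.Quotient.eq_zero_iff_mem.2 (Ideal.subset_span hp)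

/-- The matrix of coordinate functions of `ρ(γ)`. -/
def univMatrix (γ : Γ) : Matrix (Fin 3) (Fin 3) (RepRing Γ) :=
  (genericMatrix Γ γ).map (RepRing.mk Γ)

theorem univMatrix_mul (γ δ : Γ) :
    univMatrix Γ (γ * δ) = univMatrix Γ γ * univMatrix Γ δ := by
  have h : ∀ i j, RepRing.mk Γ
      ((genericMatrix Γ (γ * δ) - genericMatrix Γ γ * genericMatrix Γ δ) i j) = 0 :=
    fun i j => RepRing.mk_eq_zero Γ (Or.inl (Or.inl ⟨γ, δ, i, j, rfl⟩))
  unfold univMatrix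
  rw [← Matrix.map_mul]
  ext i j
  simpa [sub_eq_zero] using h i j

theorem univMatrix_mem (γ : Γ) :
    univMatrix Γ γ ∈ Matrix.specialOrthogonalGroup (Fin 3) (RepRing Γ) := by
  rw [Matrix.mem_specialOrthogonalGroup_iff, Matrix.mem_orthogonalGroup_iff]
  constructor
  · have h : ∀ i j, RepRing.mk Γ
        ((genericMatrix Γ γ * (genericMatrix Γ γ).transpose - 1) i j) = 0 :=
      fun i j => RepRing.mk_eq_zero Γ (Or.inl (Or.inr ⟨γ, i, j, rfl⟩))
    unfold univMatrix
    rw [← Matrix.transpose_map, ← Matrix.map_mul,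
      ← Matrix.map_one (RepRing.mk Γ) (map_zero _) (map_one _)]
    ext i j
    simpa only [Matrix.sub_apply, map_sub, sub_eq_zero, Matrix.map_apply] using h i j
  · have h : RepRing.mk Γ ((genericMatrix Γ γ).det - 1) = 0 :=
      RepRing.mk_eq_zero Γ (Or.inr ⟨γ, rfl⟩)
    rw [map_sub, map_one, sub_eq_zero] at h
    rw [← h]
    exact (AlgHom.map_det (RepRing.mk Γ) (genericMatrix Γ γ)).symm

/-- The universal representation of `Γ` in `PO(3)`. -/
def univRep : Γ →* PO3 (RepRing Γ) :=
  MonoidHom.comp (PO3.equivSO.symm.toMonoidHom)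
    (MonoidHom.mk' (fun γ => (⟨univMatrix Γ γ, univMatrix_mem Γ γ⟩ :
      Matrix.specialOrthogonalGroup (Fin 3) (RepRing Γ)))
      (fun a b => Subtype.ext (univMatrix_mul Γ a b)))

variable {Γ} {R : Type*} [CommRing R] [Algebra ℚ R]

/-- The representation attached to a point of the representation scheme. -/
def repOf (φ : RepRing Γ →ₐ[ℚ] R) : Γ →* PO3 R :=
  (PO3.map (φ : RepRing Γ →+* R)).comp (univRep Γ)

theorem equivSO_repOf (φ : RepRing Γ →ₐ[ℚ] R) (γ : Γ) :
    (PO3.equivSO (repOf φ γ)).1 = (univMatrix Γ γ).map φ := by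
  have h : repOf φ γ = PO3.map (φ : RepRing Γ →+* R) (univRep Γ γ) := rfl
  rw [h, PO3.equivSO_map]
  have h2 : PO3.equivSO (univRep Γ γ) = ⟨univMatrix Γ γ, univMatrix_mem Γ γ⟩ := by
    simp [univRep]
  rw [h2]
  rfl

/-- The polynomial evaluation at a representation. -/
def evalRep (ρ : Γ →* PO3 R) : MvPolynomial (Γ × Fin 3 × Fin 3) ℚ →ₐ[ℚ] R :=
  MvPolynomial.aeval fun t => (PO3.equivSO (ρ t.1)).1 t.2.1 t.2.2

theorem genericMatrix_map_evalRep (ρ : Γ →* PO3 R) (γ : Γ) :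
    (genericMatrix Γ γ).map (evalRep ρ) = (PO3.equivSO (ρ γ)).1 := by
  ext i j
  simp [genericMatrix, evalRep]

/-- The point of the representation scheme attached to a representation. -/
def pointOf (ρ : Γ →* PO3 R) : RepRing Γ →ₐ[ℚ] R :=
  Ideal.Quotient.liftₐ (Ideal.span (repRelations Γ)) (evalRep ρ) (by
    have key : Ideal.span (repRelations Γ) ≤ RingHom.ker (evalRep ρ) := by
      rw [Ideal.span_le]
      have ho : ∀ γ, _ := fun γ =>
        Matrix.mem_specialOrthogonalGroup_iff.1 (PO3.equivSO (ρ γ)).2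
      rintro p ((⟨γ, δ, i, j, rfl⟩ | ⟨γ, i, j, rfl⟩) | ⟨γ, rfl⟩)
      · have h : (genericMatrix Γ (γ * δ) - genericMatrix Γ γ * genericMatrix Γ δ).map
            (evalRep ρ) = 0 := by
          rw [Matrix.map_sub (evalRep ρ) (map_sub _), Matrix.map_mul]
          simp only [genericMatrix_map_evalRep]
          simp
        exact congrFun (congrFun h i) j
      · have h : (genericMatrix Γ γ * (genericMatrix Γ γ).transpose - 1).map
            (evalRep ρ) = 0 := by
          rw [Matrix.map_sub (evalRep ρ) (map_sub _), Matrix.map_mul, Matrix.transpose_map,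
            Matrix.map_one (evalRep ρ) (map_zero _) (map_one _)]
          simp only [genericMatrix_map_evalRep]
          rw [(Matrix.mem_orthogonalGroup_iff _ _).1 (ho γ).1, sub_self]
        exact congrFun (congrFun h i) j
      · change evalRep ρ _ = 0
        rw [map_sub, map_one, sub_eq_zero]
        have h := AlgHom.map_det (evalRep ρ) (genericMatrix Γ γ)
        rw [h]
        change ((genericMatrix Γ γ).map (evalRep ρ)).det = 1
        rw [genericMatrix_map_evalRep]
        exact (ho γ).2
    exact fun a ha => key ha)

/-- The representation scheme represents `R ↦ Hom(Γ, PO(3, R))`. -/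
def points : (RepRing Γ →ₐ[ℚ] R) ≃ (Γ →* PO3 R) where
  toFun := repOf
  invFun := pointOf
  left_inv φ := by
    apply Ideal.Quotient.algHom_ext
    apply MvPolynomial.algHom_ext
    rintro ⟨γ, i, j⟩
    have h := congrFun (congrFun (equivSO_repOf φ γ) i) j
    change evalRep (repOf φ) (MvPolynomial.X (γ, i, j)) = φ (RepRing.mk Γ (MvPolynomial.X (γ, i, j)))
    simp only [evalRep, MvPolynomial.aeval_X]
    rw [h]
    rfl
  right_inv ρ := by
    ext γ
    apply PO3.equivSO.injective
    apply Subtype.ext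
    rw [equivSO_repOf]
    exact genericMatrix_map_evalRep ρ γ

/-- The conjugation action `(g, ρ) ↦ g ρ g⁻¹` on representations. -/
def conjRep {H : Type*} [Group H] (g : H) (ρ : Γ →* H) : Γ →* H :=
  (MulAut.conj g).toMonoidHom.comp ρ

variable (Γ)

/-- The ring of invariants: the regular functions on `Hom(Γ, PO(3))` that are constant along
the conjugation action of the group scheme `PO(3)`, tested on points in all `ℚ`-algebras. -/
def charRing : Subalgebra ℚ (RepRing Γ) where
  carrier := {a | ∀ (R : Type) [CommRing R] [Algebra ℚ R] (ρ : Γ →* PO3 R) (g : PO3 R),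
    pointOf (conjRep g ρ) a = pointOf ρ a}
  mul_mem' ha hb R _ _ ρ g := by rw [map_mul, map_mul, ha R ρ g, hb R ρ g]
  add_mem' ha hb R _ _ ρ g := by rw [map_add, map_add, ha R ρ g, hb R ρ g]
  algebraMap_mem' r R _ _ ρ g := by rw [AlgHom.commutes, AlgHom.commutes]

/-- The representation scheme `Hom(Γ, PO(3))`. -/
def homScheme : Scheme.{0} := Spec (CommRingCat.of (RepRing Γ))

/-- The character scheme `X(Γ, PO(3)) = Hom(Γ, PO(3)) // PO(3)`. -/
def charScheme : Scheme.{0} := Spec (CommRingCat.of (charRing Γ))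

/-- The quotient morphism `Hom(Γ, PO(3)) ⟶ X(Γ, PO(3))`. -/
def quotientMap : homScheme Γ ⟶ charScheme Γ :=
  Spec.map (CommRingCat.ofHom (charRing Γ).val.toRingHom)

/-- The structure morphism of the character scheme. -/
def charSchemeToSpec : charScheme Γ ⟶ Spec (CommRingCat.of ℚ) :=
  Spec.map (CommRingCat.ofHom (algebraMap ℚ (charRing Γ)))

variable {Γ}

/-- The `R`-point of `Hom(Γ, PO(3))` given by a representation over `R`. -/
def homPoint {R : Type} [CommRing R] [Algebra ℚ R] (ρ : Γ →* PO3 R) :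
    Spec (CommRingCat.of R) ⟶ homScheme Γ :=
  Spec.map (CommRingCat.ofHom (pointOf ρ).toRingHom)

/-- The complexification of a representation in `PO(3, ℝ)`. -/
def complexify (ρ : Γ →* PO3 ℝ) : Γ →* PO3 ℂ :=
  (PO3.map Complex.ofRealHom).comp ρ

/-- The set of representations over `ℂ` is the set of complex points of the representation
scheme; a complex polynomial function on it is an element of `ℂ ⊗ RepRing Γ`. -/
def complexEval (ρ : Γ →* PO3 ℂ) : ℂ ⊗[ℚ] RepRing Γ →ₐ[ℂ] ℂ :=
  Algebra.TensorProduct.lift (AlgHom.id ℂ ℂ) (pointOf ρ) (fun _ _ => Commute.all _ _)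

/-- Stable points: the orbit is Zariski closed in `Hom(Γ, PO(3, ℂ))` and the stabilizer (which is
the centralizer of the image) is finite. -/
def IsStable (ρ : Γ →* PO3 ℂ) : Prop :=
  (∃ E : Set (ℂ ⊗[ℚ] RepRing Γ), ∀ ρ' : Γ →* PO3 ℂ,
    (∃ g : PO3 ℂ, ρ' = conjRep g ρ) ↔ ∀ e ∈ E, complexEval ρ' e = 0) ∧
  Finite (Subgroup.centralizer (Set.range ρ))

end Rep

/-! ### Coxeter groups and the subschemes `Hom_o`, `X_o` -/

section Coxeter

variable {n : ℕ} (M : CoxeterMatrix (Fin n))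

/-- Elementary subgroups: finite parabolic subgroups of rank at most two. -/
def IsElementary (H : Subgroup M.Group) : Prop :=
  Finite H ∧ ∃ T : Finset (Fin n), T.card ≤ 2 ∧ H = Subgroup.closure (M.simple '' (T : Set (Fin n)))

/-- The homomorphism is injective on every elementary subgroup. -/
def InjOnElementary {G : Type*} [Group G] (ρ : M.Group →* G) : Prop :=
  ∀ H : Subgroup M.Group, IsElementary M H → Set.InjOn ρ H

/-- The representation over the residue field at a point of the representation scheme. -/
def repAt {Γ : Type} [Group Γ] (p : PrimeSpectrum (RepRing Γ)) :
    Γ →* PO3 p.asIdeal.ResidueField :=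
  repOf (IsScalarTower.toAlgHom ℚ (RepRing Γ) p.asIdeal.ResidueField)

theorem isOpen_repAt_ne_one {Γ : Type} [Group Γ] (γ : Γ) :
    IsOpen {p : PrimeSpectrum (RepRing Γ) | repAt p γ ≠ 1} := by
  have h : {p : PrimeSpectrum (RepRing Γ) | repAt p γ ≠ 1} =
      (PrimeSpectrum.zeroLocus
        {a | ∃ i j, a = (univMatrix Γ γ - 1) i j})ᶜ := by
    ext p
    simp only [Set.mem_ofPred_eq, Set.mem_compl_iff, PrimeSpectrum.mem_zeroLocus, ne_eq, not_iff_not]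
    have h1 : repAt p γ = 1 ↔
        (univMatrix Γ γ).map (algebraMap (RepRing Γ) p.asIdeal.ResidueField) = 1 := by
      rw [← PO3.equivSO.injective.eq_iff, map_one, Subtype.ext_iff]
      unfold repAt
      rw [equivSO_repOf]
      rfl
    rw [h1]
    have h3 : (univMatrix Γ γ).map (algebraMap (RepRing Γ) p.asIdeal.ResidueField) = 1 ↔
        ∀ i j, algebraMap (RepRing Γ) p.asIdeal.ResidueField ((univMatrix Γ γ - 1) i j) = 0 := by
      rw [← Matrix.map_one (algebraMap (RepRing Γ) p.asIdeal.ResidueField) (map_zero _)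
        (map_one _), ← Matrix.ext_iff]
      simp only [Matrix.map_apply, Matrix.sub_apply, map_sub, sub_eq_zero]
    rw [h3]
    simp only [Ideal.algebraMap_residueField_eq_zero]
    constructor
    · rintro h a ⟨i, j, rfl⟩
      exact h i j
    · intro h i j
      exact h ⟨i, j, rfl⟩
  rw [h]
  exact (PrimeSpectrum.isClosed_zeroLocus _).isOpen_compl

theorem isOpen_homO :
    IsOpen {p : PrimeSpectrum (RepRing M.Group) | InjOnElementary M (repAt p)} := by
  have h : {p : PrimeSpectrum (RepRing M.Group) | InjOnElementary M (repAt p)} =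
      ⋂ H ∈ {H : Subgroup M.Group | IsElementary M H}, ⋂ γ ∈ {γ : M.Group | γ ∈ H ∧ γ ≠ 1},
        {p | repAt p γ ≠ 1} := by
    ext p
    simp only [Set.mem_iInter, Set.mem_ofPred_eq]
    constructor
    · intro h H hH γ hγ h1
      exact hγ.2 (h H hH hγ.1 H.one_mem (by rw [h1, map_one]))
    · intro h H hH a ha b hb hab
      by_contra hne
      refine h H hH (a * b⁻¹) ⟨H.mul_mem ha (H.inv_mem hb), fun h1 => hne (mul_inv_eq_one.1 h1)⟩ ?_
      rw [map_mul, map_inv, hab, mul_inv_cancel]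
  rw [h]
  have hfin : {H : Subgroup M.Group | IsElementary M H}.Finite :=
    (Set.finite_range fun T : Finset (Fin n) =>
      Subgroup.closure (M.simple '' (T : Set (Fin n)))).subset (by
        rintro H ⟨-, T, -, rfl⟩
        exact ⟨T, rfl⟩)
  refine hfin.isOpen_biInter fun H hH => ?_
  have hH1 : (H : Set M.Group).Finite := Set.finite_coe_iff.1 hH.1
  exact (hH1.subset fun γ hγ => hγ.1).isOpen_biInter fun γ _ => isOpen_repAt_ne_one γ

/-- `Hom_o(Γ, PO(3))`: the open subscheme of the representation scheme whose points are the
representations that are injective on every elementary subgroup. -/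
def homO : (homScheme M.Group).Opens :=
  ⟨{p : PrimeSpectrum (RepRing M.Group) | InjOnElementary M (repAt p)}, isOpen_homO M⟩

/-- `X_o(Γ, PO(3))` as a subset: the projection of `Hom_o(Γ, PO(3))` to the character scheme. -/
def charOSet : Set (charScheme M.Group) :=
  quotientMap M.Group '' (homO M : Set (homScheme M.Group))

/-- The standing assumptions under which `X_o` is considered (besides evenness of the labels):
for every complex representation injective on the elementary subgroups, the centralizer of the
image is the center of `PO(3, ℂ)`, and the representation is a stable point. -/
def StandingAssumption : Prop :=
  ∀ ρ : M.Group →* PO3 ℂ, InjOnElementary M ρ →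
    Subgroup.centralizer (Set.range ρ) = Subgroup.center (PO3 ℂ) ∧ IsStable ρ

/-- A cross-section of the action of `PO(3)` on `Hom_o(Γ, PO(3))`: a closed subscheme of
`Hom_o(Γ, PO(3))` that the quotient morphism maps isomorphically onto `X_o(Γ, PO(3))`. -/
def IsCrossSection (Xo : (charScheme M.Group).Opens) {Z : Scheme.{0}}
    (ι : Z ⟶ (homO M).toScheme) : Prop :=
  IsClosedImmersion ι ∧
    ∃ e : Z ≅ Xo.toScheme, e.hom ≫ Xo.ι = ι ≫ (homO M).ι ≫ quotientMap M.Group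

end Coxeter

end KM

end

/-
An element of order two of `PO(3)` with eigenvalues `1, -1, -1` is the half-turn about a line, so a
representation of a Coxeter group places one line per generator; two half-turns commute when their
lines are orthogonal (label `2`) and their product has order four when the lines meet at `45°`
(label `4`). Three coordinate axes and two of their bisectors form a frame whose stabilizer in
`PO(3)` is trivial and whose configurations are all conjugate. Hence each orbit in `Hom_o` meets
exactly once the slice where the frame generators are the standard half-turns, invariant functions
are functions on that slice, and stability, openness of `X_o` and the cross-section follow.

Orthogonality and `45°` angles force a line to be spanned by the cross product of two others, so
auxiliary generators can compute: with variables encoded by the lines through `(1, xᵢ, 0)`, cross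
products carry out polynomial arithmetic, and a system of polynomial equations becomes a Coxeter
group whose slice is, locally, the scheme it defines. Density comes from two half-turns whose
product is the rotation by `2 arctan 2`, an irrational multiple of `π`.
-/

noncomputable section

namespace KM

section HalfTurns

open Matrix

theorem isUnit_ofNat (A : Type*) [Ring A] [Algebra ℚ A] (n : ℕ) [n.AtLeastTwo] :
    IsUnit (ofNat(n) : A) := by
  simpa only [map_ofNat] using
    (IsUnit.mk0 (ofNat(n) : ℚ) (OfNat.ofNat_ne_zero n)).map (algebraMap ℚ A)

variable {R : Type*} [CommRing R] {C N P Q X Y Z : Matrix (Fin 3) (Fin 3) R}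

/-- The polarised Cayley–Hamilton identity of degree three. -/
theorem mul_mul_eq_add_adjugate (N X : Matrix (Fin 3) (Fin 3) R) :
    N * X * N = (N * X).trace • N + N.adjugate.trace • X + X.trace • N.adjugate - X * N.adjugate
      - N.adjugate * X - (X.trace * N.adjugate.trace - (X * N.adjugate).trace) • 1 := by
  ext i j
  simp only [Matrix.mul_apply, Matrix.add_apply, Matrix.sub_apply, Matrix.smul_apply, smul_eq_mul,
    Matrix.one_apply, trace_fin_three, Fin.sum_univ_three, adjugate_fin_three]
  fin_cases i <;> fin_cases j <;> simp <;> ring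

theorem adjugate_eq_sq_sub (N : Matrix (Fin 3) (Fin 3) R) :
    N.adjugate = N * N - N.trace • N + N.adjugate.trace • 1 := by
  have h := mul_mul_eq_add_adjugate N 1
  simp only [mul_one, one_mul, trace_one, Fintype.card_fin] at h
  rw [h]
  module

theorem two_mul_trace_adjugate (N : Matrix (Fin 3) (Fin 3) R) :
    2 * N.adjugate.trace = N.trace * N.trace - (N * N).trace := by
  have h := congrArg trace (adjugate_eq_sq_sub N)
  simp only [trace_add, trace_sub, trace_smul, trace_one, Fintype.card_fin, smul_eq_mul] at h
  linear_combination -h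

theorem det_two_mul_sub_one (N : Matrix (Fin 3) (Fin 3) R) :
    (2 * N - 1).det = 8 * N.det - 4 * N.adjugate.trace + 2 * N.trace - 1 := by
  rw [two_mul, adjugate_fin_three]
  simp [det_fin_three, trace_fin_three]
  ring

theorem mul_transpose_of_mem (hC : C ∈ specialOrthogonalGroup (Fin 3) R) : C * Cᵀ = 1 :=
  (mem_orthogonalGroup_iff _ _).1 (mem_specialOrthogonalGroup_iff.1 hC).1

theorem transpose_mul_of_mem (hC : C ∈ specialOrthogonalGroup (Fin 3) R) : Cᵀ * C = 1 :=
  mul_eq_one_comm.1 (mul_transpose_of_mem hC)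

theorem det_of_mem (hC : C ∈ specialOrthogonalGroup (Fin 3) R) : C.det = 1 :=
  (mem_specialOrthogonalGroup_iff.1 hC).2

theorem mem_specialOrthogonalGroup_of_det (h : C * Cᵀ = 1) (hd : C.det = 1) :
    C ∈ specialOrthogonalGroup (Fin 3) R :=
  mem_specialOrthogonalGroup_iff.2 ⟨(mem_orthogonalGroup_iff _ _).2 h, hd⟩

theorem adjugate_of_mem (hC : C ∈ specialOrthogonalGroup (Fin 3) R) : C.adjugate = Cᵀ :=
  calc C.adjugate = (Cᵀ * C) * C.adjugate := by rw [transpose_mul_of_mem hC, one_mul]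
    _ = Cᵀ := by rw [mul_assoc, mul_adjugate, det_of_mem hC, one_smul, mul_one]

theorem transpose_eq_of_mem (hC : C ∈ specialOrthogonalGroup (Fin 3) R) :
    Cᵀ = C * C - C.trace • C + C.trace • 1 := by
  simpa only [adjugate_of_mem hC, trace_transpose] using adjugate_eq_sq_sub C

theorem trace_mul_self_of_mem (hC : C ∈ specialOrthogonalGroup (Fin 3) R) :
    (C * C).trace = C.trace * C.trace - 2 * C.trace := by
  have h := two_mul_trace_adjugate C
  rw [adjugate_of_mem hC, trace_transpose] at h
  linear_combination h

theorem pow_three_of_mem (hC : C ∈ specialOrthogonalGroup (Fin 3) R) :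
    C ^ 3 = C.trace • C ^ 2 - C.trace • C + 1 := by
  have h : C ^ 2 * C - C.trace • C * C + C.trace • C = 1 := by
    simpa only [transpose_mul_of_mem hC, pow_two, add_mul, sub_mul, smul_mul_assoc, one_mul]
      using (congrArg (· * C) (transpose_eq_of_mem hC)).symm
  rw [pow_succ, ← h, smul_mul_assoc, ← pow_two]
  abel

theorem transpose_of_involution (hC : C ∈ specialOrthogonalGroup (Fin 3) R) (h : C * C = 1) :
    Cᵀ = C :=
  left_inv_eq_right_inv (transpose_mul_of_mem hC) h

theorem trace_of_involution (hC : C ∈ specialOrthogonalGroup (Fin 3) R) (h : C * C = 1) :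
    (C.trace - 3) * (C.trace + 1) = 0 := by
  have ht := trace_mul_self_of_mem hC
  rw [h, trace_one, Fintype.card_fin] at ht
  push_cast at ht
  linear_combination -ht

theorem eq_one_of_trace_three [Algebra ℚ R] (hC : C ∈ specialOrthogonalGroup (Fin 3) R)
    (h : C * C = 1) (ht : C.trace = 3) : C = 1 := by
  have key := transpose_eq_of_mem hC
  rw [transpose_of_involution hC h, h, ht] at key
  refine (isUnit_ofNat (Matrix (Fin 3) (Fin 3) R) 4).mul_left_cancel ?_
  calc 4 * C = C + (3 : R) • C := by rw [ofNat_smul_eq_nsmul]; noncomm_ring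
    _ = 1 + (3 : R) • 1 := by nth_rewrite 1 [key]; abel
    _ = 4 * 1 := by rw [ofNat_smul_eq_nsmul]; noncomm_ring

/-- Symmetric idempotents of trace one: orthogonal projections to nondegenerate lines. -/
structure IsLineProj (P : Matrix (Fin 3) (Fin 3) R) : Prop where
  symm : Pᵀ = P
  idem : P * P = P
  trace : P.trace = 1

/-- Half-turns, characterised among the involutions in `SO(3)` by their trace, so that the notion
is the right one over any `ℚ`-algebra. -/
structure IsHalfTurn (A : Matrix (Fin 3) (Fin 3) R) : Prop where
  mem : A ∈ specialOrthogonalGroup (Fin 3) R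
  sq : A * A = 1
  trace : A.trace = -1

theorem IsHalfTurn.symm {A : Matrix (Fin 3) (Fin 3) R} (hA : IsHalfTurn A) : Aᵀ = A :=
  transpose_of_involution hA.mem hA.sq

theorem IsHalfTurn.exists_lineProj [Algebra ℚ R] {A : Matrix (Fin 3) (Fin 3) R}
    (hA : IsHalfTurn A) : ∃ P, IsLineProj P ∧ A = 2 * P - 1 := by
  have half : ∀ N : Matrix (Fin 3) (Fin 3) R, 2 * ((2⁻¹ : ℚ) • N) = N := fun N => by
    rw [two_mul]; module
  refine ⟨(2⁻¹ : ℚ) • (A + 1), ⟨?_, ?_, ?_⟩, by rw [half, add_sub_cancel_right]⟩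
  · rw [transpose_smul, transpose_add, hA.symm, transpose_one]
  · simp only [smul_mul_smul_comm, add_mul, mul_add, hA.sq, mul_one, one_mul]
    module
  · have htrace : 2 * ((2⁻¹ : ℚ) • (A + 1).trace) = (A + 1).trace := by rw [two_mul]; module
    rw [trace_smul]
    refine (isUnit_ofNat R 2).mul_left_cancel ?_
    rw [htrace, trace_add, hA.trace, trace_one, Fintype.card_fin]
    norm_num

namespace IsLineProj

theorem mul_eq_zero_comm (hP : IsLineProj P) (hQ : IsLineProj Q) (h : P * Q = 0) : Q * P = 0 := by
  simpa only [transpose_mul, hP.symm, hQ.symm, transpose_zero] using congrArg transpose h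

theorem one_sub_sub (hP : IsLineProj P) (hQ : IsLineProj Q) (h : P * Q = 0) :
    IsLineProj (1 - P - Q) where
  symm := by rw [transpose_sub, transpose_sub, transpose_one, hP.symm, hQ.symm]
  idem := by
    simp only [mul_sub, sub_mul, mul_one, one_mul, hP.idem, hQ.idem, h, hP.mul_eq_zero_comm hQ h]
    abel
  trace := by
    rw [trace_sub, trace_sub, hP.trace, hQ.trace, trace_one, Fintype.card_fin]; norm_num

theorem conj {A : Matrix (Fin 3) (Fin 3) R} (hP : IsLineProj P) (hA : IsHalfTurn A) :
    IsLineProj (A * P * A) where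
  symm := by simp only [transpose_mul, hA.symm, hP.symm, mul_assoc]
  idem := calc
    A * P * A * (A * P * A) = A * P * (A * A) * P * A := by noncomm_ring
    _ = A * P * A := by rw [hA.sq, mul_one, mul_assoc A, hP.idem]
  trace := by rw [trace_mul_comm, ← mul_assoc, hA.sq, one_mul, hP.trace]

theorem trace_mul_two_mul_sub_one (hP : IsLineProj P) (hQ : IsLineProj Q) :
    ((2 * P - 1) * (2 * Q - 1)).trace = 4 * (P * Q).trace - 1 := by
  have h : (2 * P - 1) * (2 * Q - 1)
      = (P * Q + P * Q) + (P * Q + P * Q) - (P + P) - (Q + Q) + 1 := by noncomm_ring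
  rw [h]
  simp only [trace_add, trace_sub, hP.trace, hQ.trace, trace_one, Fintype.card_fin]
  push_cast
  ring

variable [Algebra ℚ R]

theorem adjugate (hP : IsLineProj P) : P.adjugate = 0 := by
  have h : P.adjugate.trace = 0 := by
    refine (isUnit_ofNat R 2).mul_left_cancel ?_
    rw [two_mul_trace_adjugate, hP.idem, hP.trace]
    ring
  rw [adjugate_eq_sq_sub, h, hP.idem, hP.trace, one_smul, sub_self, zero_smul, zero_add]

theorem mul_mul_self (hP : IsLineProj P) (X : Matrix (Fin 3) (Fin 3) R) :
    P * X * P = (P * X).trace • P := by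
  simpa [hP.adjugate] using mul_mul_eq_add_adjugate P X

theorem eq_of_mul_eq_left (hP : IsLineProj P) (hQ : IsLineProj Q) (h : P * Q = P) : P = Q := by
  have h' : Q * P = P := by
    simpa only [transpose_mul, hP.symm, hQ.symm] using congrArg transpose h
  simpa only [h', h, hP.trace, one_smul] using hQ.mul_mul_self P

theorem sum_eq_one (hX : IsLineProj X) (hY : IsLineProj Y) (hZ : IsLineProj Z)
    (hXY : X * Y = 0) (hYZ : Y * Z = 0) (hXZ : X * Z = 0) : X + Y + Z = 1 := by
  have hZ' : Z = 1 - X - Y := hZ.eq_of_mul_eq_left (hX.one_sub_sub hY hXY) <| by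
    rw [mul_sub, mul_sub, mul_one, hX.mul_eq_zero_comm hZ hXZ, hY.mul_eq_zero_comm hZ hYZ,
      sub_zero, sub_zero]
  rw [hZ']
  abel

theorem isHalfTurn (hP : IsLineProj P) : IsHalfTurn (2 * P - 1) := by
  have hsq : (2 * P - 1) * (2 * P - 1) = 1 :=
    calc (2 * P - 1) * (2 * P - 1) = 4 * (P * P) - 4 * P + 1 := by noncomm_ring
      _ = 1 := by rw [hP.idem]; abel
  have hsymm : (2 * P - 1)ᵀ = 2 * P - 1 := by
    rw [two_mul, transpose_sub, transpose_add, hP.symm, transpose_one]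
  have hdet : P.det = 0 := by
    simpa [hP.adjugate] using (congrFun (congrFun (mul_adjugate P) 0) 0).symm
  refine ⟨mem_specialOrthogonalGroup_of_det (by rw [hsymm, hsq]) ?_, hsq, ?_⟩
  · rw [det_two_mul_sub_one, hdet, hP.adjugate, hP.trace, trace_zero]
    ring
  · rw [two_mul, trace_sub, trace_add, hP.trace, trace_one, Fintype.card_fin]
    norm_num

theorem mul_eq_zero_iff_isHalfTurn (hP : IsLineProj P) (hQ : IsLineProj Q) :
    P * Q = 0 ↔ IsHalfTurn ((2 * P - 1) * (2 * Q - 1)) := by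
  constructor
  · intro h
    have hprod : (2 * P - 1) * (2 * Q - 1) = 2 * (1 - P - Q) - 1 :=
      calc (2 * P - 1) * (2 * Q - 1) = 4 * (P * Q) - 2 * P - 2 * Q + 1 := by noncomm_ring
        _ = 2 * (1 - P - Q) - 1 := by rw [h]; noncomm_ring
    exact hprod ▸ (hP.one_sub_sub hQ h).isHalfTurn
  · intro h
    have hcomm : (2 * Q - 1) * (2 * P - 1) = (2 * P - 1) * (2 * Q - 1) := by
      simpa only [transpose_mul, hP.isHalfTurn.symm, hQ.isHalfTurn.symm] using h.symm
    have hPQ : P * Q = Q * P := by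
      refine (isUnit_ofNat (Matrix (Fin 3) (Fin 3) R) 4).mul_left_cancel ?_
      have expand : ∀ U V : Matrix (Fin 3) (Fin 3) R,
          4 * (U * V) = (2 * U - 1) * (2 * V - 1) + 2 * U + 2 * V - 1 := fun U V => by noncomm_ring
      rw [expand, expand, hcomm]
      abel
    have ht : (P * Q).trace = 0 := by
      refine (isUnit_ofNat R 4).mul_left_cancel ?_
      linear_combination h.trace - hP.trace_mul_two_mul_sub_one hQ
    calc P * Q = P * Q * P := by rw [mul_assoc, ← hPQ, ← mul_assoc, hP.idem]
      _ = 0 := by rw [hP.mul_mul_self, ht, zero_smul]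

/-- With `A` the half-turn about `D`, the line `A * X * A` is orthogonal to `X`, because
`X * A * X = tr (X * A) • X = 0`, and to `Z`, because `A * Z = -Z`. -/
theorem bisector_conj {D : Matrix (Fin 3) (Fin 3) R} (hX : IsLineProj X) (hY : IsLineProj Y)
    (hD : IsLineProj D) (hXZ : X * Z = 0) (hsum : X + Y + Z = 1) (hDZ : D * Z = 0)
    (ht : 2 * (D * X).trace = 1) : (2 * D - 1) * X * (2 * D - 1) = Y := by
  obtain ⟨A, hA⟩ : ∃ A, A = 2 * D - 1 := ⟨_, rfl⟩
  have hAX : X * A * X = 0 := by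
    have : (X * A).trace = 0 := by
      rw [hA, mul_sub, mul_one, trace_sub, hX.trace, two_mul, mul_add, trace_add,
        trace_mul_comm X D]
      linear_combination ht
    rw [hX.mul_mul_self, this, zero_smul]
  have hAZ : A * Z = -Z := by
    rw [hA, sub_mul, mul_assoc, hDZ, mul_zero, one_mul, zero_sub]
  rw [← hA]
  refine (hX.conj (hA ▸ hD.isHalfTurn)).eq_of_mul_eq_left hY ?_
  calc A * X * A * Y = A * X * A * (X + Y + Z) - A * (X * A * X) - A * X * (A * Z) := by
        noncomm_ring
    _ = A * X * A := by
        rw [hsum, hAX, hAZ, mul_neg, mul_assoc A X Z, hXZ]; simp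

end IsLineProj

theorem isHalfTurn_sq_iff [Algebra ℚ R] (hC : C ∈ specialOrthogonalGroup (Fin 3) R) :
    IsHalfTurn (C ^ 2) ↔ C.trace = 1 := by
  have hcube := pow_three_of_mem hC
  have htr : (C ^ 2).trace = C.trace * C.trace - 2 * C.trace := pow_two C ▸ trace_mul_self_of_mem hC
  constructor
  · intro h
    have hinv : C ^ 3 = Cᵀ :=
      calc C ^ 3 = C ^ 2 * C ^ 2 * Cᵀ := by
            rw [← pow_add, pow_succ C 3, mul_assoc, mul_transpose_of_mem hC, mul_one]
        _ = Cᵀ := by rw [h.sq, one_mul]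
    have key := congrArg trace hcube
    rw [hinv, trace_transpose, trace_add, trace_sub, trace_smul, trace_smul, h.trace, trace_one,
      Fintype.card_fin, smul_eq_mul, smul_eq_mul] at key
    push_cast at key
    refine (isUnit_ofNat R 4).mul_left_cancel ?_
    linear_combination key - h.trace + htr
  · intro ht
    rw [ht, one_smul, one_smul] at hcube
    refine ⟨pow_mem hC 2, ?_, by rw [htr, ht]; norm_num⟩
    calc C ^ 2 * C ^ 2 = C ^ 3 * C := by noncomm_ring
      _ = C ^ 3 - C ^ 2 + C := by nth_rewrite 1 [hcube]; noncomm_ring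
      _ = 1 := by rw [hcube]; abel

end HalfTurns

section Lines

open Matrix

variable {R : Type*} [CommRing R] {P : Matrix (Fin 3) (Fin 3) R}

/-- The orthogonal projection to the line spanned by `v`; a junk value (`0`) unless `v ⬝ᵥ v` is a
unit. -/
def lineProj (v : Fin 3 → R) : Matrix (Fin 3) (Fin 3) R :=
  Ring.inverse (v ⬝ᵥ v) • vecMulVec v v

/-- The half-turn about the line spanned by `v`; a junk value unless `v ⬝ᵥ v` is a unit. -/
def halfTurn (v : Fin 3 → R) : Matrix (Fin 3) (Fin 3) R := 2 * lineProj v - 1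

theorem isLineProj_lineProj {v : Fin 3 → R} (hv : IsUnit (v ⬝ᵥ v)) : IsLineProj (lineProj v) where
  symm := by rw [lineProj, transpose_smul, transpose_vecMulVec]
  idem := by
    rw [lineProj, smul_mul_smul_comm, vecMulVec_mul_vecMulVec, vecMulVec_smul, smul_smul,
      mul_assoc, Ring.inverse_mul_cancel _ hv, mul_one]
  trace := by rw [lineProj, trace_smul, trace_vecMulVec, smul_eq_mul, Ring.inverse_mul_cancel _ hv]

theorem lineProj_mul (v w : Fin 3 → R) :
    lineProj v * lineProj w =
      (Ring.inverse (v ⬝ᵥ v) * Ring.inverse (w ⬝ᵥ w) * (v ⬝ᵥ w)) • vecMulVec v w := by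
  rw [lineProj, lineProj, smul_mul_smul_comm, vecMulVec_mul_vecMulVec, vecMulVec_smul, smul_smul]

theorem trace_lineProj_mul (v w : Fin 3 → R) :
    (lineProj v * lineProj w).trace =
      Ring.inverse (v ⬝ᵥ v) * Ring.inverse (w ⬝ᵥ w) * (v ⬝ᵥ w) ^ 2 := by
  rw [lineProj_mul, trace_smul, trace_vecMulVec, smul_eq_mul]
  ring

theorem lineProj_mul_eq_zero {v w : Fin 3 → R} (h : v ⬝ᵥ w = 0) :
    lineProj v * lineProj w = 0 := by
  rw [lineProj_mul, h, mul_zero, zero_smul]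

theorem lineProj_of_dotProduct_self {v : Fin 3 → R} (h : v ⬝ᵥ v = 1) :
    lineProj v = vecMulVec v v := by
  rw [lineProj, h, Ring.inverse_one, one_smul]

theorem lineProj_mulVec (v x : Fin 3 → R) :
    lineProj v *ᵥ x = (Ring.inverse (v ⬝ᵥ v) * (v ⬝ᵥ x)) • v := by
  rw [lineProj, smul_mulVec, vecMulVec_mulVec, op_smul_eq_smul, smul_smul]

theorem lineProj_mulVec_self {v : Fin 3 → R} (hv : IsUnit (v ⬝ᵥ v)) : lineProj v *ᵥ v = v := by
  rw [lineProj_mulVec, Ring.inverse_mul_cancel _ hv, one_smul]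

theorem lineProj_smul {v : Fin 3 → R} {c : R} (hc : IsUnit c) :
    lineProj (c • v) = lineProj v := by
  have hinv : c * Ring.inverse c = 1 := Ring.mul_inverse_cancel _ hc
  rw [lineProj, lineProj, smul_dotProduct, dotProduct_smul, smul_eq_mul, smul_eq_mul,
    Ring.mul_inverse_rev, Ring.mul_inverse_rev, smul_vecMulVec, vecMulVec_smul, smul_smul,
    smul_smul]
  congr 1
  linear_combination
    (c * Ring.inverse c * Ring.inverse (v ⬝ᵥ v) + Ring.inverse (v ⬝ᵥ v)) * hinv

theorem mulVec_eq_zero_of_mul_lineProj {v : Fin 3 → R} (hv : IsUnit (v ⬝ᵥ v))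
    (h : P * lineProj v = 0) : P *ᵥ v = 0 := by
  rw [← lineProj_mulVec_self hv, mulVec_mulVec, h, zero_mulVec]

section BaseChange

variable {S : Type*} [CommRing S]

theorem map_ringInverse (f : R →+* S) {a : R} (ha : IsUnit a) :
    f (Ring.inverse a) = Ring.inverse (f a) :=
  (ha.map f).mul_left_cancel <| by
    rw [← map_mul, Ring.mul_inverse_cancel _ ha, map_one, Ring.mul_inverse_cancel _ (ha.map f)]

theorem map_lineProj (f : R →+* S) {v : Fin 3 → R} (hv : IsUnit (v ⬝ᵥ v)) :
    (lineProj v).map f = lineProj (f ∘ v) := by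
  ext i j
  simp [lineProj, vecMulVec_apply, map_ringInverse f hv, RingHom.map_dotProduct]

theorem map_halfTurn (f : R →+* S) {v : Fin 3 → R} (hv : IsUnit (v ⬝ᵥ v)) :
    (halfTurn v).map f = halfTurn (f ∘ v) := by
  rw [halfTurn, halfTurn, ← map_lineProj f hv, two_mul, two_mul, Matrix.map_sub f (map_sub f),
    Matrix.map_add f (map_add f), Matrix.map_one f (map_zero f) (map_one f)]

end BaseChange

section Conjugation

variable {g : Matrix (Fin 3) (Fin 3) R}

theorem mulVec_dotProduct_mulVec (hg : g ∈ specialOrthogonalGroup (Fin 3) R) (v w : Fin 3 → R) :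
    (g *ᵥ v) ⬝ᵥ (g *ᵥ w) = v ⬝ᵥ w := by
  rw [dotProduct_mulVec, vecMul_mulVec, transpose_mul_of_mem hg, vecMul_one]

theorem conj_lineProj (hg : g ∈ specialOrthogonalGroup (Fin 3) R) (v : Fin 3 → R) :
    g * lineProj v * gᵀ = lineProj (g *ᵥ v) := by
  rw [lineProj, lineProj, mulVec_dotProduct_mulVec hg, mul_smul_comm, smul_mul_assoc,
    mul_vecMulVec, vecMulVec_mul, vecMul_transpose]

theorem conj_halfTurn (hg : g ∈ specialOrthogonalGroup (Fin 3) R) (v : Fin 3 → R) :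
    g * halfTurn v * gᵀ = halfTurn (g *ᵥ v) := by
  rw [halfTurn, halfTurn, ← conj_lineProj hg, mul_sub, sub_mul, mul_one, mul_transpose_of_mem hg]
  noncomm_ring

end Conjugation

/-- The axial vector of a three-by-three matrix: the vector of its antisymmetric part. -/
def axial (K : Matrix (Fin 3) (Fin 3) R) : Fin 3 → R :=
  ![K 1 2 - K 2 1, K 2 0 - K 0 2, K 0 1 - K 1 0]

theorem axial_vecMulVec (a b : Fin 3 → R) : axial (vecMulVec a b) = crossProduct a b := by
  ext i
  fin_cases i <;> simp [axial, vecMulVec_apply, cross_apply, mul_comm]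

theorem vecMulVec_axial (K : Matrix (Fin 3) (Fin 3) R) :
    vecMulVec (axial K) (axial K) = (K - Kᵀ).adjugate := by
  rw [adjugate_fin_three]
  ext i j
  fin_cases i <;> fin_cases j <;> simp [axial, vecMulVec_apply] <;> ring

theorem cross_dot_cross_self (a b : Fin 3 → R) :
    crossProduct a b ⬝ᵥ crossProduct a b = (a ⬝ᵥ a) * (b ⬝ᵥ b) - (a ⬝ᵥ b) ^ 2 := by
  rw [cross_dot_cross, dotProduct_comm b a, pow_two]

theorem three_sub_trace_halfTurn_mul {a b : Fin 3 → R} (ha : IsUnit (a ⬝ᵥ a))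
    (hb : IsUnit (b ⬝ᵥ b)) : 3 - (halfTurn a * halfTurn b).trace =
      4 * (Ring.inverse (a ⬝ᵥ a) * Ring.inverse (b ⬝ᵥ b)
        * (crossProduct a b ⬝ᵥ crossProduct a b)) := by
  rw [halfTurn, halfTurn,
    (isLineProj_lineProj ha).trace_mul_two_mul_sub_one (isLineProj_lineProj hb),
    trace_lineProj_mul, cross_dot_cross_self]
  linear_combination (-4 * Ring.inverse (b ⬝ᵥ b) * (b ⬝ᵥ b)) * Ring.inverse_mul_cancel _ ha
    - 4 * Ring.inverse_mul_cancel _ hb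

variable [Algebra ℚ R]

theorem isUnit_three_sub_trace_iff {a b : Fin 3 → R} (ha : IsUnit (a ⬝ᵥ a))
    (hb : IsUnit (b ⬝ᵥ b)) : IsUnit (3 - (halfTurn a * halfTurn b).trace) ↔
      IsUnit (crossProduct a b ⬝ᵥ crossProduct a b) := by
  rw [three_sub_trace_halfTurn_mul ha hb, IsUnit.mul_iff, IsUnit.mul_iff, IsUnit.mul_iff]
  simp only [isUnit_ofNat R 4, ha.ringInverse, hb.ringInverse, true_and]

theorem IsLineProj.eq_lineProj_of_mulVec_eq (hP : IsLineProj P) {z : Fin 3 → R}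
    (hz : IsUnit (z ⬝ᵥ z)) (h : P *ᵥ z = z) : P = lineProj z := by
  refine ((isLineProj_lineProj hz).eq_of_mul_eq_left hP ?_).symm
  rw [lineProj, smul_mul_assoc, vecMulVec_mul, ← mulVec_transpose, hP.symm, h]

theorem IsLineProj.eq_lineProj_mulVec (hP : IsLineProj P) (x : Fin 3 → R)
    (hx : IsUnit ((P *ᵥ x) ⬝ᵥ (P *ᵥ x))) : P = lineProj (P *ᵥ x) :=
  hP.eq_lineProj_of_mulVec_eq hx (by rw [mulVec_mulVec, hP.idem])

/-- The rows `x` of `P` are orthogonal to `p` and `q`, hence parallel to `w = p × q`: the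
equation `w × x = 0` gives `(w ⬝ᵥ w) • x = (w ⬝ᵥ x) • w`. -/
theorem IsLineProj.eq_lineProj_cross (hP : IsLineProj P) {p q : Fin 3 → R} (hp : P *ᵥ p = 0)
    (hq : P *ᵥ q = 0) (hw : IsUnit (crossProduct p q ⬝ᵥ crossProduct p q)) :
    P = lineProj (crossProduct p q) := by
  obtain ⟨w, hw_def⟩ : ∃ w, w = crossProduct p q := ⟨_, rfl⟩
  rw [← hw_def] at hw ⊢
  have hrow : ∀ i, (w ⬝ᵥ w) • P i = (w ⬝ᵥ P i) • w := fun i => by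
    have hwx : crossProduct w (P i) = 0 := by
      have hpi : P i ⬝ᵥ p = 0 := congrFun hp i
      have hqi : P i ⬝ᵥ q = 0 := congrFun hq i
      rw [hw_def, cross_cross_eq_smul_sub_smul, dotProduct_comm p, hpi, dotProduct_comm q, hqi,
        zero_smul, zero_smul, sub_self]
    have h := cross_cross_eq_smul_sub_smul' w w (P i)
    rw [hwx, map_zero] at h
    exact (sub_eq_zero.1 h.symm).symm
  have hmul : (w ⬝ᵥ w) • P = vecMulVec (P *ᵥ w) w := by
    ext i j
    calc (w ⬝ᵥ w) * P i j = (w ⬝ᵥ P i) * w j := congrFun (hrow i) j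
      _ = (P i ⬝ᵥ w) * w j := by rw [dotProduct_comm w]
  have htrace : P *ᵥ w ⬝ᵥ w = w ⬝ᵥ w := by
    rw [← trace_vecMulVec, ← hmul, trace_smul, hP.trace, smul_eq_mul, mul_one]
  refine hP.eq_lineProj_of_mulVec_eq hw (hw.smul_left_cancel.1 ?_)
  calc (w ⬝ᵥ w) • P *ᵥ w = ((w ⬝ᵥ w) • P)ᵀ *ᵥ w := by rw [transpose_smul, hP.symm, smul_mulVec]
    _ = (w ⬝ᵥ w) • w := by
      rw [hmul, transpose_vecMulVec, vecMulVec_mulVec, htrace, op_smul_eq_smul]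

theorem IsLineProj.eq_lineProj_horizontal (hP : IsLineProj P)
    (h2 : P *ᵥ Pi.single 2 1 = 0) (h00 : IsUnit (P 0 0)) :
    IsUnit (![1, Ring.inverse (P 0 0) * P 0 1, 0] ⬝ᵥ ![1, Ring.inverse (P 0 0) * P 0 1, 0]) ∧
      P = lineProj ![1, Ring.inverse (P 0 0) * P 0 1, 0] := by
  obtain ⟨z, hz_def⟩ : ∃ z, z = ![1, Ring.inverse (P 0 0) * P 0 1, 0] := ⟨_, rfl⟩
  rw [← hz_def]
  have hcol : P *ᵥ Pi.single 0 1 = P 0 0 • z := by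
    rw [hz_def, mulVec_single_one]
    have h20 : P 2 0 = P 0 2 := congrFun (congrFun hP.symm 0) 2
    have h10 : P 1 0 = P 0 1 := congrFun (congrFun hP.symm 0) 1
    have h02 : P 0 2 = 0 := by simpa using congrFun h2 0
    ext i
    fin_cases i <;> simp [h20, h02, h10, Ring.mul_inverse_cancel_left _ _ h00]
  have hnorm : (P *ᵥ Pi.single 0 1) ⬝ᵥ (P *ᵥ Pi.single 0 1) = P 0 0 := by
    rw [dotProduct_mulVec, ← mulVec_transpose, hP.symm, mulVec_mulVec, hP.idem]
    simp
  have hz : P 0 0 * (P 0 0 * (z ⬝ᵥ z)) = P 0 0 := by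
    simpa only [hz_def, hcol, smul_dotProduct, dotProduct_smul, smul_eq_mul] using hnorm
  refine ⟨(IsUnit.mul_iff.1 (IsUnit.mul_iff.1 (hz ▸ h00)).2).2, ?_⟩
  rw [← lineProj_smul h00, ← hcol]
  exact hP.eq_lineProj_mulVec _ (hnorm ▸ h00)

end Lines

section Frames

open Matrix

variable {R : Type*} [CommRing R]

/-- The standard basis vectors, spanning the coordinate axes. -/
def axisVec (k : Fin 3) : Fin 3 → R := Pi.single k 1

/-- The vector spanning the bisector of the coordinate axes `k` and `k + 1`. -/
def diagVec (k : Fin 2) : Fin 3 → R := axisVec k.castSucc + axisVec k.succ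

theorem axisVec_dot (i j : Fin 3) :
    (axisVec i : Fin 3 → R) ⬝ᵥ axisVec j = if i = j then 1 else 0 := by
  simp [axisVec, Pi.single_apply, eq_comm]

theorem diagVec_dot (k : Fin 2) : (diagVec k : Fin 3 → R) ⬝ᵥ diagVec k = 2 := by
  fin_cases k <;> simp [diagVec, axisVec_dot] <;> norm_num

theorem isUnit_axisVec (k : Fin 3) : IsUnit ((axisVec k : Fin 3 → R) ⬝ᵥ axisVec k) := by
  simp [axisVec_dot]

theorem exists_smul_of_lineProj_eq {v w : Fin 3 → R} (hv : IsUnit (v ⬝ᵥ v))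
    (h : lineProj v = lineProj w) : ∃ c : R, v = c • w :=
  ⟨_, by rw [← lineProj_mulVec, ← h, lineProj_mulVec_self hv]⟩

variable [Algebra ℚ R]

theorem isUnit_diagVec (k : Fin 2) : IsUnit ((diagVec k : Fin 3 → R) ⬝ᵥ diagVec k) := by
  rw [diagVec_dot]
  exact isUnit_ofNat R 2

/-- Conjugation by `B` interchanges the second and third lines, so `K = P 1 * B` satisfies
`(K - Kᵀ) ^ 2 = -(P 1 + P 2)`, and the adjugate of `K - Kᵀ` is the projection to the first line. -/
theorem vecMulVec_axial_mul {P : Fin 3 → Matrix (Fin 3) (Fin 3) R} {B : Matrix (Fin 3) (Fin 3) R}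
    (hP : ∀ k, IsLineProj (P k)) (hsum : P 0 + P 1 + P 2 = 1) (h12 : P 1 * P 2 = 0)
    (hB : IsHalfTurn B) (hBP : B * P 1 * B = P 2) :
    vecMulVec (axial (P 1 * B)) (axial (P 1 * B)) = P 0 := by
  have hT : (P 1 * B)ᵀ = B * P 1 := by rw [transpose_mul, hB.symm, (hP 1).symm]
  have hsq : (P 1 * B - B * P 1) * (P 1 * B - B * P 1) = -(P 1 + P 2) := calc
    _ = P 1 * (B * P 1 * B) - P 1 * (B * B) * P 1 - B * (P 1 * P 1) * B + B * P 1 * B * P 1 := by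
      noncomm_ring
    _ = -(P 1 + P 2) := by
      rw [hBP, hB.sq, mul_one, (hP 1).idem, hBP, h12, (hP 1).mul_eq_zero_comm (hP 2) h12]
      abel
  have htrace : (P 1 * B - B * P 1).trace = 0 := by rw [trace_sub, trace_mul_comm, sub_self]
  have hadj : (P 1 * B - B * P 1).adjugate.trace = 1 := by
    refine (isUnit_ofNat R 2).mul_left_cancel ?_
    rw [two_mul_trace_adjugate, hsq, htrace, trace_neg, trace_add, (hP 1).trace, (hP 2).trace]
    norm_num
  rw [vecMulVec_axial, hT, adjugate_eq_sq_sub, hsq, htrace, hadj, one_smul, zero_smul, ← hsum]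
  abel

theorem exists_rotation_of_conj {P : Fin 3 → Matrix (Fin 3) (Fin 3) R}
    {A B : Matrix (Fin 3) (Fin 3) R} (hP : ∀ k, IsLineProj (P k)) (hsum : P 0 + P 1 + P 2 = 1)
    (h12 : P 1 * P 2 = 0) (hA : IsHalfTurn A) (hB : IsHalfTurn B) (hAP : A * P 0 * A = P 1)
    (hBP : B * P 1 * B = P 2) :
    ∃ g ∈ specialOrthogonalGroup (Fin 3) R,
      (∀ k, vecMulVec (g *ᵥ axisVec k) (g *ᵥ axisVec k) = P k) ∧
      A *ᵥ (g *ᵥ axisVec 0) = g *ᵥ axisVec 1 ∧ B *ᵥ (g *ᵥ axisVec 1) = g *ᵥ axisVec 2 := by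
  obtain ⟨u, hu⟩ : ∃ u, u = axial (P 1 * B) := ⟨_, rfl⟩
  obtain ⟨g, hg⟩ : ∃ g : Matrix (Fin 3) (Fin 3) R,
    g = (Matrix.of ![u, A *ᵥ u, B *ᵥ (A *ᵥ u)])ᵀ := ⟨_, rfl⟩
  have hcol : ∀ k, g *ᵥ axisVec k = ![u, A *ᵥ u, B *ᵥ (A *ᵥ u)] k := fun k => by
    rw [hg, axisVec, mulVec_single_one]
    rfl
  have conj_vecMulVec : ∀ {C : Matrix (Fin 3) (Fin 3) R}, IsHalfTurn C → ∀ x,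
      vecMulVec (C *ᵥ x) (C *ᵥ x) = C * vecMulVec x x * C := fun hC x => by
    rw [mul_vecMulVec, vecMulVec_mul, ← mulVec_transpose, hC.symm]
  have huu : vecMulVec u u = P 0 := by rw [hu, vecMulVec_axial_mul hP hsum h12 hB hBP]
  have hvv : vecMulVec (A *ᵥ u) (A *ᵥ u) = P 1 := by rw [conj_vecMulVec hA, huu, hAP]
  have hww : vecMulVec (B *ᵥ (A *ᵥ u)) (B *ᵥ (A *ᵥ u)) = P 2 := by
    rw [conj_vecMulVec hB, hvv, hBP]
  have hcross : crossProduct (A *ᵥ u) (B *ᵥ (A *ᵥ u)) = u := by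
    rw [← axial_vecMulVec, ← vecMul_transpose B, ← vecMulVec_mul, hB.symm, hvv, hu]
  have hmem : g ∈ specialOrthogonalGroup (Fin 3) R := by
    refine mem_specialOrthogonalGroup_of_det ?_ ?_
    · rw [← hsum, ← huu, ← hvv, ← hww, hg]
      ext i j
      simp [Matrix.mul_apply, Fin.sum_univ_three, vecMulVec_apply]
    · have hdet := triple_product_eq_det u (A *ᵥ u) (B *ᵥ (A *ᵥ u))
      rw [hcross, ← trace_vecMulVec, huu, (hP 0).trace] at hdet
      rw [hg, det_transpose]
      exact hdet.symm
  refine ⟨g, hmem, fun k => ?_, by rw [hcol, hcol]; rfl, by rw [hcol, hcol]; rfl⟩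
  rw [hcol]
  fin_cases k
  exacts [huu, hvv, hww]

/-- The configurations of five lines formed by three orthogonal axes `P k` and the bisectors
`D k` of the axes `k` and `k + 1`. -/
structure IsFrame (P : Fin 3 → Matrix (Fin 3) (Fin 3) R) (D : Fin 2 → Matrix (Fin 3) (Fin 3) R) :
    Prop where
  axis : ∀ k, IsLineProj (P k)
  diag : ∀ k, IsLineProj (D k)
  orth : ∀ i j, i ≠ j → P i * P j = 0
  orth_zero : D 0 * P 2 = 0
  orth_one : D 1 * P 0 = 0
  bisect : ∀ k, 2 * (D k * P k.castSucc).trace = 1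

theorem IsFrame.exists_rotation {P : Fin 3 → Matrix (Fin 3) (Fin 3) R}
    {D : Fin 2 → Matrix (Fin 3) (Fin 3) R} (h : IsFrame P D) :
    ∃ g ∈ specialOrthogonalGroup (Fin 3) R, (∀ k, P k = lineProj (g *ᵥ axisVec k)) ∧
      ∀ k, D k = lineProj (g *ᵥ diagVec k) := by
  have hsum : P 0 + P 1 + P 2 = 1 := (h.axis 0).sum_eq_one (h.axis 1) (h.axis 2)
    (h.orth 0 1 (by decide)) (h.orth 1 2 (by decide)) (h.orth 0 2 (by decide))
  have hsum' : P 1 + P 2 + P 0 = 1 := by rw [← hsum]; abel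
  obtain ⟨g, hg, haxis, hzero, hone⟩ := exists_rotation_of_conj h.axis hsum
    (h.orth 1 2 (by decide)) (h.diag 0).isHalfTurn (h.diag 1).isHalfTurn
    ((h.axis 0).bisector_conj (h.axis 1) (h.diag 0) (h.orth 0 2 (by decide)) hsum h.orth_zero
      (h.bisect 0))
    ((h.axis 1).bisector_conj (h.axis 2) (h.diag 1) (h.orth 1 0 (by decide)) hsum' h.orth_one
      (h.bisect 1))
  have hswap : ∀ k : Fin 2,
      (2 * D k - 1) *ᵥ (g *ᵥ axisVec k.castSucc) = g *ᵥ axisVec k.succ :=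
    Fin.forall_fin_two.2 ⟨hzero, hone⟩
  refine ⟨g, hg, fun k => ?_, fun k => (h.diag k).eq_lineProj_of_mulVec_eq ?_ ?_⟩
  · rw [lineProj_of_dotProduct_self, haxis]
    rw [mulVec_dotProduct_mulVec hg, axisVec_dot, if_pos rfl]
  · rw [mulVec_dotProduct_mulVec hg]
    exact isUnit_diagVec k
  · have hdouble : g *ᵥ diagVec k = (2 * D k) *ᵥ (g *ᵥ axisVec k.castSucc) := by
      rw [diagVec, mulVec_add, ← hswap k, sub_mulVec, one_mulVec, add_sub_cancel]
    rw [hdouble, mulVec_mulVec, two_mul, mul_add, (h.diag k).idem]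

theorem eq_one_of_fixes_frame {g : Matrix (Fin 3) (Fin 3) R}
    (hg : g ∈ specialOrthogonalGroup (Fin 3) R)
    (haxis : ∀ k, lineProj (g *ᵥ axisVec k) = lineProj (axisVec k))
    (hdiag : ∀ k, lineProj (g *ᵥ diagVec k) = lineProj (diagVec k)) : g = 1 := by
  have hcol : ∀ k, ∃ c : R, g *ᵥ axisVec k = c • axisVec k := fun k =>
    exists_smul_of_lineProj_eq (by rw [mulVec_dotProduct_mulVec hg]; exact isUnit_axisVec k)
      (haxis k)
  choose c hc using hcol
  have hstep : ∀ k : Fin 2, c k.succ = c k.castSucc := fun k => by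
    obtain ⟨d, hd⟩ := exists_smul_of_lineProj_eq
      (by rw [mulVec_dotProduct_mulVec hg]; exact isUnit_diagVec k) (hdiag k)
    rw [diagVec, mulVec_add, hc, hc] at hd
    have hne : k.castSucc ≠ k.succ := Fin.castSucc_lt_succ.ne
    have hleft : c k.castSucc = d := by simpa [axisVec, hne] using congrFun hd k.castSucc
    have hright : c k.succ = d := by simpa [axisVec, hne.symm] using congrFun hd k.succ
    rw [hleft, hright]
  have hscalar : g = c 0 • 1 := by
    have hconst : ∀ k, c k = c 0 :=
      Fin.forall_fin_succ.2 ⟨rfl, Fin.forall_fin_two.2 ⟨hstep 0, (hstep 1).trans (hstep 0)⟩⟩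
    ext i j
    have := congrFun (hc j) i
    simpa [axisVec, hconst, Matrix.one_apply, Pi.single_apply] using this
  have hsq : c 0 * c 0 = 1 := by
    have := mulVec_dotProduct_mulVec hg (axisVec 0) (axisVec 0)
    simpa [hc, axisVec_dot] using this
  have hcube : c 0 ^ 3 = 1 := by simpa [hscalar, det_smul] using det_of_mem hg
  have hone : c 0 = 1 := by linear_combination hcube - c 0 * hsq
  rw [hscalar, hone, one_smul]

end Frames

section Slices

variable {Γ : Type} [Group Γ]

theorem RepRing.algHom_ext {S : Type*} [CommRing S] [Algebra ℚ S] {φ ψ : RepRing Γ →ₐ[ℚ] S}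
    (h : ∀ γ, (univMatrix Γ γ).map φ = (univMatrix Γ γ).map ψ) : φ = ψ := by
  apply Ideal.Quotient.algHom_ext
  apply MvPolynomial.algHom_ext
  rintro ⟨γ, i, j⟩
  exact congrFun (congrFun (h γ) i) j

theorem univMatrix_map_pointOf {R : Type*} [CommRing R] [Algebra ℚ R] (ρ : Γ →* PO3 R) (γ : Γ) :
    (univMatrix Γ γ).map (pointOf ρ) = (PO3.equivSO (ρ γ)).1 := by
  rw [← equivSO_repOf]
  congr 2
  exact DFunLike.congr_fun (points.right_inv ρ) γ

theorem pointOf_repOf {R : Type*} [CommRing R] [Algebra ℚ R] (φ : RepRing Γ →ₐ[ℚ] R) :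
    pointOf (repOf φ) = φ :=
  points.left_inv φ

theorem repOf_pointOf {R : Type*} [CommRing R] [Algebra ℚ R] (ρ : Γ →* PO3 R) :
    repOf (pointOf ρ) = ρ :=
  points.right_inv ρ

theorem pointOf_map {R S : Type*} [CommRing R] [Algebra ℚ R] [CommRing S] [Algebra ℚ S]
    (f : R →ₐ[ℚ] S) (ρ : Γ →* PO3 R) :
    pointOf ((PO3.map (f : R →+* S)).comp ρ) = f.comp (pointOf ρ) := by
  apply RepRing.algHom_ext
  intro γ
  rw [univMatrix_map_pointOf, MonoidHom.comp_apply, PO3.equivSO_map, ← univMatrix_map_pointOf]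
  rfl

theorem repOf_comp {R S : Type*} [CommRing R] [Algebra ℚ R] [CommRing S] [Algebra ℚ S]
    (f : R →ₐ[ℚ] S) (φ : RepRing Γ →ₐ[ℚ] R) :
    repOf (f.comp φ) = (PO3.map (f : R →+* S)).comp (repOf φ) := by
  rw [← repOf_pointOf ((PO3.map (f : R →+* S)).comp (repOf φ)), pointOf_map, pointOf_repOf]

theorem conjRep_conjRep {H : Type*} [Group H] (g h : H) (ρ : Γ →* H) :
    conjRep g (conjRep h ρ) = conjRep (g * h) ρ := by
  ext γ; simp [conjRep]

theorem conjRep_one {H : Type*} [Group H] (ρ : Γ →* H) : conjRep 1 ρ = ρ := by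
  ext γ; simp [conjRep]

theorem comp_conjRep {H H' : Type*} [Group H] [Group H'] (f : H →* H') (g : H) (ρ : Γ →* H) :
    f.comp (conjRep g ρ) = conjRep (f g) (f.comp ρ) := by
  ext γ; simp [conjRep]

/-- The representation `ρ`, as a point of the representation scheme, lies on the closed subscheme
cut out by the ideal `J`. -/
def OnZeroLocus {R : Type*} [CommRing R] [Algebra ℚ R] (J : Ideal (RepRing Γ)) (ρ : Γ →* PO3 R) :
    Prop :=
  ∀ a ∈ J, pointOf ρ a = 0

theorem OnZeroLocus.map {R S : Type*} [CommRing R] [Algebra ℚ R] [CommRing S] [Algebra ℚ S]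
    {J : Ideal (RepRing Γ)} {ρ : Γ →* PO3 R} (hρ : OnZeroLocus J ρ) (f : R →ₐ[ℚ] S) :
    OnZeroLocus J ((PO3.map (f : R →+* S)).comp ρ) := fun a ha => by
  rw [pointOf_map, AlgHom.comp_apply, hρ a ha, map_zero]

theorem onZeroLocus_repOf_mkₐ (J : Ideal (RepRing Γ)) :
    OnZeroLocus J (repOf (Ideal.Quotient.mkₐ ℚ J)) := fun a ha => by
  rw [pointOf_repOf]
  exact Ideal.Quotient.eq_zero_iff_mem.2 ha

theorem mkₐ_span_one_sub {A : Type*} [CommRing A] [Algebra ℚ A] (e : A) :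
    Ideal.Quotient.mkₐ ℚ (Ideal.span {1 - e}) e = 1 :=
  (Ideal.Quotient.eq.2 (Ideal.mem_span_singleton_self (1 - e))).symm

theorem exists_comp_mkₐ_eq_pointOf {R : Type*} [CommRing R] [Algebra ℚ R] {e : RepRing Γ}
    {ρ : Γ →* PO3 R} (hρ : pointOf ρ e = 1) :
    ∃ ψ : RepRing Γ ⧸ Ideal.span {1 - e} →ₐ[ℚ] R,
      ψ.comp (Ideal.Quotient.mkₐ ℚ (Ideal.span {1 - e})) = pointOf ρ := by
  refine ⟨Ideal.Quotient.liftₐ _ (pointOf ρ) fun c hc => ?_, Ideal.Quotient.liftₐ_comp _ _ _⟩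
  obtain ⟨d, rfl⟩ := Ideal.mem_span_singleton'.1 hc
  rw [map_mul, map_sub, map_one, hρ, sub_self, mul_zero]

/-- An ideal `J` of the representation ring cutting out a slice of the conjugation action on
the clopen locus `e = 1`: every orbit in that locus meets the zero locus of `J` exactly once and
with trivial stabilizer, functorially in the coefficients. -/
structure IsSlice (e : RepRing Γ) (J : Ideal (RepRing Γ)) : Prop where
  idem : e * e = e
  inv : e ∈ charRing Γ
  mem : 1 - e ∈ J
  exists_conj : ∀ (R : Type) [CommRing R] [Algebra ℚ R] (ρ : Γ →* PO3 R), pointOf ρ e = 1 →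
    ∃ g, OnZeroLocus J (conjRep g ρ)
  unique : ∀ (R : Type) [CommRing R] [Algebra ℚ R] (ρ : Γ →* PO3 R) (g : PO3 R),
    OnZeroLocus J ρ → OnZeroLocus J (conjRep g ρ) → g = 1

/-- At a representation of the locus `e = 1`, the function `b` takes the value of `a` at those
conjugates that lie on the zero locus of `J`. If `J` cuts out a slice there is exactly one, so that
`b` extends the restriction of `a` to the slice along the orbits. -/
def ExtendsFromSlice (e : RepRing Γ) (J : Ideal (RepRing Γ)) (a b : RepRing Γ) : Prop :=
  ∀ (R : Type) [CommRing R] [Algebra ℚ R] (ρ : Γ →* PO3 R), pointOf ρ e = 1 →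
    ∀ k : PO3 R, OnZeroLocus J (conjRep k ρ) → pointOf ρ b = pointOf (conjRep k ρ) a

namespace IsSlice

variable {e : RepRing Γ} {J : Ideal (RepRing Γ)} {R : Type} [CommRing R] [Algebra ℚ R]

theorem conj_eq (h : IsSlice e J) {ρ : Γ →* PO3 R} {g k : PO3 R}
    (hg : OnZeroLocus J (conjRep g ρ)) (hk : OnZeroLocus J (conjRep k ρ)) : g = k := by
  rw [← inv_mul_cancel_right g k, ← conjRep_conjRep] at hg
  exact mul_inv_eq_one.1 (h.unique R _ _ hk hg)

/-- The universal representation of the locus `e = 1` can be conjugated into the slice. Applying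
the conjugation to `a` over the ring of functions on the locus gives the extension of `a`. -/
theorem exists_extension (h : IsSlice e J) (a : RepRing Γ) : ∃ b, ExtendsFromSlice e J a b := by
  let φ := Ideal.Quotient.mkₐ ℚ (Ideal.span {1 - e})
  obtain ⟨g, hg⟩ := h.exists_conj _ (repOf φ) (by rw [pointOf_repOf, mkₐ_span_one_sub])
  obtain ⟨b, hb⟩ := Ideal.Quotient.mk_surjective (pointOf (conjRep g (repOf φ)) a)
  refine ⟨b, fun R _ _ ρ hρ k hk => ?_⟩
  obtain ⟨ψ, hψ⟩ := exists_comp_mkₐ_eq_pointOf hρ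
  have conj_map : (PO3.map (ψ : _ →+* R)).comp (conjRep g (repOf φ))
      = conjRep (PO3.map (ψ : _ →+* R) g) ρ := by
    rw [comp_conjRep, ← repOf_comp, hψ, repOf_pointOf]
  have map_g : PO3.map (ψ : _ →+* R) g = k := h.conj_eq (conj_map ▸ hg.map ψ) hk
  rw [← map_g, ← conj_map, pointOf_map, AlgHom.comp_apply, ← hb, ← hψ]
  rfl

theorem pointOf_conjRep_extension (h : IsSlice e J) {a b : RepRing Γ}
    (hb : ExtendsFromSlice e J a b) (ρ : Γ →* PO3 R) (hρ : pointOf ρ e = 1) (g : PO3 R) :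
    pointOf (conjRep g ρ) b = pointOf ρ b := by
  obtain ⟨k, hk⟩ := h.exists_conj R ρ hρ
  have conj_conj : conjRep (k * g⁻¹) (conjRep g ρ) = conjRep k ρ := by
    rw [conjRep_conjRep, inv_mul_cancel_right]
  have hρ' : pointOf (conjRep g ρ) e = 1 := (h.inv R ρ g).trans hρ
  rw [hb R ρ hρ k hk, hb R _ hρ' (k * g⁻¹) (conj_conj ▸ hk), conj_conj]

theorem mul_extension_mem_charRing (h : IsSlice e J) {a b : RepRing Γ}
    (hb : ExtendsFromSlice e J a b) : e * b ∈ charRing Γ := by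
  intro R _ _ ρ g
  let I : Ideal R := Ideal.span {1 - pointOf ρ e}
  let π : R →ₐ[ℚ] R ⧸ I := Ideal.Quotient.mkₐ ℚ I
  have sub_mem : pointOf (conjRep g ρ) b - pointOf ρ b ∈ I := by
    have hπ := h.pointOf_conjRep_extension hb ((PO3.map (π : R →+* R ⧸ I)).comp ρ)
      (by rw [pointOf_map]; exact mkₐ_span_one_sub _) (PO3.map (π : R →+* R ⧸ I) g)
    rw [← comp_conjRep, pointOf_map, pointOf_map] at hπ
    exact Ideal.Quotient.eq.1 hπ
  obtain ⟨r, hr⟩ := Ideal.mem_span_singleton'.1 sub_mem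
  have idem : pointOf ρ e * pointOf ρ e = pointOf ρ e := by rw [← map_mul, h.idem]
  rw [map_mul, map_mul, h.inv R ρ g]
  linear_combination -pointOf ρ e * hr - r * idem

theorem mul_extension_sub_mem (h : IsSlice e J) {a b : RepRing Γ}
    (hb : ExtendsFromSlice e J a b) : e * b - a ∈ J := by
  let π := Ideal.Quotient.mkₐ ℚ J
  have π_e : π e = 1 := (Ideal.Quotient.eq.2 h.mem).symm
  have π_b := hb _ (repOf π) (by rw [pointOf_repOf, π_e]) 1
    (by rw [conjRep_one]; exact onZeroLocus_repOf_mkₐ J)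
  rw [conjRep_one, pointOf_repOf] at π_b
  apply Ideal.Quotient.eq_zero_iff_mem.1
  change π (e * b - a) = 0
  rw [map_sub, map_mul, π_e, one_mul, π_b, sub_self]

theorem exists_invariant (h : IsSlice e J) (a : RepRing Γ) : ∃ b ∈ charRing Γ, b - a ∈ J := by
  obtain ⟨b, hb⟩ := h.exists_extension a
  exact ⟨e * b, h.mul_extension_mem_charRing hb, h.mul_extension_sub_mem hb⟩

theorem mul_eq_zero (h : IsSlice e J) {b : RepRing Γ} (hb : b ∈ charRing Γ) (hbJ : b ∈ J) :
    e * b = 0 := by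
  let φ := Ideal.Quotient.mkₐ ℚ (Ideal.span {1 - e})
  obtain ⟨g, hg⟩ := h.exists_conj _ (repOf φ) (by rw [pointOf_repOf, mkₐ_span_one_sub])
  have φ_b := hb _ (repOf φ) g
  rw [hg b hbJ, pointOf_repOf] at φ_b
  obtain ⟨r, hr⟩ := Ideal.mem_span_singleton'.1 (Ideal.Quotient.eq_zero_iff_mem.1 φ_b.symm)
  rw [← hr]
  linear_combination -r * h.idem

theorem surjective_algebraMap (h : IsSlice e J) :
    Function.Surjective (algebraMap (charRing Γ) (RepRing Γ ⧸ J)) := by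
  intro c
  obtain ⟨a, rfl⟩ := Ideal.Quotient.mk_surjective c
  obtain ⟨b, hb, hba⟩ := h.exists_invariant a
  exact ⟨⟨b, hb⟩, Ideal.Quotient.eq.2 hba⟩

theorem isLocalization (h : IsSlice e J) :
    IsLocalization.Away (⟨e, h.inv⟩ : charRing Γ) (RepRing Γ ⧸ J) := by
  refine IsLocalization.away_of_isIdempotentElem (Subtype.ext h.idem) ?_ h.surjective_algebraMap
  ext ⟨b, hb⟩
  rw [RingHom.mem_ker, Ideal.mem_span_singleton']
  constructor
  · intro hbJ
    have mul_b := h.mul_eq_zero hb (Ideal.Quotient.eq_zero_iff_mem.1 hbJ)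
    refine ⟨⟨b, hb⟩, Subtype.ext ?_⟩
    change b * (1 - e) = b
    linear_combination -mul_b
  · rintro ⟨⟨a, ha⟩, hab⟩
    have b_eq : a * (1 - e) = b := congrArg Subtype.val hab
    exact Ideal.Quotient.eq_zero_iff_mem.2 (b_eq ▸ J.mul_mem_left _ h.mem)

theorem centralizer_eq_bot (h : IsSlice e J) (ρ : Γ →* PO3 R) (hρ : pointOf ρ e = 1) :
    Subgroup.centralizer (Set.range ρ) = ⊥ := by
  rw [eq_bot_iff]
  intro z hz
  obtain ⟨g, hg⟩ := h.exists_conj R ρ hρ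
  have conj_z : conjRep z ρ = ρ := by
    ext γ
    have comm := Subgroup.mem_centralizer_iff.1 hz (ρ γ) ⟨γ, rfl⟩
    simp [conjRep, ← comm]
  have g_eq : g = g * z := by
    refine h.conj_eq (ρ := ρ) hg ?_
    rwa [← conjRep_conjRep, conj_z]
  simpa using g_eq.symm

theorem centralizer_eq_center (h : IsSlice e J) (ρ : Γ →* PO3 R) (hρ : pointOf ρ e = 1) :
    Subgroup.centralizer (Set.range ρ) = Subgroup.center (PO3 R) := by
  refine le_antisymm ?_ (Subgroup.center_le_centralizer _)
  rw [h.centralizer_eq_bot ρ hρ]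
  exact bot_le

/-- Invariant functions separate the orbits in the locus `e = 1`, because every function agrees on
the slice with an invariant one. -/
theorem exists_conjRep_of_invariants_eq (h : IsSlice e J) {ρ ρ' : Γ →* PO3 R}
    (hρ : pointOf ρ e = 1) (inv_eq : ∀ a ∈ charRing Γ, pointOf ρ' a = pointOf ρ a) :
    ∃ g, ρ' = conjRep g ρ := by
  obtain ⟨g, hg⟩ := h.exists_conj R ρ hρ
  obtain ⟨k, hk⟩ := h.exists_conj R ρ' ((inv_eq e h.inv).trans hρ)
  have point_eq : pointOf (conjRep k ρ') = pointOf (conjRep g ρ) := by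
    ext a
    obtain ⟨b, hb, hba⟩ := h.exists_invariant a
    have hg_b := hg _ hba
    have hk_b := hk _ hba
    rw [map_sub, sub_eq_zero, hb R] at hg_b hk_b
    rw [← hg_b, ← hk_b, inv_eq b hb]
  have conj_eq : conjRep k ρ' = conjRep g ρ := points.symm.injective point_eq
  refine ⟨k⁻¹ * g, ?_⟩
  rw [← conjRep_conjRep, ← conj_eq, conjRep_conjRep, inv_mul_cancel, conjRep_one]

theorem isStable (h : IsSlice e J) (ρ : Γ →* PO3 ℂ) (hρ : pointOf ρ e = 1) : IsStable ρ := by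
  refine ⟨⟨{c | ∃ a ∈ charRing Γ, c = 1 ⊗ₜ a - pointOf ρ a ⊗ₜ 1},
    fun ρ' => ⟨?_, fun hρ' => h.exists_conjRep_of_invariants_eq hρ fun a ha => ?_⟩⟩, ?_⟩
  · rintro ⟨g, rfl⟩ c ⟨a, ha, rfl⟩
    simp [complexEval, ha ℂ ρ g]
  · simpa [complexEval, sub_eq_zero] using hρ' _ ⟨a, ha, rfl⟩
  · rw [h.centralizer_eq_bot ρ hρ]
    infer_instance

end IsSlice

end Slices

section SliceSchemes

theorem exists_iso_opens {X Y Z T : Scheme.{0}} (j : Z ⟶ X) [IsOpenImmersion j] (k : Z ⟶ Y)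
    [IsOpenImmersion k] {sX : X ⟶ T} {sY : Y ⟶ T} (w : j ≫ sX = k ≫ sY) :
    ∃ (X' : X.Opens) (S : Y.Opens) (f : X'.toScheme ≅ S.toScheme) (t : Z ⟶ X'.toScheme),
      (S : Set Y) = Set.range k ∧ f.hom ≫ S.ι ≫ sY = X'.ι ≫ sX ∧ t ≫ X'.ι = j ∧
        t ≫ f.hom ≫ S.ι = k := by
  refine ⟨j.opensRange, k.opensRange, j.isoOpensRange.symm ≪≫ k.isoOpensRange,
    j.isoOpensRange.hom, rfl, ?_, Scheme.Hom.isoOpensRange_hom_ι j, ?_⟩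
  · rw [← cancel_epi j.isoOpensRange.hom]
    simpa using w.symm
  · simp

variable {n : ℕ} {M : CoxeterMatrix (Fin n)} {e : RepRing M.Group} {J : Ideal (RepRing M.Group)}

/-- The slice as a scheme. -/
def sliceScheme (J : Ideal (RepRing M.Group)) : Scheme.{0} :=
  Spec (CommRingCat.of (RepRing M.Group ⧸ J))

/-- The inclusion of the slice into the representation scheme. -/
def sliceToHom (J : Ideal (RepRing M.Group)) : sliceScheme J ⟶ homScheme M.Group :=
  Spec.map (CommRingCat.ofHom (Ideal.Quotient.mk J))

instance (J : Ideal (RepRing M.Group)) : IsClosedImmersion (sliceToHom J) :=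
  IsClosedImmersion.spec_of_surjective _ Ideal.Quotient.mk_surjective

theorem sliceToHom_comp (J : Ideal (RepRing M.Group)) : sliceToHom J ≫ quotientMap M.Group
    = Spec.map (CommRingCat.ofHom (algebraMap (charRing M.Group) (RepRing M.Group ⧸ J))) :=
  (Spec.map_comp (CommRingCat.ofHom (charRing M.Group).val.toRingHom)
    (CommRingCat.ofHom (Ideal.Quotient.mk J))).symm

/-- The `B`-point of the slice given by a homomorphism from its coordinate ring. -/
def slicePoint {B : Type} [CommRing B] [Algebra ℚ B] (Φ : RepRing M.Group ⧸ J →ₐ[ℚ] B) :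
    Spec (CommRingCat.of B) ⟶ sliceScheme J :=
  Spec.map (CommRingCat.ofHom Φ.toRingHom)

theorem slicePoint_comp {B : Type} [CommRing B] [Algebra ℚ B] (Φ : RepRing M.Group ⧸ J →ₐ[ℚ] B) :
    slicePoint Φ ≫ (sliceToHom J ≫ quotientMap M.Group) ≫ charSchemeToSpec M.Group
      = Spec.map (CommRingCat.ofHom (algebraMap ℚ B)) := by
  rw [sliceToHom_comp]
  change Spec.map (CommRingCat.ofHom Φ.toRingHom) ≫ Spec.map (CommRingCat.ofHom
    (algebraMap (charRing M.Group) (RepRing M.Group ⧸ J))) ≫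
    Spec.map (CommRingCat.ofHom (algebraMap ℚ (charRing M.Group))) = _
  rw [← Spec.map_comp, ← Spec.map_comp, ← CommRingCat.ofHom_comp, ← CommRingCat.ofHom_comp]
  congr 2
  exact Subsingleton.elim _ _

theorem map_comp_slicePoint {B C : Type} [CommRing B] [Algebra ℚ B] [CommRing C] [Algebra ℚ C]
    (Φ : RepRing M.Group ⧸ J →ₐ[ℚ] B) (f : B →ₐ[ℚ] C) :
    Spec.map (CommRingCat.ofHom f.toRingHom) ≫ slicePoint Φ = slicePoint (f.comp Φ) :=
  (Spec.map_comp (CommRingCat.ofHom Φ.toRingHom) (CommRingCat.ofHom f.toRingHom)).symm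

theorem homPoint_complexify {y : RepRing M.Group ⧸ J →ₐ[ℚ] ℚ} {ρ : M.Group →* PO3 ℝ}
    (hρ : pointOf ρ = (Algebra.ofId ℚ ℝ).comp (y.comp (Ideal.Quotient.mkₐ ℚ J))) :
    homPoint (complexify ρ) =
      Spec.map (CommRingCat.ofHom (algebraMap ℚ ℂ)) ≫ slicePoint y ≫ sliceToHom J := by
  have hc : pointOf (complexify ρ)
      = (Algebra.ofId ℚ ℂ).comp (y.comp (Ideal.Quotient.mkₐ ℚ J)) := by
    have hmap : pointOf (complexify ρ) = Complex.ofRealHom.toRatAlgHom.comp (pointOf ρ) :=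
      pointOf_map Complex.ofRealHom.toRatAlgHom ρ
    rw [hmap, hρ, ← AlgHom.comp_assoc]
    congr 1
  rw [homPoint, hc]
  change Spec.map _ = Spec.map _ ≫ Spec.map (CommRingCat.ofHom y.toRingHom) ≫
    Spec.map (CommRingCat.ofHom (Ideal.Quotient.mk J))
  rw [← Spec.map_comp, ← Spec.map_comp]
  rfl

namespace IsSlice

theorem isOpenImmersion (h : IsSlice e J) :
    IsOpenImmersion (sliceToHom J ≫ quotientMap M.Group) := by
  have := h.isLocalization
  rw [sliceToHom_comp]
  exact IsOpenImmersion.of_isLocalization (⟨e, h.inv⟩ : charRing M.Group)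

theorem range_sliceToHom_subset (h : IsSlice e J)
    (hO : ∀ p : PrimeSpectrum (RepRing M.Group), InjOnElementary M (repAt p) ↔ e ∉ p.asIdeal) :
    Set.range (sliceToHom J) ⊆ (homO M : Set (homScheme M.Group)) := by
  rintro _ ⟨q, rfl⟩
  refine (hO _).2 fun he => ?_
  have one_sub_mem : 1 - e ∈ (sliceToHom J q).asIdeal := by
    change Ideal.Quotient.mk J (1 - e) ∈ q.asIdeal
    rw [Ideal.Quotient.eq_zero_iff_mem.2 h.mem]
    exact zero_mem _
  have one_mem := add_mem one_sub_mem he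
  rw [sub_add_cancel] at one_mem
  exact (Ideal.ne_top_iff_one _).1 (sliceToHom J q).isPrime.ne_top one_mem

theorem range_eq_charOSet (h : IsSlice e J)
    (hO : ∀ p : PrimeSpectrum (RepRing M.Group), InjOnElementary M (repAt p) ↔ e ∉ p.asIdeal) :
    Set.range (sliceToHom J ≫ quotientMap M.Group) = charOSet M := by
  apply Set.Subset.antisymm
  · rintro _ ⟨q, rfl⟩
    exact ⟨sliceToHom J q, h.range_sliceToHom_subset hO ⟨q, rfl⟩, by simp⟩
  · rintro _ ⟨p, hp, rfl⟩
    have := h.isLocalization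
    have range_eq : Set.range
        (PrimeSpectrum.comap (algebraMap (charRing M.Group) (RepRing M.Group ⧸ J)))
        = PrimeSpectrum.basicOpen (⟨e, h.inv⟩ : charRing M.Group) :=
      PrimeSpectrum.localization_away_comap_range _ _
    rw [sliceToHom_comp]
    change quotientMap M.Group p ∈ Set.range
      (PrimeSpectrum.comap (algebraMap (charRing M.Group) (RepRing M.Group ⧸ J)))
    rw [range_eq]
    exact fun he => (hO p).1 hp he

theorem exists_crossSection (h : IsSlice e J)
    (hO : ∀ p : PrimeSpectrum (RepRing M.Group), InjOnElementary M (repAt p) ↔ e ∉ p.asIdeal)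
    {y : RepRing M.Group ⧸ J →ₐ[ℚ] ℚ} {ρ : M.Group →* PO3 ℝ}
    (hρ : pointOf ρ = (Algebra.ofId ℚ ℝ).comp (y.comp (Ideal.Quotient.mkₐ ℚ J))) :
    ∃ Xo : (charScheme M.Group).Opens, (Xo : Set (charScheme M.Group)) = charOSet M ∧
      ∃ (Sc : Scheme.{0}) (ι : Sc ⟶ (homO M).toScheme), IsCrossSection M Xo ι ∧
        ∃ s : Spec (CommRingCat.of ℂ) ⟶ Sc,
          s ≫ ι ≫ (homO M).ι = homPoint (complexify ρ) := by
  let q := sliceToHom J ≫ quotientMap M.Group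
  have hq : IsOpenImmersion q := h.isOpenImmersion
  have range_subset : Set.range (sliceToHom J) ⊆ Set.range (homO M).ι := by
    rw [Scheme.Opens.range_ι]
    exact h.range_sliceToHom_subset hO
  let ι := IsOpenImmersion.lift (homO M).ι (sliceToHom J) range_subset
  have hι : ι ≫ (homO M).ι = sliceToHom J := IsOpenImmersion.lift_fac _ _ _
  have closed : IsClosedImmersion ι := by
    have : IsClosedImmersion (ι ≫ (homO M).ι) := by rw [hι]; infer_instance
    exact IsClosedImmersion.of_comp ι (homO M).ι
  refine ⟨q.opensRange, h.range_eq_charOSet hO, sliceScheme J, ι,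
    ⟨closed, q.isoOpensRange, ?_⟩, Spec.map (CommRingCat.ofHom (algebraMap ℚ ℂ)) ≫ slicePoint y, ?_⟩
  · rw [Scheme.Hom.isoOpensRange_hom_ι, ← Category.assoc, hι]
  · rw [hι, homPoint_complexify hρ, Category.assoc]

theorem exists_iso_opens (h : IsSlice e J)
    (hO : ∀ p : PrimeSpectrum (RepRing M.Group), InjOnElementary M (repAt p) ↔ e ∉ p.asIdeal)
    {B B' : Type} [CommRing B] [Algebra ℚ B] [CommRing B'] [Algebra ℚ B'] (j : B →ₐ[ℚ] B')
    (hj : IsOpenImmersion (Spec.map (CommRingCat.ofHom j.toRingHom)))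
    (Φ : RepRing M.Group ⧸ J →ₐ[ℚ] B') (hΦ : IsOpenImmersion (slicePoint Φ))
    (x' : B' →ₐ[ℚ] ℚ) {ρ : M.Group →* PO3 ℝ}
    (hρ : pointOf ρ = (Algebra.ofId ℚ ℝ).comp ((x'.comp Φ).comp (Ideal.Quotient.mkₐ ℚ J))) :
    ∃ (X' : (Spec (CommRingCat.of B)).Opens) (S : (charScheme M.Group).Opens)
      (f : X'.toScheme ≅ S.toScheme) (x₀ : Spec (CommRingCat.of ℚ) ⟶ X'.toScheme),
      (S : Set (charScheme M.Group)) ⊆ charOSet M ∧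
      f.hom ≫ S.ι ≫ charSchemeToSpec M.Group =
        X'.ι ≫ Spec.map (CommRingCat.ofHom (algebraMap ℚ B)) ∧
      x₀ ≫ X'.ι = Spec.map (CommRingCat.ofHom (x'.comp j).toRingHom) ∧
      Spec.map (CommRingCat.ofHom (algebraMap ℚ ℂ)) ≫ x₀ ≫ f.hom ≫ S.ι =
        homPoint (complexify ρ) ≫ quotientMap M.Group := by
  let q := sliceToHom J ≫ quotientMap M.Group
  have hq : IsOpenImmersion q := h.isOpenImmersion
  have over_rat : Spec.map (CommRingCat.ofHom j.toRingHom) ≫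
      Spec.map (CommRingCat.ofHom (algebraMap ℚ B))
        = (slicePoint Φ ≫ q) ≫ charSchemeToSpec M.Group := by
    rw [Category.assoc, slicePoint_comp, ← Spec.map_comp, ← CommRingCat.ofHom_comp]
    exact congrArg (fun f => Spec.map (CommRingCat.ofHom f)) j.comp_algebraMap
  obtain ⟨X', S, f, t, hS, hf, htX, htS⟩ := KM.exists_iso_opens _ (slicePoint Φ ≫ q) over_rat
  refine ⟨X', S, f, Spec.map (CommRingCat.ofHom x'.toRingHom) ≫ t, ?_, hf, ?_, ?_⟩
  · rw [hS, ← h.range_eq_charOSet hO]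
    rintro _ ⟨z, rfl⟩
    exact ⟨slicePoint Φ z, by simp [q]⟩
  · rw [Category.assoc, htX, ← Spec.map_comp]
    rfl
  · rw [Category.assoc, htS, homPoint_complexify hρ, ← map_comp_slicePoint]
    simp only [Category.assoc, q]

end IsSlice

end SliceSchemes

section Involutions

variable {G : Type*} [Group G] {g h : G}

theorem semiconjBy_zpow_of_involutions (hg : g * g = 1) (hh : h * h = 1) (k : ℤ) :
    SemiconjBy g ((g * h) ^ k) ((g * h) ^ (-k)) := by
  have inverts : SemiconjBy g (g * h) (g * h)⁻¹ := by
    rw [SemiconjBy, mul_inv_rev, inv_eq_of_mul_eq_one_left hg, inv_eq_of_mul_eq_one_left hh,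
      mul_assoc h g g, hg, ← mul_assoc, hg, one_mul, mul_one]
  rw [zpow_neg, ← inv_zpow]
  exact inverts.zpow_right k

theorem mem_closure_pair_involutions (hg : g * g = 1) (hh : h * h = 1) {x : G}
    (hx : x ∈ Subgroup.closure {g, h}) : ∃ k : ℤ, x = (g * h) ^ k ∨ x = (g * h) ^ k * g := by
  have swap (k : ℤ) : g * (g * h) ^ k = (g * h) ^ (-k) * g :=
    (semiconjBy_zpow_of_involutions hg hh k).eq
  have hgi : g⁻¹ = g := inv_eq_of_mul_eq_one_left hg
  have hhi : h⁻¹ = h := inv_eq_of_mul_eq_one_left hh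
  induction hx using Subgroup.closure_induction with
  | mem x hx =>
    rcases hx with rfl | rfl
    · exact ⟨0, Or.inr (by simp)⟩
    · refine ⟨-1, Or.inr ?_⟩
      rw [zpow_neg, zpow_one, mul_inv_rev, hgi, hhi, mul_assoc, hg, mul_one]
  | one => exact ⟨0, Or.inl (by simp)⟩
  | mul x y _ _ hx hy =>
    obtain ⟨a, rfl | rfl⟩ := hx <;> obtain ⟨b, rfl | rfl⟩ := hy
    · exact ⟨a + b, Or.inl (zpow_add _ _ _).symm⟩
    · exact ⟨a + b, Or.inr (by rw [zpow_add, mul_assoc])⟩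
    · exact ⟨a + -b, Or.inr (by rw [mul_assoc, swap, zpow_add, mul_assoc])⟩
    · refine ⟨a + -b, Or.inl ?_⟩
      rw [mul_assoc, ← mul_assoc g, swap, mul_assoc _ g g, hg, mul_one, zpow_add]
  | inv x _ hx =>
    obtain ⟨a, rfl | rfl⟩ := hx
    · exact ⟨-a, Or.inl (zpow_neg _ _).symm⟩
    · refine ⟨a, Or.inr ?_⟩
      rw [mul_inv_rev, hgi, ← zpow_neg, swap, neg_neg]

theorem isConj_zpow_mul_of_involutions (hg : g * g = 1) (hh : h * h = 1) (k : ℤ) :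
    IsConj g ((g * h) ^ k * g) ∨ IsConj h ((g * h) ^ k * g) := by
  have swap (a : ℤ) : g * ((g * h) ^ a)⁻¹ = (g * h) ^ a * g := by
    simpa using (semiconjBy_zpow_of_involutions hg hh (-a)).eq
  rcases Int.even_or_odd' k with ⟨a, rfl | rfl⟩
  · refine Or.inl (isConj_iff.2 ⟨(g * h) ^ a, ?_⟩)
    rw [mul_assoc, swap, ← mul_assoc, ← zpow_add, two_mul]
  · refine Or.inr (isConj_iff.2 ⟨(g * h) ^ a * g, ?_⟩)
    calc (g * h) ^ a * g * h * ((g * h) ^ a * g)⁻¹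
        = (g * h) ^ a * (g * h) * (g * ((g * h) ^ a)⁻¹) := by
          rw [mul_inv_rev, inv_eq_of_mul_eq_one_left hg, ← mul_assoc, ← mul_assoc,
            ← mul_assoc]
      _ = (g * h) ^ (2 * a + 1) * g := by
          rw [swap, ← zpow_add_one, ← mul_assoc, ← zpow_add]
          congr 2
          ring

theorem finite_closure_pair_involutions (hg : g * g = 1) (hh : h * h = 1)
    (hf : IsOfFinOrder (g * h)) : Finite (Subgroup.closure {g, h}) := by
  have finite_rotations : (Set.range fun k : ℤ => (g * h) ^ k).Finite := by
    have := hf.finite_zpowers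
    rwa [Subgroup.coe_zpowers] at this
  refine Set.Finite.to_subtype ((finite_rotations.union
    (finite_rotations.image (· * g))).subset ?_)
  intro x hx
  obtain ⟨k, rfl | rfl⟩ := mem_closure_pair_involutions hg hh hx
  · exact Or.inl ⟨k, rfl⟩
  · exact Or.inr ⟨_, ⟨k, rfl⟩, rfl⟩

theorem orderOf_eq_of_pow_half_ne_one {x : G} {m : ℕ} (hm : m = 2 ∨ m = 4) (hpow : x ^ m = 1)
    (hhalf : x ^ (m / 2) ≠ 1) : orderOf x = m := by
  rcases hm with rfl | rfl
  · exact orderOf_eq_prime_pow (p := 2) (n := 0) hhalf hpow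
  · exact orderOf_eq_prime_pow (p := 2) (n := 1) hhalf hpow

end Involutions

section EvenCoxeter

variable {n : ℕ} {M : CoxeterMatrix (Fin n)}

theorem simple_mul_self (i : Fin n) : M.simple i * M.simple i = 1 :=
  M.toCoxeterSystem.simple_mul_simple_self i

theorem simple_mul_simple_pow (i j : Fin n) : (M.simple i * M.simple j) ^ M i j = 1 :=
  M.toCoxeterSystem.simple_mul_simple_pow i j

theorem simple_ne_one (i : Fin n) : M.simple i ≠ 1 := fun h => by
  have := M.toCoxeterSystem.length_simple i
  simp [h] at this

theorem isElementary_single (i : Fin n) : IsElementary M (Subgroup.closure {M.simple i}) := by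
  refine ⟨?_, {i}, by simp, by simp⟩
  have := finite_closure_pair_involutions (simple_mul_self (M := M) i) (simple_mul_self i)
    (by rw [simple_mul_self]; exact IsOfFinOrder.one)
  simpa using this

theorem isElementary_pair {i j : Fin n} (h0 : M i j ≠ 0) :
    IsElementary M (Subgroup.closure {M.simple i, M.simple j}) := by
  refine ⟨finite_closure_pair_involutions (simple_mul_self i) (simple_mul_self j)
    (isOfFinOrder_iff_pow_eq_one.2 ⟨_, Nat.pos_of_ne_zero h0, simple_mul_simple_pow i j⟩),
    {i, j}, Finset.card_le_two, ?_⟩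
  congr 1
  simp [Set.image_insert_eq]

theorem IsElementary.eq_bot_or_closure_pair {H : Subgroup M.Group} (hH : IsElementary M H) :
    H = ⊥ ∨ ∃ i j, H = Subgroup.closure {M.simple i, M.simple j} := by
  obtain ⟨-, T, hT, rfl⟩ := hH
  interval_cases hc : T.card
  · left
    simp [Finset.card_eq_zero.1 hc]
  · obtain ⟨i, rfl⟩ := Finset.card_eq_one.1 hc
    exact Or.inr ⟨i, i, by simp⟩
  · obtain ⟨i, j, -, rfl⟩ := Finset.card_eq_two.1 hc
    exact Or.inr ⟨i, j, by rw [Finset.coe_pair, Set.image_pair]⟩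

variable (M) in
/-- The finite labels off the diagonal are `2` or `4`. Following `CoxeterMatrix`, the entry `0`
stands for the absence of a relation. -/
def HasLabelsTwoFour : Prop := ∀ i j, i ≠ j → M i j = 0 ∨ M i j = 2 ∨ M i j = 4

variable (M) in
/-- Involutions testing injectivity on the elementary subgroups. -/
def testElements : Set M.Group :=
  Set.range M.simple ∪
    {γ | ∃ i j, i ≠ j ∧ M i j ≠ 0 ∧ γ = (M.simple i * M.simple j) ^ (M i j / 2)}

theorem finite_testElements : (testElements M).Finite := by
  refine (Set.finite_range _).union ((Set.finite_range fun p : Fin n × Fin n =>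
    (M.simple p.1 * M.simple p.2) ^ (M p.1 p.2 / 2)).subset ?_)
  rintro γ ⟨i, j, -, -, rfl⟩
  exact ⟨(i, j), rfl⟩

namespace HasLabelsTwoFour

theorem isLiftable (hM : HasLabelsTwoFour M) {G : Type*} [Group G] {f : Fin n → G} {i j : Fin n}
    (hf : ∀ k, f k * f k = 1) (hij : (f i * f j) ^ M i j = 1)
    (hk : ∀ k, k ≠ i → k ≠ j → f k = 1) : M.IsLiftable f := by
  have even_pow {k l : Fin n} (hkl : k ≠ l) {a : G} (ha : a * a = 1) : a ^ M k l = 1 := by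
    rcases hM k l hkl with h | h | h <;> rw [h]
    · exact pow_zero a
    · rw [pow_two, ha]
    · rw [show 4 = 2 * 2 by rfl, pow_mul, pow_two a, ha, one_pow]
  have hji : (f j * f i) ^ M j i = 1 := by
    rw [M.symmetric j i, ← inv_eq_of_mul_eq_one_left (hf i), ← inv_eq_of_mul_eq_one_left (hf j),
      ← mul_inv_rev, inv_pow, hij, inv_one]
  intro k l
  by_cases hkl : k = l
  · rw [hkl, hf, one_pow]
  by_cases hk' : k ≠ i ∧ k ≠ j
  · rw [hk k hk'.1 hk'.2, one_mul, even_pow hkl (hf l)]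
  by_cases hl' : l ≠ i ∧ l ≠ j
  · rw [hk l hl'.1 hl'.2, mul_one, even_pow hkl (hf k)]
  have hk'' : k = i ∨ k = j := by tauto
  have hl'' : l = i ∨ l = j := by tauto
  rcases hk'' with rfl | rfl <;> rcases hl'' with rfl | rfl
  exacts [absurd rfl hkl, hij, hji, absurd rfl hkl]

open DihedralGroup in
theorem orderOf_mul (hM : HasLabelsTwoFour M) {i j : Fin n} (hij : i ≠ j) :
    orderOf (M.simple i * M.simple j) = M i j := by
  apply Nat.dvd_antisymm (orderOf_dvd_of_pow_eq_one (simple_mul_simple_pow i j))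
  let f : Fin n → DihedralGroup (M i j) := fun k =>
    if k = i then sr 0 else if k = j then sr 1 else 1
  have f_i : f i = sr 0 := by simp [f]
  have f_j : f j = sr 1 := by simp [f, hij.symm]
  have f_mul : f i * f j = r 1 := by rw [f_i, f_j, sr_mul_sr, sub_zero]
  have f_self (k : Fin n) : f k * f k = 1 := by
    simp only [f]
    split_ifs
    exacts [sr_mul_self 0, sr_mul_self 1, one_mul 1]
  have hf : M.IsLiftable f :=
    hM.isLiftable f_self (by rw [f_mul, r_one_pow_n]) fun k hki hkj => by simp [f, hki, hkj]
  have lift_mul : M.toCoxeterSystem.lift ⟨f, hf⟩ (M.simple i * M.simple j) = r 1 := by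
    rw [map_mul, ← f_mul]
    exact congrArg₂ _ (M.toCoxeterSystem.lift_apply_simple hf i)
      (M.toCoxeterSystem.lift_apply_simple hf j)
  have dvd := orderOf_map_dvd (M.toCoxeterSystem.lift ⟨f, hf⟩) (M.simple i * M.simple j)
  rwa [lift_mul, orderOf_r_one] at dvd

theorem mul_self_of_mem (hM : HasLabelsTwoFour M) {γ : M.Group} (hγ : γ ∈ testElements M) :
    γ * γ = 1 := by
  rcases hγ with ⟨i, rfl⟩ | ⟨i, j, hij, h0, rfl⟩
  · exact simple_mul_self i
  · have hpow := simple_mul_simple_pow (M := M) i j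
    rcases (hM i j hij).resolve_left h0 with h | h <;>
      rw [h] at hpow ⊢ <;> rw [← pow_add] <;> exact hpow

theorem ne_one_of_mem (hM : HasLabelsTwoFour M) {γ : M.Group} (hγ : γ ∈ testElements M) :
    γ ≠ 1 := by
  rcases hγ with ⟨i, rfl⟩ | ⟨i, j, hij, h0, rfl⟩
  · exact simple_ne_one i
  · intro hγ1
    have dvd := orderOf_dvd_of_pow_eq_one hγ1
    rw [hM.orderOf_mul hij] at dvd
    rcases (hM i j hij).resolve_left h0 with h | h <;> norm_num [h] at dvd

/-- The product of two generators keeps its order under `ρ` since no smaller power of `2` kills the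
image; the remaining elements of the subgroup are conjugate to one of the generators. -/
theorem eq_one_of_mem_closure_pair (hM : HasLabelsTwoFour M) {G : Type*} [Group G]
    {ρ : M.Group →* G} (hρ : ∀ γ ∈ testElements M, ρ γ ≠ 1) {i j : Fin n}
    (hfin : Finite (Subgroup.closure {M.simple i, M.simple j})) {γ : M.Group}
    (hγ : γ ∈ Subgroup.closure {M.simple i, M.simple j}) (hργ : ρ γ = 1) : γ = 1 := by
  obtain ⟨k, rfl | rfl⟩ := mem_closure_pair_involutions (simple_mul_self i) (simple_mul_self j) hγ
  · by_cases hij : i = j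
    · rw [hij, simple_mul_self, one_zpow]
    have hmem : M.simple i * M.simple j ∈ Subgroup.closure {M.simple i, M.simple j} :=
      mul_mem (Subgroup.subset_closure (by simp)) (Subgroup.subset_closure (by simp))
    have h0 : M i j ≠ 0 := by
      rw [← hM.orderOf_mul hij, ← Subgroup.orderOf_mk _ hmem]
      exact (orderOf_pos _).ne'
    have orderOf_map : orderOf (ρ (M.simple i * M.simple j)) = M i j := by
      refine orderOf_eq_of_pow_half_ne_one ((hM i j hij).resolve_left h0) ?_ ?_
      · rw [← map_pow, simple_mul_simple_pow, map_one]
      · rw [← map_pow]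
        exact hρ _ (Or.inr ⟨i, j, hij, h0, rfl⟩)
    rwa [map_zpow, ← orderOf_dvd_iff_zpow_eq_one, orderOf_map, ← hM.orderOf_mul hij,
      orderOf_dvd_iff_zpow_eq_one] at hργ
  · exfalso
    rcases isConj_zpow_mul_of_involutions (simple_mul_self i) (simple_mul_self j) k with hc | hc
    all_goals
      have := ρ.map_isConj hc
      rw [hργ, isConj_one_left] at this
      exact hρ _ (Or.inl ⟨_, rfl⟩) this

theorem injOnElementary_iff (hM : HasLabelsTwoFour M) {G : Type*} [Group G] (ρ : M.Group →* G) :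
    InjOnElementary M ρ ↔ ∀ γ ∈ testElements M, ρ γ ≠ 1 := by
  constructor
  · intro hinj γ hγ hργ
    have not_mem (H : Subgroup M.Group) (hH : IsElementary M H) : γ ∉ H := fun hm =>
      hM.ne_one_of_mem hγ (hinj H hH hm H.one_mem (by rw [hργ, map_one]))
    rcases hγ with ⟨i, rfl⟩ | ⟨i, j, -, h0, rfl⟩
    · exact not_mem _ (isElementary_single i) (Subgroup.subset_closure rfl)
    · exact not_mem _ (isElementary_pair h0) (pow_mem
        (mul_mem (Subgroup.subset_closure (by simp)) (Subgroup.subset_closure (by simp))) _)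
  · intro hρ H hH a ha b hb hab
    have hfin := hH.1
    have mem : a * b⁻¹ ∈ H := H.mul_mem ha (H.inv_mem hb)
    refine mul_inv_eq_one.1 ?_
    rcases hH.eq_bot_or_closure_pair with rfl | ⟨i, j, rfl⟩
    · exact Subgroup.mem_bot.1 mem
    · exact hM.eq_one_of_mem_closure_pair hρ hfin mem (by simp [hab])

end HasLabelsTwoFour

end EvenCoxeter

section RepMat

open Matrix

variable {Γ : Type} [Group Γ] {R : Type*} [CommRing R] (ρ : Γ →* PO3 R)

/-- The rotation matrix of `ρ γ`. -/
def repMat (γ : Γ) : Matrix (Fin 3) (Fin 3) R :=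
  (PO3.equivSO (ρ γ)).1

theorem repMat_mem (γ : Γ) : repMat ρ γ ∈ specialOrthogonalGroup (Fin 3) R :=
  (PO3.equivSO (ρ γ)).2

theorem repMat_mul (γ δ : Γ) : repMat ρ (γ * δ) = repMat ρ γ * repMat ρ δ := by
  simp [repMat]

theorem repMat_one : repMat ρ 1 = 1 := by
  simp [repMat]

theorem repMat_pow (γ : Γ) (k : ℕ) : repMat ρ (γ ^ k) = repMat ρ γ ^ k := by
  simp [repMat]

theorem repMat_eq_one_iff (γ : Γ) : repMat ρ γ = 1 ↔ ρ γ = 1 := by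
  rw [← PO3.equivSO.injective.eq_iff, map_one, Subtype.ext_iff]
  rfl

theorem repMat_conjRep (g : PO3 R) (γ : Γ) :
    repMat (conjRep g ρ) γ = (PO3.equivSO g).1 * repMat ρ γ * (PO3.equivSO g).1ᵀ := by
  simp only [repMat, conjRep, MonoidHom.comp_apply, MulEquiv.coe_toMonoidHom, MulAut.conj_apply,
    map_mul, map_inv, Submonoid.coe_mul]
  rfl

theorem trace_repMat_conjRep (g : PO3 R) (γ : Γ) :
    (repMat (conjRep g ρ) γ).trace = (repMat ρ γ).trace := by
  rw [repMat_conjRep, trace_mul_comm, ← mul_assoc, transpose_mul_of_mem (PO3.equivSO g).2, one_mul]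

end RepMat

section Idempotent

open Matrix

variable {Γ : Type} [Group Γ] {R : Type*} [CommRing R] [Algebra ℚ R] (ρ : Γ →* PO3 R)

theorem univMatrix_eq_repMat (γ : Γ) :
    univMatrix Γ γ = repMat (repOf (AlgHom.id ℚ (RepRing Γ))) γ := by
  rw [repMat, equivSO_repOf]
  rfl

/-- The regular function `(3 - tr ρ(γ)) / 4`. If `γ` is an involution it is the idempotent with
value one where `ρ γ` is a half-turn and zero where `ρ γ` is trivial. -/
def traceIdem (γ : Γ) : RepRing Γ := (4⁻¹ : ℚ) • (3 - (univMatrix Γ γ).trace)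

theorem pointOf_trace (γ : Γ) : pointOf ρ (univMatrix Γ γ).trace = (repMat ρ γ).trace := by
  rw [AddMonoidHom.map_trace, univMatrix_map_pointOf, repMat]

theorem pointOf_traceIdem (γ : Γ) :
    pointOf ρ (traceIdem γ) = (4⁻¹ : ℚ) • (3 - (repMat ρ γ).trace) := by
  rw [traceIdem, map_smul, map_sub, pointOf_trace, map_ofNat]

theorem pointOf_traceIdem_eq_one_iff (γ : Γ) :
    pointOf ρ (traceIdem γ) = 1 ↔ (repMat ρ γ).trace = -1 := by
  rw [pointOf_traceIdem, inv_smul_eq_iff₀ (by norm_num), Algebra.smul_def, map_ofNat, mul_one]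
  constructor <;> intro h
  · linear_combination -h
  · linear_combination -h

theorem pointOf_traceIdem_eq_zero_iff {γ : Γ} (hγ : γ * γ = 1) :
    pointOf ρ (traceIdem γ) = 0 ↔ ρ γ = 1 := by
  have sq : repMat ρ γ * repMat ρ γ = 1 := by rw [← repMat_mul, hγ, repMat_one]
  rw [pointOf_traceIdem, inv_smul_eq_iff₀ (by norm_num), smul_zero, sub_eq_zero,
    ← repMat_eq_one_iff]
  constructor
  · exact fun h => eq_one_of_trace_three (repMat_mem ρ γ) sq h.symm
  · intro h
    rw [h, trace_one, Fintype.card_fin, Nat.cast_ofNat]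

theorem traceIdem_mul_self {γ : Γ} (hγ : γ * γ = 1) :
    traceIdem γ * traceIdem γ = traceIdem γ := by
  have trace_sq := trace_of_involution (univMatrix_mem Γ γ) (by
    rw [univMatrix_eq_repMat, ← repMat_mul, hγ, repMat_one])
  have inv_mul : algebraMap ℚ (RepRing Γ) 4⁻¹ * 4 = 1 := by
    rw [← map_ofNat (algebraMap ℚ (RepRing Γ)) 4, ← map_mul, inv_mul_cancel₀ four_ne_zero, map_one]
  rw [traceIdem, Algebra.smul_def]
  linear_combination algebraMap ℚ (RepRing Γ) 4⁻¹ ^ 2 * trace_sq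
    + algebraMap ℚ (RepRing Γ) 4⁻¹ * (3 - (univMatrix Γ γ).trace) * inv_mul

theorem traceIdem_mem_charRing (γ : Γ) : traceIdem γ ∈ charRing Γ := by
  intro R _ _ ρ g
  rw [pointOf_traceIdem, pointOf_traceIdem, trace_repMat_conjRep]

variable {n : ℕ} (M : CoxeterMatrix (Fin n))

/-- The regular function with value one where every test involution acts as a half-turn and zero
elsewhere; for labels `2` and `4` its nonvanishing locus is `Hom_o`. -/
def elementaryIdem : RepRing M.Group :=
  ∏ γ ∈ (finite_testElements (M := M)).toFinset, traceIdem γ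

variable {M}

theorem elementaryIdem_mem_charRing : elementaryIdem M ∈ charRing M.Group :=
  prod_mem fun γ _ => traceIdem_mem_charRing γ

namespace HasLabelsTwoFour

theorem elementaryIdem_mul_self (hM : HasLabelsTwoFour M) :
    elementaryIdem M * elementaryIdem M = elementaryIdem M := by
  rw [elementaryIdem, ← Finset.prod_mul_distrib]
  exact Finset.prod_congr rfl fun γ hγ =>
    traceIdem_mul_self (hM.mul_self_of_mem (finite_testElements.mem_toFinset.1 hγ))

theorem pointOf_elementaryIdem_eq_one_iff (hM : HasLabelsTwoFour M) (ρ : M.Group →* PO3 R) :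
    pointOf ρ (elementaryIdem M) = 1 ↔ ∀ γ ∈ testElements M, (repMat ρ γ).trace = -1 := by
  simp only [← pointOf_traceIdem_eq_one_iff]
  constructor
  · classical
    intro h γ hγ
    have absorb : traceIdem γ * elementaryIdem M = elementaryIdem M := by
      rw [elementaryIdem,
        ← Finset.mul_prod_erase _ _ (finite_testElements.mem_toFinset.2 hγ), ← mul_assoc,
        traceIdem_mul_self (hM.mul_self_of_mem hγ)]
    rw [← mul_one (pointOf ρ (traceIdem γ)), ← h, ← map_mul, absorb]
  · intro h
    rw [elementaryIdem, map_prod]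
    exact Finset.prod_eq_one fun γ hγ => h γ (finite_testElements.mem_toFinset.1 hγ)

variable {K : Type*} [Field K] [Algebra ℚ K]

theorem pointOf_elementaryIdem_ne_zero_iff (hM : HasLabelsTwoFour M) (ρ : M.Group →* PO3 K) :
    pointOf ρ (elementaryIdem M) ≠ 0 ↔ InjOnElementary M ρ := by
  rw [hM.injOnElementary_iff, elementaryIdem, map_prod, Finset.prod_ne_zero_iff]
  simp only [finite_testElements.mem_toFinset]
  exact forall₂_congr fun γ hγ =>
    (pointOf_traceIdem_eq_zero_iff ρ (hM.mul_self_of_mem hγ)).not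

theorem injOnElementary_repAt_iff (hM : HasLabelsTwoFour M)
    (p : PrimeSpectrum (RepRing M.Group)) :
    InjOnElementary M (repAt p) ↔ elementaryIdem M ∉ p.asIdeal := by
  rw [← hM.pointOf_elementaryIdem_ne_zero_iff, repAt, pointOf_repOf, ne_eq,
    ← Ideal.algebraMap_residueField_eq_zero]
  rfl

theorem pointOf_elementaryIdem_of_injOn (hM : HasLabelsTwoFour M) (ρ : M.Group →* PO3 K)
    (hρ : InjOnElementary M ρ) : pointOf ρ (elementaryIdem M) = 1 := by
  have idem : IsIdempotentElem (pointOf ρ (elementaryIdem M)) :=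
    (show IsIdempotentElem _ from hM.elementaryIdem_mul_self).map (pointOf ρ)
  exact (IsIdempotentElem.iff_eq_zero_or_one.1 idem).resolve_left
    ((hM.pointOf_elementaryIdem_ne_zero_iff ρ).2 hρ)

end HasLabelsTwoFour

theorem IsSlice.standingAssumption (hM : HasLabelsTwoFour M) {J : Ideal (RepRing M.Group)}
    (h : IsSlice (elementaryIdem M) J) : StandingAssumption M := fun ρ hρ =>
  ⟨h.centralizer_eq_center ρ (hM.pointOf_elementaryIdem_of_injOn ρ hρ),
    h.isStable ρ (hM.pointOf_elementaryIdem_of_injOn ρ hρ)⟩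

namespace HasLabelsTwoFour

variable {ρ : M.Group →* PO3 R}

theorem isHalfTurn (hM : HasLabelsTwoFour M)
    (hρ : pointOf ρ (elementaryIdem M) = 1) (i : Fin n) : IsHalfTurn (repMat ρ (M.simple i)) :=
  ⟨repMat_mem _ _, by rw [← repMat_mul, simple_mul_self, repMat_one],
    (hM.pointOf_elementaryIdem_eq_one_iff ρ).1 hρ _ (Or.inl ⟨i, rfl⟩)⟩

theorem isHalfTurn_pow_half (hM : HasLabelsTwoFour M)
    (hρ : pointOf ρ (elementaryIdem M) = 1) {i j : Fin n} (hij : i ≠ j) (h0 : M i j ≠ 0) :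
    IsHalfTurn ((repMat ρ (M.simple i) * repMat ρ (M.simple j)) ^ (M i j / 2)) := by
  have hγ : (M.simple i * M.simple j) ^ (M i j / 2) ∈ testElements M :=
    Or.inr ⟨i, j, hij, h0, rfl⟩
  rw [← repMat_mul, ← repMat_pow]
  exact ⟨repMat_mem _ _, by rw [← repMat_mul, hM.mul_self_of_mem hγ, repMat_one],
    (hM.pointOf_elementaryIdem_eq_one_iff ρ).1 hρ _ hγ⟩

theorem mul_eq_zero (hM : HasLabelsTwoFour M)
    (hρ : pointOf ρ (elementaryIdem M) = 1) {i j : Fin n} (hij : M i j = 2)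
    {P Q : Matrix (Fin 3) (Fin 3) R} (hP : IsLineProj P) (hQ : IsLineProj Q)
    (hi : repMat ρ (M.simple i) = 2 * P - 1) (hj : repMat ρ (M.simple j) = 2 * Q - 1) :
    P * Q = 0 := by
  have hne : i ≠ j := by rintro rfl; simp at hij
  have half := hM.isHalfTurn_pow_half hρ hne (by rw [hij]; exact two_ne_zero)
  rw [hij, hi, hj, Nat.div_self two_pos, pow_one] at half
  exact (hP.mul_eq_zero_iff_isHalfTurn hQ).2 half

theorem two_mul_trace (hM : HasLabelsTwoFour M)
    (hρ : pointOf ρ (elementaryIdem M) = 1) {i j : Fin n} (hij : M i j = 4)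
    {P Q : Matrix (Fin 3) (Fin 3) R} (hP : IsLineProj P) (hQ : IsLineProj Q)
    (hi : repMat ρ (M.simple i) = 2 * P - 1) (hj : repMat ρ (M.simple j) = 2 * Q - 1) :
    2 * (P * Q).trace = 1 := by
  have hne : i ≠ j := by rintro rfl; simp at hij
  have half := hM.isHalfTurn_pow_half hρ hne (by rw [hij]; exact four_ne_zero)
  rw [hij, show 4 / 2 = 2 by rfl, isHalfTurn_sq_iff
    (mul_mem (repMat_mem ρ _) (repMat_mem ρ _)), hi, hj, hP.trace_mul_two_mul_sub_one hQ] at half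
  apply (isUnit_ofNat R 2).mul_left_cancel
  linear_combination half

end HasLabelsTwoFour

end Idempotent

section VecTerms

open Matrix

theorem map_axisVec {R S : Type*} [CommRing R] [CommRing S] (f : R →+* S) (k : Fin 3) :
    f ∘ axisVec k = axisVec k := by
  funext i
  by_cases h : i = k <;> simp [axisVec, h]

theorem map_diagVec {R S : Type*} [CommRing R] [CommRing S] (f : R →+* S) (k : Fin 2) :
    f ∘ diagVec k = diagVec k := by
  rw [diagVec, diagVec, ← map_axisVec f, ← map_axisVec f]
  funext i
  exact map_add f _ _

/-- Expressions for vectors in space, built by cross products from the standard axes, the bisectors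
of consecutive axes and the vectors `(1, xᵢ, 0)`. -/
inductive VecTerm (m : ℕ) : Type
  | axis (k : Fin 3) : VecTerm m
  | diag (k : Fin 2) : VecTerm m
  | var (i : Fin m) : VecTerm m
  | cross (a b : VecTerm m) : VecTerm m

namespace VecTerm

variable {m : ℕ} {R : Type*} [CommRing R]

/-- The vector denoted by an expression. -/
def eval (x : Fin m → R) : VecTerm m → Fin 3 → R
  | axis k => axisVec k
  | diag k => diagVec k
  | var i => ![1, x i, 0]
  | cross a b => crossProduct (eval x a) (eval x b)

theorem map_eval {S : Type*} [CommRing S] (f : R →+* S) (x : Fin m → R) (t : VecTerm m) :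
    f ∘ eval x t = eval (f ∘ x) t := by
  induction t with
  | axis k => exact map_axisVec f k
  | diag k => exact map_diagVec f k
  | var i => ext j; fin_cases j <;> simp [eval]
  | cross a b iha ihb =>
    simp only [eval, ← iha, ← ihb]
    ext j
    fin_cases j <;> simp [cross_apply]

theorem map_eval_dot_self {S : Type*} [CommRing S] (f : R →+* S) (x : Fin m → R) (t : VecTerm m) :
    f (eval x t ⬝ᵥ eval x t) = eval (f ∘ x) t ⬝ᵥ eval (f ∘ x) t := by
  rw [RingHom.map_dotProduct, map_eval]

theorem cross_ne_left (a b : VecTerm m) : cross a b ≠ a := by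
  intro h
  have := congrArg sizeOf h
  simp only [cross.sizeOf_spec] at this
  lia

theorem cross_ne_right (a b : VecTerm m) : cross a b ≠ b := by
  intro h
  have := congrArg sizeOf h
  simp only [cross.sizeOf_spec] at this
  lia

/-- The pairs of expressions whose values are orthogonal by construction, or are to be made
orthogonal by a relation in `Rl`. A relation `t` stands for the vanishing of the second coordinate
of `t`. -/
inductive Orth (Rl : Set (VecTerm m)) : VecTerm m → VecTerm m → Prop
  | axis (i j : Fin 3) : i ≠ j → Orth Rl (axis i) (axis j)
  | diag (k : Fin 2) (l : Fin 3) : k.castSucc ≠ l → k.succ ≠ l → Orth Rl (diag k) (axis l)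
  | var (i : Fin m) : Orth Rl (var i) (axis 2)
  | left (a b : VecTerm m) : Orth Rl (cross a b) a
  | right (a b : VecTerm m) : Orth Rl (cross a b) b
  | rel (a b : VecTerm m) : cross a b ∈ Rl → Orth Rl (cross a b) (axis 1)

/-- The pairs consisting of a bisector and the first of the axes it bisects. -/
inductive Bisect : VecTerm m → VecTerm m → Prop
  | diag (k : Fin 2) : Bisect (diag k) (axis k.castSucc)

variable {Rl : Set (VecTerm m)} {s t : VecTerm m}

theorem Orth.ne (h : Orth Rl s t) : s ≠ t := by
  cases h with
  | axis i j hij => exact fun h => hij (axis.inj h)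
  | left a b => exact cross_ne_left _ _
  | right a b => exact cross_ne_right _ _
  | _ => exact nofun

theorem Bisect.ne (h : Bisect s t) : s ≠ t := by
  cases h
  exact nofun

theorem Orth.not_bisect (h : Orth Rl s t) : ¬(Bisect s t ∨ Bisect t s) := by
  rintro (h' | h') <;> cases h <;> cases h'
  contradiction

theorem Orth.dot_eq_zero (h : Orth Rl s t) {x : Fin m → R} (hx : ∀ r ∈ Rl, eval x r 1 = 0) :
    eval x s ⬝ᵥ eval x t = 0 := by
  cases h with
  | axis i j hij => simp [eval, axisVec_dot, hij]
  | diag k l h h' => simp [eval, diagVec, axisVec_dot, h, h']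
  | var i => simp [eval, axisVec]
  | left a b => rw [eval, dotProduct_comm, dot_self_cross]
  | right a b => rw [eval, dotProduct_comm, dot_cross_self]
  | rel a b h => simpa [eval, axisVec] using hx _ h

theorem Bisect.dot (h : Bisect s t) (x : Fin m → R) :
    2 * (eval x s ⬝ᵥ eval x t) ^ 2 = (eval x s ⬝ᵥ eval x s) * (eval x t ⬝ᵥ eval x t) := by
  obtain ⟨k⟩ := h
  have hk : k.castSucc ≠ k.succ := Fin.castSucc_lt_succ.ne
  simp [eval, diagVec, axisVec_dot, hk, hk.symm, one_add_one_eq_two]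

open Classical in
variable (Rl s t) in
/-- The Coxeter label of a pair of expressions: `2` for orthogonal lines, `4` for lines at an angle
of 45 degrees, and `0` (no relation) otherwise. -/
def label : ℕ :=
  if s = t then 1 else if Bisect s t ∨ Bisect t s then 4
    else if Orth Rl s t ∨ Orth Rl t s then 2 else 0

theorem label_self (s : VecTerm m) : label Rl s s = 1 := if_pos rfl

theorem label_comm (s t : VecTerm m) : label Rl s t = label Rl t s := by
  grind [label]

theorem label_cases (h : s ≠ t) : label Rl s t = 0 ∨ label Rl s t = 2 ∨ label Rl s t = 4 := by
  unfold label
  split_ifs <;> simp_all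

theorem Bisect.label_eq (h : Bisect s t) : label Rl s t = 4 := by
  rw [label, if_neg h.ne, if_pos (Or.inl h)]

theorem Orth.label_eq (h : Orth Rl s t) : label Rl s t = 2 := by
  rw [label, if_neg h.ne, if_neg h.not_bisect, if_pos (Or.inl h)]

theorem dot_eq_zero_of_label (h : label Rl s t = 2) {x : Fin m → R}
    (hx : ∀ r ∈ Rl, eval x r 1 = 0) : eval x s ⬝ᵥ eval x t = 0 := by
  have orth : Orth Rl s t ∨ Orth Rl t s := by grind [label]
  rcases orth with orth | orth
  · exact orth.dot_eq_zero hx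
  · rw [dotProduct_comm, orth.dot_eq_zero hx]

theorem dot_of_label (h : label Rl s t = 4) (x : Fin m → R) :
    2 * (eval x s ⬝ᵥ eval x t) ^ 2 = (eval x s ⬝ᵥ eval x s) * (eval x t ⬝ᵥ eval x t) := by
  have bisect : Bisect s t ∨ Bisect t s := by grind [label]
  rcases bisect with bisect | bisect
  · exact bisect.dot x
  · rw [dotProduct_comm (eval x s) (eval x t), bisect.dot x, mul_comm]

end VecTerm

end VecTerms

section Configurations

open Matrix

/-- A finite set of vector expressions closed under subexpressions, with a set of relations
requiring the second coordinate of some of the cross products to vanish. It is a recipe for a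
Coxeter group: the expressions are the generators, and `VecTerm.label` gives the labels. -/
structure Config (m : ℕ) where
  /-- the expressions -/
  terms : Finset (VecTerm m)
  /-- the expressions whose second coordinate is required to vanish -/
  rels : Set (VecTerm m)
  axis_mem : ∀ k, .axis k ∈ terms
  diag_mem : ∀ k, .diag k ∈ terms
  var_mem : ∀ i, .var i ∈ terms
  left_mem : ∀ a b, .cross a b ∈ terms → a ∈ terms
  right_mem : ∀ a b, .cross a b ∈ terms → b ∈ terms
  rels_subset : ∀ t ∈ rels, t ∈ terms
  rels_cross : ∀ t ∈ rels, ∃ a b, t = .cross a b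

namespace Config

variable {m : ℕ} (c : Config m)

/-- An enumeration of the expressions of a configuration. -/
def term (i : Fin c.terms.card) : VecTerm m := (c.terms.equivFin.symm i).1

theorem term_mem (i : Fin c.terms.card) : c.term i ∈ c.terms := (c.terms.equivFin.symm i).2

theorem term_injective : Function.Injective c.term :=
  Subtype.val_injective.comp c.terms.equivFin.symm.injective

theorem exists_term_eq {t : VecTerm m} (ht : t ∈ c.terms) : ∃ i, c.term i = t :=
  ⟨c.terms.equivFin ⟨t, ht⟩, by rw [term, Equiv.symm_apply_apply]⟩

/-- The Coxeter matrix of a configuration. -/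
def coxeter : CoxeterMatrix (Fin c.terms.card) where
  M := Matrix.of fun i j => VecTerm.label c.rels (c.term i) (c.term j)
  isSymm := by
    ext i j
    exact VecTerm.label_comm _ _
  diagonal i := VecTerm.label_self _
  off_diagonal i j h := by
    rcases VecTerm.label_cases (Rl := c.rels) (c.term_injective.ne h) with h' | h' | h' <;>
      simp [h']

theorem hasLabels : HasLabelsTwoFour c.coxeter := fun _ _ h =>
  VecTerm.label_cases (c.term_injective.ne h)

open Classical in
/-- The generator attached to an expression, with the junk value `1` for expressions that do not
belong to the configuration. -/
def gen (t : VecTerm m) : c.coxeter.Group :=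
  if h : t ∈ c.terms then c.coxeter.simple (c.terms.equivFin ⟨t, h⟩) else 1

theorem gen_term (i : Fin c.terms.card) : c.gen (c.term i) = c.coxeter.simple i := by
  rw [gen, dif_pos (c.term_mem i)]
  exact congrArg c.coxeter.simple (c.terms.equivFin.apply_symm_apply i)

variable {c} {R : Type*} [CommRing R]

theorem rep_ext {ρ σ : c.coxeter.Group →* PO3 R}
    (h : ∀ t ∈ c.terms, repMat ρ (c.gen t) = repMat σ (c.gen t)) : ρ = σ := by
  refine c.coxeter.toCoxeterSystem.ext_simple fun i => PO3.equivSO.injective (Subtype.ext ?_)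
  have := h _ (c.term_mem i)
  rwa [gen_term] at this

variable [Algebra ℚ R] {ρ : c.coxeter.Group →* PO3 R}

theorem exists_lineProj (hρ : pointOf ρ (elementaryIdem c.coxeter) = 1) {t : VecTerm m}
    (ht : t ∈ c.terms) : ∃ P, IsLineProj P ∧ repMat ρ (c.gen t) = 2 * P - 1 := by
  obtain ⟨i, rfl⟩ := c.exists_term_eq ht
  rw [gen_term]
  exact (c.hasLabels.isHalfTurn hρ i).exists_lineProj

variable {s t : VecTerm m} {P Q : Matrix (Fin 3) (Fin 3) R}

theorem mul_eq_zero (hρ : pointOf ρ (elementaryIdem c.coxeter) = 1) (hs : s ∈ c.terms)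
    (ht : t ∈ c.terms) (hst : VecTerm.Orth c.rels s t) (hP : IsLineProj P) (hQ : IsLineProj Q)
    (hsP : repMat ρ (c.gen s) = 2 * P - 1) (htQ : repMat ρ (c.gen t) = 2 * Q - 1) :
    P * Q = 0 := by
  obtain ⟨i, rfl⟩ := c.exists_term_eq hs
  obtain ⟨j, rfl⟩ := c.exists_term_eq ht
  rw [gen_term] at hsP htQ
  exact c.hasLabels.mul_eq_zero hρ hst.label_eq hP hQ hsP htQ

theorem two_mul_trace (hρ : pointOf ρ (elementaryIdem c.coxeter) = 1) (hs : s ∈ c.terms)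
    (ht : t ∈ c.terms) (hst : VecTerm.Bisect s t) (hP : IsLineProj P) (hQ : IsLineProj Q)
    (hsP : repMat ρ (c.gen s) = 2 * P - 1) (htQ : repMat ρ (c.gen t) = 2 * Q - 1) :
    2 * (P * Q).trace = 1 := by
  obtain ⟨i, rfl⟩ := c.exists_term_eq hs
  obtain ⟨j, rfl⟩ := c.exists_term_eq ht
  rw [gen_term] at hsP htQ
  exact c.hasLabels.two_mul_trace hρ hst.label_eq hP hQ hsP htQ

variable (c)

/-- The ideal of the closed subscheme of the representations in `Hom_o` that map the axes and
bisectors to the standard half-turns. -/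
def sliceIdeal : Ideal (RepRing c.coxeter.Group) :=
  Ideal.span ({1 - elementaryIdem c.coxeter} ∪
    {a | ∃ k i j, a = univMatrix _ (c.gen (.axis k)) i j - halfTurn (axisVec k) i j} ∪
    {a | ∃ k i j, a = univMatrix _ (c.gen (.diag k)) i j - halfTurn (diagVec k) i j})

/-- The representations in `Hom_o` that map the axes and bisectors to the standard half-turns. -/
structure IsNormalized (ρ : c.coxeter.Group →* PO3 R) : Prop where
  idem : pointOf ρ (elementaryIdem c.coxeter) = 1
  axis : ∀ k, repMat ρ (c.gen (.axis k)) = halfTurn (axisVec k)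
  diag : ∀ k, repMat ρ (c.gen (.diag k)) = halfTurn (diagVec k)

theorem pointOf_univMatrix_sub_halfTurn {Γ : Type} [Group Γ] (ρ : Γ →* PO3 R) (γ : Γ)
    {v : Fin 3 → RepRing Γ} (hv : IsUnit (v ⬝ᵥ v)) (i j : Fin 3) :
    pointOf ρ (univMatrix Γ γ i j - halfTurn v i j)
      = repMat ρ γ i j - halfTurn (pointOf ρ ∘ v) i j := by
  have hmat : (univMatrix Γ γ).map (pointOf ρ) = repMat ρ γ := univMatrix_map_pointOf ρ γ
  have hturn : (halfTurn v).map (pointOf ρ) = halfTurn (pointOf ρ ∘ v) :=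
    map_halfTurn (pointOf ρ).toRingHom hv
  rw [← hmat, ← hturn, map_sub, Matrix.map_apply, Matrix.map_apply]

theorem isNormalized_iff (ρ : c.coxeter.Group →* PO3 R) :
    c.IsNormalized ρ ↔ OnZeroLocus c.sliceIdeal ρ := by
  have eq_zero_axis (k i j) :
      pointOf ρ (univMatrix _ (c.gen (.axis k)) i j - halfTurn (axisVec k) i j) = 0 ↔
        repMat ρ (c.gen (.axis k)) i j = halfTurn (axisVec k) i j := by
    rw [pointOf_univMatrix_sub_halfTurn ρ _ (isUnit_axisVec k), sub_eq_zero]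
    exact Eq.congr_right (congrArg (halfTurn · i j) (map_axisVec (pointOf ρ).toRingHom k))
  have eq_zero_diag (k i j) :
      pointOf ρ (univMatrix _ (c.gen (.diag k)) i j - halfTurn (diagVec k) i j) = 0 ↔
        repMat ρ (c.gen (.diag k)) i j = halfTurn (diagVec k) i j := by
    rw [pointOf_univMatrix_sub_halfTurn ρ _ (isUnit_diagVec k), sub_eq_zero]
    exact Eq.congr_right (congrArg (halfTurn · i j) (map_diagVec (pointOf ρ).toRingHom k))
  have eq_zero_idem : pointOf ρ (1 - elementaryIdem c.coxeter) = 0 ↔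
      pointOf ρ (elementaryIdem c.coxeter) = 1 := by
    rw [map_sub, map_one, sub_eq_zero, eq_comm]
  constructor
  · intro h
    refine show c.sliceIdeal ≤ RingHom.ker (pointOf ρ) from Ideal.span_le.2 ?_
    rintro a ((rfl | ⟨k, i, j, rfl⟩) | ⟨k, i, j, rfl⟩)
    · exact eq_zero_idem.2 h.idem
    · exact (eq_zero_axis k i j).2 (by rw [h.axis])
    · exact (eq_zero_diag k i j).2 (by rw [h.diag])
  · intro h
    refine ⟨eq_zero_idem.1 (h _ (Ideal.subset_span (Or.inl (Or.inl rfl)))), fun k => ?_,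
      fun k => ?_⟩ <;> ext i j
    · exact (eq_zero_axis k i j).1 (h _ (Ideal.subset_span (Or.inl (Or.inr ⟨k, i, j, rfl⟩))))
    · exact (eq_zero_diag k i j).1 (h _ (Ideal.subset_span (Or.inr ⟨k, i, j, rfl⟩)))

theorem exists_isNormalized (hρ : pointOf ρ (elementaryIdem c.coxeter) = 1) :
    ∃ g, c.IsNormalized (conjRep g ρ) := by
  choose P hP hPe using fun k => exists_lineProj hρ (c.axis_mem k)
  choose D hD hDe using fun k => exists_lineProj hρ (c.diag_mem k)
  have orth (k l) (h : k.castSucc ≠ l) (h' : k.succ ≠ l) : D k * P l = 0 :=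
    mul_eq_zero hρ (c.diag_mem k) (c.axis_mem l) (.diag k l h h') (hD k) (hP l) (hDe k) (hPe l)
  have frame : IsFrame P D :=
    { axis := hP
      diag := hD
      orth := fun i j hij => mul_eq_zero hρ (c.axis_mem i) (c.axis_mem j) (.axis i j hij)
        (hP i) (hP j) (hPe i) (hPe j)
      orth_zero := orth 0 2 (by decide) (by decide)
      orth_one := orth 1 0 (by decide) (by decide)
      bisect := fun k => two_mul_trace hρ (c.diag_mem k) (c.axis_mem _) (.diag k) (hD k) (hP _)
        (hDe k) (hPe _) }
  obtain ⟨g, hg, hgP, hgD⟩ := frame.exists_rotation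
  have hgt : gᵀ ∈ specialOrthogonalGroup (Fin 3) R :=
    mem_specialOrthogonalGroup_of_det (by rw [transpose_transpose, transpose_mul_of_mem hg])
      (by rw [det_transpose, det_of_mem hg])
  have unrotate (v : Fin 3 → R) : gᵀ * (2 * lineProj (g *ᵥ v) - 1) * gᵀᵀ = halfTurn v := by
    rw [← halfTurn, conj_halfTurn hgt, mulVec_mulVec, transpose_mul_of_mem hg, one_mulVec]
  refine ⟨PO3.equivSO.symm ⟨gᵀ, hgt⟩, ?_, fun k => ?_, fun k => ?_⟩
  · rw [c.hasLabels.pointOf_elementaryIdem_eq_one_iff] at hρ ⊢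
    intro γ hγ
    rw [trace_repMat_conjRep, hρ γ hγ]
  · rw [repMat_conjRep, hPe, hgP, MulEquiv.apply_symm_apply, unrotate]
  · rw [repMat_conjRep, hDe, hgD, MulEquiv.apply_symm_apply, unrotate]

theorem eq_one_of_isNormalized {g : PO3 R} (h : c.IsNormalized ρ)
    (hg : c.IsNormalized (conjRep g ρ)) : g = 1 := by
  have lineProj_eq {v w : Fin 3 → R} (h : halfTurn v = halfTurn w) : lineProj v = lineProj w :=
    (isUnit_ofNat (Matrix (Fin 3) (Fin 3) R) 2).mul_left_cancel (sub_left_injective h)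
  refine PO3.equivSO.injective (Subtype.ext ?_)
  rw [map_one]
  refine eq_one_of_fixes_frame (PO3.equivSO g).2 (fun k => lineProj_eq ?_)
    (fun k => lineProj_eq ?_)
  · rw [← conj_halfTurn (PO3.equivSO g).2, ← h.axis, ← repMat_conjRep, hg.axis, h.axis]
  · rw [← conj_halfTurn (PO3.equivSO g).2, ← h.diag, ← repMat_conjRep, hg.diag, h.diag]

theorem isSlice : IsSlice (elementaryIdem c.coxeter) c.sliceIdeal where
  idem := c.hasLabels.elementaryIdem_mul_self
  inv := elementaryIdem_mem_charRing
  mem := Ideal.subset_span (Or.inl (Or.inl rfl))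
  exists_conj _ _ _ _ hρ := (c.exists_isNormalized hρ).imp fun _ => (c.isNormalized_iff _).1
  unique _ _ _ _ _ h hg :=
    c.eq_one_of_isNormalized ((c.isNormalized_iff _).2 h) ((c.isNormalized_iff _).2 hg)

end Config

end Configurations

section Realization

open Matrix

section

variable {R : Type*} [CommRing R] {v w : Fin 3 → R}

theorem dotProduct_eq_zero_of_lineProj_mulVec (hv : IsUnit (v ⬝ᵥ v)) (h : lineProj v *ᵥ w = 0) :
    v ⬝ᵥ w = 0 := by
  have := congrArg (v ⬝ᵥ ·) h
  simp only [lineProj_mulVec, dotProduct_smul, smul_eq_mul, dotProduct_zero] at this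
  linear_combination this - (v ⬝ᵥ w) * Ring.inverse_mul_cancel _ hv

theorem one_add_halfTurn_zero_zero (x : R) :
    1 + halfTurn ![1, x, 0] 0 0 = 2 * Ring.inverse (![1, x, 0] ⬝ᵥ ![1, x, 0]) := by
  rw [halfTurn, two_mul (lineProj _)]
  simp only [Matrix.sub_apply, Matrix.add_apply, lineProj, Matrix.smul_apply, vecMulVec_apply,
    one_apply_eq, cons_val_zero, smul_eq_mul]
  ring

theorem halfTurn_zero_one (x : R) :
    halfTurn ![1, x, 0] 0 1 = 2 * Ring.inverse (![1, x, 0] ⬝ᵥ ![1, x, 0]) * x := by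
  rw [halfTurn, two_mul (lineProj _)]
  simp only [Matrix.sub_apply, Matrix.add_apply, lineProj, Matrix.smul_apply, vecMulVec_apply,
    cons_val_zero, cons_val_one, smul_eq_mul, one_apply_ne (zero_ne_one)]
  ring

variable [Algebra ℚ R]

theorem isHalfTurn_halfTurn (hv : IsUnit (v ⬝ᵥ v)) : IsHalfTurn (halfTurn v) :=
  (isLineProj_lineProj hv).isHalfTurn

theorem isHalfTurn_halfTurn_mul (hv : IsUnit (v ⬝ᵥ v)) (hw : IsUnit (w ⬝ᵥ w))
    (h : v ⬝ᵥ w = 0) : IsHalfTurn (halfTurn v * halfTurn w) :=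
  ((isLineProj_lineProj hv).mul_eq_zero_iff_isHalfTurn (isLineProj_lineProj hw)).1
    (lineProj_mul_eq_zero h)

theorem isHalfTurn_halfTurn_mul_sq (hv : IsUnit (v ⬝ᵥ v)) (hw : IsUnit (w ⬝ᵥ w))
    (h : 2 * (v ⬝ᵥ w) ^ 2 = (v ⬝ᵥ v) * (w ⬝ᵥ w)) :
    IsHalfTurn ((halfTurn v * halfTurn w) ^ 2) := by
  rw [isHalfTurn_sq_iff (mul_mem (isHalfTurn_halfTurn hv).mem (isHalfTurn_halfTurn hw).mem),
    halfTurn, halfTurn, (isLineProj_lineProj hv).trace_mul_two_mul_sub_one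
      (isLineProj_lineProj hw), trace_lineProj_mul]
  linear_combination 2 * Ring.inverse (v ⬝ᵥ v) * Ring.inverse (w ⬝ᵥ w) * h
    + 2 * Ring.inverse (w ⬝ᵥ w) * (w ⬝ᵥ w) * Ring.inverse_mul_cancel _ hv
    + 2 * Ring.inverse_mul_cancel _ hw

end

namespace Config

variable {m : ℕ} {c : Config m} {R : Type*} [CommRing R]

variable (c) in
/-- The tuples satisfying the relations of the configuration, at which all the vectors of the
configuration are nondegenerate. -/
structure IsSolution (x : Fin m → R) : Prop where
  isUnit : ∀ t ∈ c.terms, IsUnit (t.eval x ⬝ᵥ t.eval x)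
  rel : ∀ t ∈ c.rels, t.eval x 1 = 0

theorem IsSolution.map {S : Type*} [CommRing S] (f : R →+* S) {x : Fin m → R}
    (hx : c.IsSolution x) : c.IsSolution (f ∘ x) where
  isUnit t ht := by
    rw [← VecTerm.map_eval_dot_self]
    exact (hx.isUnit t ht).map f
  rel t ht := by rw [← VecTerm.map_eval, Function.comp_apply, hx.rel t ht, map_zero]

variable [Algebra ℚ R]

namespace IsSolution

variable {x : Fin m → R} (hx : c.IsSolution x)
include hx

theorem isHalfTurn_term (i : Fin c.terms.card) : IsHalfTurn (halfTurn ((c.term i).eval x)) :=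
  isHalfTurn_halfTurn (hx.isUnit _ (c.term_mem i))

theorem isHalfTurn_term_mul_pow_half {i j : Fin c.terms.card} (hij : i ≠ j)
    (h0 : c.coxeter i j ≠ 0) : IsHalfTurn
      ((halfTurn ((c.term i).eval x) * halfTurn ((c.term j).eval x)) ^ (c.coxeter i j / 2)) := by
  have hi := hx.isUnit _ (c.term_mem i)
  have hj := hx.isUnit _ (c.term_mem j)
  rcases c.hasLabels i j hij with h | h | h
  · exact absurd h h0
  · rw [h, Nat.div_self two_pos, pow_one]
    exact isHalfTurn_halfTurn_mul hi hj (VecTerm.dot_eq_zero_of_label h hx.rel)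
  · rw [h]
    exact isHalfTurn_halfTurn_mul_sq hi hj (VecTerm.dot_of_label h x)

/-- The images of the generators under the representation attached to a solution. -/
def genImage (i : Fin c.terms.card) : PO3 R :=
  PO3.equivSO.symm ⟨halfTurn ((c.term i).eval x), (hx.isHalfTurn_term i).mem⟩

theorem equivSO_genImage (i : Fin c.terms.card) :
    (PO3.equivSO (hx.genImage i)).1 = halfTurn ((c.term i).eval x) := by
  rw [genImage, MulEquiv.apply_symm_apply]

theorem isLiftable : c.coxeter.IsLiftable hx.genImage := by
  intro i j
  refine PO3.equivSO.injective (Subtype.ext ?_)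
  rw [map_pow, map_mul, map_one]
  simp only [SubmonoidClass.coe_pow, Submonoid.coe_mul, Submonoid.coe_one, equivSO_genImage]
  by_cases hij : i = j
  · rw [hij, c.coxeter.diagonal, pow_one]
    exact (hx.isHalfTurn_term j).sq
  by_cases h0 : c.coxeter i j = 0
  · rw [h0, pow_zero]
  have half_add_half : c.coxeter i j = c.coxeter i j / 2 + c.coxeter i j / 2 := by
    rcases c.hasLabels i j hij with h | h | h <;> rw [h]
  rw [half_add_half, pow_add]
  exact (hx.isHalfTurn_term_mul_pow_half hij h0).sq

/-- The representation attached to a solution: each generator acts by the half-turn about the value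
of its expression. -/
def rep : c.coxeter.Group →* PO3 R := c.coxeter.toCoxeterSystem.lift ⟨hx.genImage, hx.isLiftable⟩

theorem repMat_rep_simple (i : Fin c.terms.card) :
    repMat hx.rep (c.coxeter.simple i) = halfTurn ((c.term i).eval x) := by
  have lift_simple : hx.rep (c.coxeter.simple i) = hx.genImage i :=
    c.coxeter.toCoxeterSystem.lift_apply_simple hx.isLiftable i
  rw [repMat, lift_simple, equivSO_genImage]

theorem repMat_rep {t : VecTerm m} (ht : t ∈ c.terms) :
    repMat hx.rep (c.gen t) = halfTurn (t.eval x) := by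
  obtain ⟨i, rfl⟩ := c.exists_term_eq ht
  rw [gen_term, repMat_rep_simple]

theorem isNormalized : c.IsNormalized hx.rep := by
  refine ⟨?_, fun k => hx.repMat_rep (c.axis_mem k), fun k => hx.repMat_rep (c.diag_mem k)⟩
  rw [c.hasLabels.pointOf_elementaryIdem_eq_one_iff]
  rintro γ (⟨i, rfl⟩ | ⟨i, j, hij, h0, rfl⟩)
  · rw [repMat_rep_simple]
    exact (hx.isHalfTurn_term i).trace
  · rw [repMat_pow, repMat_mul, repMat_rep_simple, repMat_rep_simple]
    exact (hx.isHalfTurn_term_mul_pow_half hij h0).trace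

theorem map_rep {S : Type*} [CommRing S] [Algebra ℚ S] (f : R →ₐ[ℚ] S) :
    (PO3.map (f : R →+* S)).comp hx.rep = (hx.map (f : R →+* S)).rep := by
  refine rep_ext fun t ht => ?_
  have map_repMat : repMat ((PO3.map (f : R →+* S)).comp hx.rep) (c.gen t)
      = (repMat hx.rep (c.gen t)).map (f : R →+* S) := PO3.equivSO_map _ _
  rw [map_repMat, repMat_rep _ ht, repMat_rep _ ht, map_halfTurn _ (hx.isUnit t ht),
    VecTerm.map_eval]

omit hx in
theorem rep_congr {y : Fin m → R} (hx : c.IsSolution x) (hy : c.IsSolution y) (h : x = y) :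
    hx.rep = hy.rep := by
  subst h
  rfl

end IsSolution

variable (c) in
/-- The function on the representation scheme that is invertible exactly when the generator of an
expression `(1, xᵢ, 0)` or `a × b` acts by the half-turn about a nondegenerate vector of that
form. -/
def factor : VecTerm m → RepRing c.coxeter.Group
  | .var i => 1 + univMatrix _ (c.gen (.var i)) 0 0
  | .cross a b => 3 - (univMatrix _ (c.gen a * c.gen b)).trace
  | _ => 1

variable (c) in
/-- The function cutting out the open subscheme of the slice that consists of the representations
attached to solutions. -/
def generic : RepRing c.coxeter.Group := ∏ t ∈ c.terms, c.factor t

theorem isUnit_pointOf_generic_iff {ρ : c.coxeter.Group →* PO3 R} :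
    IsUnit (pointOf ρ c.generic) ↔ ∀ t ∈ c.terms, IsUnit (pointOf ρ (c.factor t)) := by
  rw [generic, map_prod, IsUnit.prod_iff]

theorem pointOf_factor_var (ρ : c.coxeter.Group →* PO3 R) (i : Fin m) :
    pointOf ρ (c.factor (.var i)) = 1 + repMat ρ (c.gen (.var i)) 0 0 := by
  rw [factor, map_add, map_one]
  exact congrArg (1 + ·) (congrFun₂ (univMatrix_map_pointOf ρ (c.gen (.var i))) 0 0)

theorem pointOf_factor_cross (ρ : c.coxeter.Group →* PO3 R) (a b : VecTerm m) :
    pointOf ρ (c.factor (.cross a b))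
      = 3 - (repMat ρ (c.gen a) * repMat ρ (c.gen b)).trace := by
  rw [factor, map_sub, map_ofNat, pointOf_trace, repMat_mul]

/-- The solution read off from a generic normalized representation. -/
def coords (ρ : c.coxeter.Group →* PO3 R) (i : Fin m) : R :=
  Ring.inverse (1 + repMat ρ (c.gen (.var i)) 0 0) * repMat ρ (c.gen (.var i)) 0 1

namespace IsSolution

variable {x : Fin m → R}

theorem isUnit_generic (hx : c.IsSolution x) : IsUnit (pointOf hx.rep c.generic) := by
  rw [isUnit_pointOf_generic_iff]
  intro t ht
  cases t with
  | axis k => exact (map_one (pointOf hx.rep)).symm ▸ isUnit_one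
  | diag k => exact (map_one (pointOf hx.rep)).symm ▸ isUnit_one
  | var i =>
    rw [pointOf_factor_var, hx.repMat_rep ht, VecTerm.eval, one_add_halfTurn_zero_zero]
    exact (isUnit_ofNat R 2).mul (hx.isUnit _ ht).ringInverse
  | cross a b =>
    have ha := c.left_mem a b ht
    have hb := c.right_mem a b ht
    rw [pointOf_factor_cross, hx.repMat_rep ha, hx.repMat_rep hb,
      isUnit_three_sub_trace_iff (hx.isUnit _ ha) (hx.isUnit _ hb)]
    exact hx.isUnit _ ht

theorem coords_rep (hx : c.IsSolution x) : coords hx.rep = x := by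
  funext i
  have hunit : IsUnit (2 * Ring.inverse (![1, x i, 0] ⬝ᵥ ![1, x i, 0])) :=
    (isUnit_ofNat R 2).mul (hx.isUnit _ (c.var_mem i)).ringInverse
  rw [coords, hx.repMat_rep (c.var_mem i), VecTerm.eval, one_add_halfTurn_zero_zero,
    halfTurn_zero_one, ← mul_assoc, Ring.inverse_mul_cancel _ hunit, one_mul]

theorem eq_of_rep_eq {y : Fin m → R} (hx : c.IsSolution x) (hy : c.IsSolution y)
    (h : hx.rep = hy.rep) : x = y := by
  rw [← hx.coords_rep, h, hy.coords_rep]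

end IsSolution

namespace IsNormalized

variable {ρ : c.coxeter.Group →* PO3 R}

theorem repMat_var (hρ : c.IsNormalized ρ) (i : Fin m)
    (hunit : IsUnit (1 + repMat ρ (c.gen (.var i)) 0 0)) :
    IsUnit ((![1, coords ρ i, 0] : Fin 3 → R) ⬝ᵥ ![1, coords ρ i, 0]) ∧
      repMat ρ (c.gen (.var i)) = halfTurn ![1, coords ρ i, 0] := by
  obtain ⟨P, hP, hPe⟩ := exists_lineProj hρ.idem (c.var_mem i)
  have horizontal : P *ᵥ axisVec 2 = 0 := mulVec_eq_zero_of_mul_lineProj (isUnit_axisVec 2)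
    (mul_eq_zero hρ.idem (c.var_mem i) (c.axis_mem 2) (.var i) hP
      (isLineProj_lineProj (isUnit_axisVec 2)) hPe (hρ.axis 2))
  have entry_zero : 1 + repMat ρ (c.gen (.var i)) 0 0 = 2 * P 0 0 := by
    rw [hPe, two_mul P, Matrix.sub_apply, Matrix.add_apply, one_apply_eq]
    ring
  have entry_one : repMat ρ (c.gen (.var i)) 0 1 = 2 * P 0 1 := by
    rw [hPe, two_mul P, Matrix.sub_apply, Matrix.add_apply, one_apply_ne zero_ne_one]
    ring
  rw [entry_zero] at hunit
  have isUnit_zero : IsUnit (P 0 0) := isUnit_of_mul_isUnit_right hunit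
  have coords_eq : coords ρ i = Ring.inverse (P 0 0) * P 0 1 := by
    rw [coords, entry_zero, entry_one]
    refine hunit.mul_left_cancel ?_
    linear_combination 2 * P 0 1 * Ring.mul_inverse_cancel _ hunit
      - 2 * P 0 1 * Ring.mul_inverse_cancel _ isUnit_zero
  obtain ⟨isUnit_dot, P_eq⟩ := hP.eq_lineProj_horizontal horizontal isUnit_zero
  rw [hPe, halfTurn, coords_eq]
  exact ⟨isUnit_dot, by rw [← P_eq]⟩

theorem repMat_cross (hρ : c.IsNormalized ρ) {a b : VecTerm m} (ht : .cross a b ∈ c.terms)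
    {v w : Fin 3 → R} (hv : IsUnit (v ⬝ᵥ v)) (hw : IsUnit (w ⬝ᵥ w))
    (ha : repMat ρ (c.gen a) = halfTurn v) (hb : repMat ρ (c.gen b) = halfTurn w)
    (hvw : IsUnit (crossProduct v w ⬝ᵥ crossProduct v w)) :
    repMat ρ (c.gen (.cross a b)) = halfTurn (crossProduct v w) := by
  obtain ⟨P, hP, hPe⟩ := exists_lineProj hρ.idem ht
  have orth_left : P *ᵥ v = 0 := mulVec_eq_zero_of_mul_lineProj hv
    (mul_eq_zero hρ.idem ht (c.left_mem a b ht) (.left a b) hP (isLineProj_lineProj hv) hPe ha)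
  have orth_right : P *ᵥ w = 0 := mulVec_eq_zero_of_mul_lineProj hw
    (mul_eq_zero hρ.idem ht (c.right_mem a b ht) (.right a b) hP (isLineProj_lineProj hw) hPe hb)
  rw [hPe, halfTurn, ← hP.eq_lineProj_cross orth_left orth_right hvw]

theorem repMat_eq (hρ : c.IsNormalized ρ) (hg : IsUnit (pointOf ρ c.generic)) {t : VecTerm m}
    (ht : t ∈ c.terms) : IsUnit (t.eval (coords ρ) ⬝ᵥ t.eval (coords ρ)) ∧
      repMat ρ (c.gen t) = halfTurn (t.eval (coords ρ)) := by
  have isUnit_factor := isUnit_pointOf_generic_iff.1 hg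
  induction t with
  | axis k => exact ⟨isUnit_axisVec k, hρ.axis k⟩
  | diag k => exact ⟨isUnit_diagVec k, hρ.diag k⟩
  | var i => exact hρ.repMat_var i (pointOf_factor_var ρ i ▸ isUnit_factor _ ht)
  | cross a b iha ihb =>
    obtain ⟨ua, ea⟩ := iha (c.left_mem a b ht)
    obtain ⟨ub, eb⟩ := ihb (c.right_mem a b ht)
    have isUnit_cross := isUnit_factor _ ht
    rw [pointOf_factor_cross, ea, eb, isUnit_three_sub_trace_iff ua ub] at isUnit_cross
    exact ⟨isUnit_cross, hρ.repMat_cross ht ua ub ea eb isUnit_cross⟩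

theorem isSolution (hρ : c.IsNormalized ρ) (hg : IsUnit (pointOf ρ c.generic)) :
    c.IsSolution (coords ρ) where
  isUnit t ht := (hρ.repMat_eq hg ht).1
  rel t ht := by
    obtain ⟨a, b, rfl⟩ := c.rels_cross t ht
    have hmem := c.rels_subset _ ht
    obtain ⟨hunit, heq⟩ := hρ.repMat_eq hg hmem
    have mulVec_axis := mulVec_eq_zero_of_mul_lineProj (isUnit_axisVec 1)
      (mul_eq_zero hρ.idem hmem (c.axis_mem 1) (.rel a b ht) (isLineProj_lineProj hunit)
        (isLineProj_lineProj (isUnit_axisVec 1)) heq (hρ.axis 1))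
    simpa only [axisVec, dotProduct_single_one] using
      dotProduct_eq_zero_of_lineProj_mulVec hunit mulVec_axis

theorem eq_rep (hρ : c.IsNormalized ρ) (hg : IsUnit (pointOf ρ c.generic)) :
    ρ = (hρ.isSolution hg).rep :=
  rep_ext fun t ht => by rw [(hρ.repMat_eq hg ht).2, IsSolution.repMat_rep _ ht]

end IsNormalized

end Config

end Realization

section OpenImmersion

open Matrix

theorem isLocalizationAway_of_algHom {A D : Type*} [CommRing A] [CommRing D] [Algebra A D] {f : A}
    (hf : IsUnit (algebraMap A D f)) (ψ : D →ₐ[A] Localization.Away f)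
    (hD : ∀ α : D →ₐ[A] D, α = AlgHom.id A D) : IsLocalization.Away f D := by
  have := IsLocalization.algHom_subsingleton (Submonoid.powers f) (S := Localization.Away f)
    (P := Localization.Away f)
  let φ : Localization.Away f →ₐ[A] D := IsLocalization.Away.liftAlgHom f (f := Algebra.ofId A D) hf
  exact IsLocalization.isLocalization_of_algEquiv (Submonoid.powers f)
    (AlgEquiv.ofAlgHom φ ψ (hD _) (Subsingleton.elim _ _))

namespace Config

variable {m : ℕ} {c : Config m}

variable (c) in
/-- The function whose nonvanishing makes all the vectors of the configuration nondegenerate. -/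
def nondegenerate {R : Type*} [CommRing R] (x : Fin m → R) : R :=
  ∏ t ∈ c.terms, t.eval x ⬝ᵥ t.eval x

theorem map_nondegenerate {R S : Type*} [CommRing R] [CommRing S] (f : R →+* S) (x : Fin m → R) :
    f (c.nondegenerate x) = c.nondegenerate (f ∘ x) := by
  simp only [nondegenerate, map_prod, VecTerm.map_eval_dot_self]

theorem isSolution_iff {R : Type*} [CommRing R] {x : Fin m → R} :
    c.IsSolution x ↔ IsUnit (c.nondegenerate x) ∧ ∀ t ∈ c.rels, t.eval x 1 = 0 := by
  rw [nondegenerate, IsUnit.prod_iff]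
  exact ⟨fun h => ⟨h.isUnit, h.rel⟩, fun h => ⟨h.1, h.2⟩⟩

section Presents

variable {B : Type} [CommRing B] [Algebra ℚ B]

variable (c) in
/-- The tuple `x` is the universal solution of the relations of the configuration: it presents `B`
as the coordinate ring of their zero locus in affine space. -/
structure Presents (x : Fin m → B) : Prop where
  rel : ∀ t ∈ c.rels, t.eval x 1 = 0
  ext : ∀ {R : Type} [CommRing R] [Algebra ℚ R] {φ ψ : B →ₐ[ℚ] R}, φ ∘ x = ψ ∘ x → φ = ψ
  exists_lift : ∀ {R : Type} [CommRing R] [Algebra ℚ R] {y : Fin m → R},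
    (∀ t ∈ c.rels, t.eval y 1 = 0) → ∃ φ : B →ₐ[ℚ] R, φ ∘ x = y

variable (c) in
/-- The tuple `x` is the universal nondegenerate solution of the relations of the configuration. -/
structure IsUniversalSolution (x : Fin m → B) : Prop where
  isSolution : c.IsSolution x
  ext : ∀ {R : Type} [CommRing R] [Algebra ℚ R] {φ ψ : B →ₐ[ℚ] R}, φ ∘ x = ψ ∘ x → φ = ψ
  exists_lift : ∀ {R : Type} [CommRing R] [Algebra ℚ R] {y : Fin m → R},
    c.IsSolution y → ∃ φ : B →ₐ[ℚ] R, φ ∘ x = y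

variable {x : Fin m → B}

theorem Presents.isUniversalSolution (hx : c.Presents x) : c.IsUniversalSolution
    (algebraMap B (Localization.Away (c.nondegenerate x)) ∘ x) where
  isSolution := by
    refine isSolution_iff.2 ⟨?_, fun t ht => ?_⟩
    · rw [← map_nondegenerate]
      exact IsLocalization.Away.algebraMap_isUnit _
    · rw [← VecTerm.map_eval, Function.comp_apply, hx.rel t ht, map_zero]
  ext h := IsLocalization.algHom_ext (Submonoid.powers (c.nondegenerate x)) (hx.ext h)
  exists_lift hy := by
    obtain ⟨φ, rfl⟩ := hx.exists_lift hy.rel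
    have hunit : IsUnit (φ (c.nondegenerate x)) :=
      (map_nondegenerate φ.toRingHom x).symm ▸ (isSolution_iff.1 hy).1
    refine ⟨IsLocalization.Away.liftAlgHom (c.nondegenerate x) hunit, funext fun i => ?_⟩
    exact IsLocalization.Away.lift_eq _ hunit (x i)

end Presents

/-- The point of the slice given by a solution. -/
def IsSolution.sliceHom {R : Type*} [CommRing R] [Algebra ℚ R] {x : Fin m → R}
    (hx : c.IsSolution x) : RepRing c.coxeter.Group ⧸ c.sliceIdeal →ₐ[ℚ] R :=
  Ideal.Quotient.liftₐ c.sliceIdeal (pointOf hx.rep) ((c.isNormalized_iff _).1 hx.isNormalized)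

theorem IsSolution.sliceHom_comp_mkₐ {R : Type*} [CommRing R] [Algebra ℚ R] {x : Fin m → R}
    (hx : c.IsSolution x) :
    hx.sliceHom.comp (Ideal.Quotient.mkₐ ℚ c.sliceIdeal) = pointOf hx.rep :=
  Ideal.Quotient.liftₐ_comp _ _ _

namespace IsUniversalSolution

variable {D R : Type} [CommRing D] [Algebra ℚ D] [CommRing R] [Algebra ℚ R] {z : Fin m → D}

theorem exists_comp_pointOf_eq (hz : c.IsUniversalSolution z) {ρ : c.coxeter.Group →* PO3 R}
    (hρ : c.IsNormalized ρ) (hg : IsUnit (pointOf ρ c.generic)) :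
    ∃ ψ : D →ₐ[ℚ] R, ψ.comp (pointOf hz.isSolution.rep) = pointOf ρ := by
  obtain ⟨ψ, hψ⟩ := hz.exists_lift (hρ.isSolution hg)
  refine ⟨ψ, ?_⟩
  rw [← pointOf_map, hz.isSolution.map_rep, hρ.eq_rep hg]
  exact congrArg pointOf (IsSolution.rep_congr _ _ hψ)

theorem eq_of_comp_pointOf_eq (hz : c.IsUniversalSolution z) {φ ψ : D →ₐ[ℚ] R}
    (h : φ.comp (pointOf hz.isSolution.rep) = ψ.comp (pointOf hz.isSolution.rep)) : φ = ψ := by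
  rw [← pointOf_map, ← pointOf_map, hz.isSolution.map_rep, hz.isSolution.map_rep] at h
  exact hz.ext ((hz.isSolution.map _).eq_of_rep_eq (hz.isSolution.map _) (points.symm.injective h))

/-- The nonvanishing locus of `Config.generic` in the slice represents the functor of
solutions. -/
theorem isOpenImmersion (hz : c.IsUniversalSolution z) :
    IsOpenImmersion (slicePoint hz.isSolution.sliceHom) := by
  obtain ⟨Φ, hΦ⟩ : ∃ Φ, Φ = hz.isSolution.sliceHom := ⟨_, rfl⟩
  have hΦ_comp : Φ.comp (Ideal.Quotient.mkₐ ℚ c.sliceIdeal) = pointOf hz.isSolution.rep :=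
    hΦ ▸ hz.isSolution.sliceHom_comp_mkₐ
  rw [← hΦ]
  let F : RepRing c.coxeter.Group ⧸ c.sliceIdeal := Ideal.Quotient.mkₐ ℚ c.sliceIdeal c.generic
  have hF : IsUnit (Φ F) := DFunLike.congr_fun hΦ_comp c.generic ▸ hz.isSolution.isUnit_generic
  let loc := IsScalarTower.toAlgHom ℚ (RepRing c.coxeter.Group ⧸ c.sliceIdeal) (Localization.Away F)
  let κ := loc.comp (Ideal.Quotient.mkₐ ℚ c.sliceIdeal)
  have normalized : c.IsNormalized (repOf κ) := by
    rw [c.isNormalized_iff, repOf_comp]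
    exact (onZeroLocus_repOf_mkₐ c.sliceIdeal).map loc
  have generic : IsUnit (pointOf (repOf κ) c.generic) := by
    rw [pointOf_repOf]
    exact IsLocalization.Away.algebraMap_isUnit F
  obtain ⟨ψ, hψ⟩ := hz.exists_comp_pointOf_eq normalized generic
  rw [pointOf_repOf, ← hΦ_comp, ← AlgHom.comp_assoc] at hψ
  have hψ_comp : ψ.comp Φ = loc := Ideal.Quotient.algHom_ext ℚ hψ
  let := Φ.toRingHom.toAlgebra
  have : IsLocalization.Away F D := by
    refine isLocalizationAway_of_algHom hF ⟨ψ.toRingHom, DFunLike.congr_fun hψ_comp⟩ fun α => ?_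
    have hα : α.toRingHom.toRatAlgHom = AlgHom.id ℚ D := by
      refine hz.eq_of_comp_pointOf_eq ?_
      rw [← hΦ_comp, ← AlgHom.comp_assoc, ← AlgHom.comp_assoc]
      exact congrArg (AlgHom.comp · _) (AlgHom.ext α.commutes)
    have hα_apply := DFunLike.congr_fun hα
    exact AlgHom.ext hα_apply
  exact IsOpenImmersion.of_isLocalization F

end IsUniversalSolution

end Config

end OpenImmersion

section Arithmetic

open Matrix MvPolynomial

variable {m : ℕ}

namespace VecTerm

open Classical in
/-- The set of subexpressions of an expression, including the expression itself. -/
def subterms : VecTerm m → Finset (VecTerm m)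
  | cross a b => insert (cross a b) (subterms a ∪ subterms b)
  | t => {t}

theorem self_mem_subterms (t : VecTerm m) : t ∈ subterms t := by
  cases t <;> simp [subterms]

theorem left_mem_subterms {a b t : VecTerm m} (h : cross a b ∈ subterms t) : a ∈ subterms t := by
  induction t with
  | cross c d ihc ihd =>
    simp only [subterms, Finset.mem_insert, Finset.mem_union, cross.injEq] at h ⊢
    rcases h with ⟨rfl, rfl⟩ | h | h
    · exact Or.inr (Or.inl (self_mem_subterms _))
    · exact Or.inr (Or.inl (ihc h))
    · exact Or.inr (Or.inr (ihd h))
  | _ => simp [subterms] at h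

theorem right_mem_subterms {a b t : VecTerm m} (h : cross a b ∈ subterms t) : b ∈ subterms t := by
  induction t with
  | cross c d ihc ihd =>
    simp only [subterms, Finset.mem_insert, Finset.mem_union, cross.injEq] at h ⊢
    rcases h with ⟨rfl, rfl⟩ | h | h
    · exact Or.inr (Or.inr (self_mem_subterms _))
    · exact Or.inr (Or.inl (ihc h))
    · exact Or.inr (Or.inr (ihd h))
  | _ => simp [subterms] at h

/-- The expression `t` has the given polynomials as coordinates, and none of its subexpressions
vanishes at a rational point. -/
structure IsVec (t : VecTerm m) (a b c : MvPolynomial (Fin m) ℚ) : Prop where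
  ne_zero : ∀ s ∈ subterms t, ∀ x : Fin m → ℚ, eval x s ≠ 0
  eval_eq : ∀ {R : Type} [CommRing R] [Algebra ℚ R] (x : Fin m → R),
    eval x t = ![aeval x a, aeval x b, aeval x c]

theorem eval_axis_ne_zero (x : Fin m → ℚ) (k : Fin 3) : eval x (.axis k) ≠ 0 := fun h => by
  simpa [eval, axisVec] using congrFun h k

theorem eval_diag_ne_zero (x : Fin m → ℚ) (k : Fin 2) : eval x (.diag k) ≠ 0 := fun h =>
  (isUnit_diagVec (R := ℚ) k).ne_zero (dotProduct_self_eq_zero.2 h)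

theorem eval_var_ne_zero (x : Fin m → ℚ) (i : Fin m) : eval x (.var i) ≠ 0 := fun h =>
  one_ne_zero (congrFun h 0)

theorem isVec_axis_zero : IsVec (.axis 0 : VecTerm m) 1 0 0 where
  ne_zero s hs x := Finset.mem_singleton.1 hs ▸ eval_axis_ne_zero x 0
  eval_eq x := by ext i; fin_cases i <;> simp [eval, axisVec]

theorem isVec_axis_one : IsVec (.axis 1 : VecTerm m) 0 1 0 where
  ne_zero s hs x := Finset.mem_singleton.1 hs ▸ eval_axis_ne_zero x 1
  eval_eq x := by ext i; fin_cases i <;> simp [eval, axisVec]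

theorem isVec_axis_two : IsVec (.axis 2 : VecTerm m) 0 0 1 where
  ne_zero s hs x := Finset.mem_singleton.1 hs ▸ eval_axis_ne_zero x 2
  eval_eq x := by ext i; fin_cases i <;> simp [eval, axisVec]

theorem isVec_diag_zero : IsVec (.diag 0 : VecTerm m) 1 1 0 where
  ne_zero s hs x := Finset.mem_singleton.1 hs ▸ eval_diag_ne_zero x 0
  eval_eq x := by ext i; fin_cases i <;> simp [eval, diagVec, axisVec]

theorem isVec_diag_one : IsVec (.diag 1 : VecTerm m) 0 1 1 where
  ne_zero s hs x := Finset.mem_singleton.1 hs ▸ eval_diag_ne_zero x 1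
  eval_eq x := by ext i; fin_cases i <;> simp [eval, diagVec, axisVec]

theorem isVec_var (i : Fin m) : IsVec (.var i) 1 (X i) 0 where
  ne_zero s hs x := Finset.mem_singleton.1 hs ▸ eval_var_ne_zero x i
  eval_eq x := by ext j; fin_cases j <;> simp [eval]

namespace IsVec

variable {s t : VecTerm m} {p q : MvPolynomial (Fin m) ℚ}

theorem cross {a b c a' b' c' u v w : MvPolynomial (Fin m) ℚ} (hs : IsVec s a b c)
    (ht : IsVec t a' b' c') (hu : u = b * c' - c * b' := by ring)
    (hv : v = c * a' - a * c' := by ring) (hw : w = a * b' - b * a' := by ring)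
    (hunit : IsUnit u ∨ IsUnit v ∨ IsUnit w := by simp) : IsVec (.cross s t) u v w := by
  have eval_eq {R : Type} [CommRing R] [Algebra ℚ R] (x : Fin m → R) :
      eval x (.cross s t) = ![aeval x u, aeval x v, aeval x w] := by
    rw [eval, hs.eval_eq, ht.eval_eq, hu, hv, hw, cross_apply]
    simp
  refine ⟨fun r hr x => ?_, eval_eq⟩
  simp only [subterms, Finset.mem_insert, Finset.mem_union] at hr
  rcases hr with rfl | hr | hr
  · rw [eval_eq]
    intro h
    rcases hunit with hunit | hunit | hunit
    · exact (hunit.map (aeval x)).ne_zero (congrFun h 0)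
    · exact (hunit.map (aeval x)).ne_zero (congrFun h 1)
    · exact (hunit.map (aeval x)).ne_zero (congrFun h 2)
  · exact hs.ne_zero r hr x
  · exact ht.ne_zero r hr x

theorem exists_vertical (hs : IsVec s 1 p 0) : ∃ t, IsVec t 1 0 p := by
  have normal : IsVec (.cross (.axis 0) (.diag 1) : VecTerm m) 0 (-1) 1 :=
    isVec_axis_zero.cross isVec_diag_one
  have plane : IsVec (.cross s (.cross (.axis 0) (.diag 1))) p (-1) (-1) := hs.cross normal
  exact ⟨_, plane.cross isVec_axis_one⟩

theorem antidiag : IsVec (.cross (.diag 0) (.axis 2) : VecTerm m) 1 (-1) 0 :=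
  isVec_diag_zero.cross isVec_axis_two

theorem exists_add (hs : IsVec s 1 p 0) (ht : IsVec t 1 q 0) :
    ∃ a b, IsVec (.cross a b) 1 (p + q) 0 := by
  obtain ⟨_, ht'⟩ := ht.exists_vertical
  -- The sum is read off by projecting `(1, p, q)` to the plane `z = 0` along `(0, 1, -1)`.
  have point := (ht'.cross isVec_axis_one (u := -q) (v := 0) (w := 1)).cross
    (hs.cross isVec_axis_two (u := p) (v := -1) (w := 0)) (u := 1) (v := p) (w := q)
  have normal : IsVec (.cross (.diag 1) (.axis 0) : VecTerm m) 0 1 (-1) :=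
    isVec_diag_one.cross isVec_axis_zero
  have plane := point.cross normal (u := -p - q) (v := 1) (w := 1)
  exact ⟨_, _, plane.cross isVec_axis_two⟩

theorem exists_mul (hs : IsVec s 1 p 0) (ht : IsVec t 1 q 0) :
    ∃ a b, IsVec (.cross a b) 1 (p * q) 0 := by
  obtain ⟨_, ht'⟩ := ht.exists_vertical
  have slope := isVec_axis_zero.cross (ht'.cross antidiag (u := q) (v := q) (w := -1))
    (u := 0) (v := 1) (w := q)
  -- The plane spanned by `(1, p, 0)` and `(0, 1, q)` meets the plane `y = 0` in `(1, 0, -p q)`.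
  have plane := hs.cross slope (u := p * q) (v := -q) (w := 1)
  have vertical := isVec_axis_one.cross plane (u := 1) (v := 0) (w := -(p * q))
  have horizontal := vertical.cross isVec_diag_one (u := p * q) (v := -1) (w := 1)
  exact ⟨_, _, isVec_axis_two.cross horizontal⟩

end IsVec

variable (m) in
/-- The polynomials `p` that are encoded by some expression, as the vector `(1, p, 0)`. -/
def representable : Subring (MvPolynomial (Fin m) ℚ) where
  carrier := {p | ∃ t : VecTerm m, IsVec t 1 p 0}
  zero_mem' := ⟨_, isVec_axis_zero⟩
  one_mem' := ⟨_, isVec_diag_zero⟩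
  add_mem' := by
    rintro p q ⟨s, hs⟩ ⟨t, ht⟩
    obtain ⟨a, b, h⟩ := hs.exists_add ht
    exact ⟨_, h⟩
  mul_mem' := by
    rintro p q ⟨s, hs⟩ ⟨t, ht⟩
    obtain ⟨a, b, h⟩ := hs.exists_mul ht
    exact ⟨_, h⟩
  neg_mem' := by
    rintro p ⟨s, hs⟩
    obtain ⟨a, b, h⟩ := hs.exists_mul .antidiag
    exact ⟨_, by rwa [mul_neg_one] at h⟩

theorem exists_cross_of_mem {p : MvPolynomial (Fin m) ℚ} (hp : p ∈ representable m) :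
    ∃ a b, IsVec (.cross a b) 1 p 0 := by
  obtain ⟨t, ht⟩ := hp
  simpa only [add_zero] using ht.exists_add isVec_axis_zero

theorem exists_nsmul_mem (p : MvPolynomial (Fin m) ℚ) :
    ∃ N : ℕ, N ≠ 0 ∧ N • p ∈ representable m := by
  induction p using MvPolynomial.induction_on with
  | C a =>
    refine ⟨a.den, a.den_nz, ?_⟩
    have h : a.den • (C a : MvPolynomial (Fin m) ℚ) = ((a.num : ℤ) : MvPolynomial (Fin m) ℚ) := by
      rw [← map_nsmul, nsmul_eq_mul, mul_comm, Rat.mul_den_eq_num, map_intCast]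
    rw [h]
    exact intCast_mem _ _
  | add p q hp hq =>
    obtain ⟨N, hN, h⟩ := hp
    obtain ⟨K, hK, h'⟩ := hq
    refine ⟨N * K, mul_ne_zero hN hK, ?_⟩
    rw [smul_add]
    refine add_mem ?_ ?_
    · rw [mul_comm, mul_smul]; exact nsmul_mem h K
    · rw [mul_smul]; exact nsmul_mem h' N
  | mul_X p i hp =>
    obtain ⟨N, hN, h⟩ := hp
    refine ⟨N, hN, ?_⟩
    rw [← smul_mul_assoc]
    exact mul_mem h ⟨_, isVec_var i⟩

end VecTerm

namespace Config

open Classical in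
/-- The configuration generated by finitely many expressions, with relations among them. -/
def ofTerms (L : Finset (VecTerm m)) (Rl : Set (VecTerm m)) (hRl : Rl ⊆ L)
    (hcross : ∀ t ∈ Rl, ∃ a b, t = .cross a b) : Config m where
  terms := Finset.univ.image .axis ∪ Finset.univ.image .diag ∪ Finset.univ.image .var ∪
    L.biUnion VecTerm.subterms
  rels := Rl
  axis_mem k := by simp
  diag_mem k := by simp
  var_mem i := by simp
  left_mem a b h := by
    have h' : ∃ t ∈ L, .cross a b ∈ VecTerm.subterms t := by simpa using h
    obtain ⟨t, ht, h'⟩ := h'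
    exact Finset.mem_union_right _ (Finset.mem_biUnion.2 ⟨t, ht, VecTerm.left_mem_subterms h'⟩)
  right_mem a b h := by
    have h' : ∃ t ∈ L, .cross a b ∈ VecTerm.subterms t := by simpa using h
    obtain ⟨t, ht, h'⟩ := h'
    exact Finset.mem_union_right _ (Finset.mem_biUnion.2 ⟨t, ht, VecTerm.right_mem_subterms h'⟩)
  rels_subset t ht := Finset.mem_union_right _
    (Finset.mem_biUnion.2 ⟨t, hRl ht, VecTerm.self_mem_subterms t⟩)
  rels_cross := hcross

variable {L : Finset (VecTerm m)} {Rl : Set (VecTerm m)} {hRl : Rl ⊆ L}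
  {hcross : ∀ t ∈ Rl, ∃ a b, t = .cross a b} {t : VecTerm m}

open Classical in
theorem mem_ofTerms (ht : t ∈ L) : t ∈ (ofTerms L Rl hRl hcross).terms :=
  Finset.mem_union_right _ (Finset.mem_biUnion.2 ⟨t, ht, VecTerm.self_mem_subterms t⟩)

theorem eval_ne_zero_of_mem_ofTerms
    (hL : ∀ s ∈ L, ∀ r ∈ VecTerm.subterms s, ∀ x : Fin m → ℚ, r.eval x ≠ 0)
    (ht : t ∈ (ofTerms L Rl hRl hcross).terms) (x : Fin m → ℚ) : t.eval x ≠ 0 := by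
  cases t with
  | axis k => exact VecTerm.eval_axis_ne_zero x k
  | diag k => exact VecTerm.eval_diag_ne_zero x k
  | var i => exact VecTerm.eval_var_ne_zero x i
  | cross a b =>
    have h : ∃ s ∈ L, .cross a b ∈ VecTerm.subterms s := by simpa [ofTerms] using ht
    obtain ⟨s, hs, h⟩ := h
    exact hL s hs _ h x

end Config

theorem exists_config_of_finset (S : Finset (MvPolynomial (Fin m) ℚ)) :
    ∃ c : Config m, (∀ t ∈ c.terms, ∀ x : Fin m → ℚ, t.eval x ≠ 0) ∧
      (∀ {R : Type} [CommRing R] [Algebra ℚ R] (y : Fin m → R),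
        (∀ t ∈ c.rels, t.eval y 1 = 0) ↔ ∀ p ∈ S, aeval y p = 0) ∧
      ∃ t ∈ c.terms, ∀ {R : Type} [CommRing R] [Algebra ℚ R] (y : Fin m → R),
        t.eval y = ![1, 2, 0] := by
  classical
  choose N hN hmem using VecTerm.exists_nsmul_mem (m := m)
  choose a b hab using fun p => VecTerm.exists_cross_of_mem (hmem p)
  obtain ⟨two, htwo⟩ : 2 ∈ VecTerm.representable m := ofNat_mem _ 2
  let Rl : Finset (VecTerm m) := S.image fun p => .cross (a p) (b p)
  refine ⟨.ofTerms (insert two Rl) Rl (by simp) (by grind), fun t ht =>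
    Config.eval_ne_zero_of_mem_ofTerms (fun s hs => ?_) ht, fun {R} _ _ y => ?_, two,
    Config.mem_ofTerms (Finset.mem_insert_self _ _), fun y => ?_⟩
  · rcases Finset.mem_insert.1 hs with rfl | hs
    · exact htwo.ne_zero
    · obtain ⟨p, -, rfl⟩ := Finset.mem_image.1 hs
      exact (hab p).ne_zero
  · have eval_eq_zero_iff (p) : VecTerm.eval y (.cross (a p) (b p)) 1 = 0 ↔ aeval y p = 0 := by
      rw [(hab p).eval_eq, cons_val_one, cons_val_zero, map_nsmul, ← Nat.cast_smul_eq_nsmul ℚ,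
        smul_eq_zero_iff_right (Nat.cast_ne_zero.2 (hN p))]
    simp only [Config.ofTerms, Rl, Finset.mem_coe, Finset.forall_mem_image, eval_eq_zero_iff]
  · rw [htwo.eval_eq, map_one, map_ofNat, map_zero]

theorem Config.presents_of_surjective {c : Config m} {B : Type} [CommRing B] [Algebra ℚ B]
    {π : MvPolynomial (Fin m) ℚ →ₐ[ℚ] B} (hπ : Function.Surjective π)
    (h : ∀ {R : Type} [CommRing R] [Algebra ℚ R] (y : Fin m → R),
      (∀ t ∈ c.rels, t.eval y 1 = 0) ↔ RingHom.ker π ≤ RingHom.ker (aeval (R := ℚ) y)) :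
    c.Presents (π ∘ X) where
  rel := (h _).2 (aeval_unique π ▸ le_rfl)
  ext hφψ := (AlgHom.cancel_right hπ).1 (MvPolynomial.algHom_ext (congrFun hφψ))
  exists_lift {R _ _ y} hy := by
    let e := Ideal.quotientKerAlgEquivOfSurjective hπ
    refine ⟨(Ideal.Quotient.liftₐ (RingHom.ker π) (aeval y) ((h y).1 hy)).comp e.symm,
      funext fun i => ?_⟩
    have symm_apply : e.symm (π (X i)) = Ideal.Quotient.mk _ (X i) :=
      (AlgEquiv.symm_apply_eq _).2 rfl
    calc Ideal.Quotient.liftₐ (RingHom.ker π) (aeval y) ((h y).1 hy) (e.symm (π (X i)))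
        = aeval y (X i) := congrArg _ symm_apply
      _ = y i := aeval_X y i

theorem exists_config_presents (B : Type) [CommRing B] [Algebra ℚ B] [Algebra.FiniteType ℚ B] :
    ∃ (m : ℕ) (c : Config m) (x : Fin m → B), c.Presents x ∧
      (∀ t ∈ c.terms, ∀ x : Fin m → ℚ, t.eval x ≠ 0) ∧
      ∃ t ∈ c.terms, ∀ {R : Type} [CommRing R] [Algebra ℚ R] (y : Fin m → R),
        t.eval y = ![1, 2, 0] := by
  obtain ⟨m, π, hπ⟩ := Algebra.FiniteType.iff_quotient_mvPolynomial''.1 ‹Algebra.FiniteType ℚ B›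
  obtain ⟨S, hS⟩ := IsNoetherian.noetherian (RingHom.ker π)
  obtain ⟨c, hne, hrels, ht⟩ := exists_config_of_finset S
  refine ⟨m, c, π ∘ X, Config.presents_of_surjective hπ fun y => ?_, hne, ht⟩
  rw [hrels, ← hS, Submodule.span_le]
  rfl

end Arithmetic

section Density

open Matrix

/-- The rotations about the third axis, as a homomorphism from the angles. -/
def rotZ : Multiplicative ℝ →* specialOrthogonalGroup (Fin 3) ℝ where
  toFun α := ⟨!![Real.cos α.toAdd, -Real.sin α.toAdd, 0; Real.sin α.toAdd, Real.cos α.toAdd, 0;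
    0, 0, 1], mem_specialOrthogonalGroup_of_det (by
      ext i j
      have := Real.sin_sq_add_cos_sq α.toAdd
      fin_cases i <;> fin_cases j <;> simp [Matrix.mul_apply, Fin.sum_univ_three] <;> linarith)
    (by simp [det_fin_three, ← pow_two])⟩
  map_one' := Subtype.ext (by ext i j; fin_cases i <;> fin_cases j <;> simp)
  map_mul' α β := Subtype.ext (by
    ext i j
    fin_cases i <;> fin_cases j <;>
      simp [Real.cos_add, Real.sin_add] <;> ring)

theorem coe_rotZ (α : ℝ) : (rotZ (.ofAdd α)).1 =
    !![Real.cos α, -Real.sin α, 0; Real.sin α, Real.cos α, 0; 0, 0, 1] := rfl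

theorem rotZ_two_pi : rotZ (.ofAdd (2 * Real.pi)) = 1 :=
  Subtype.ext (by ext i j; fin_cases i <;> fin_cases j <;> simp [coe_rotZ])

theorem continuous_rotZ : Continuous fun α : ℝ => rotZ (.ofAdd α) := by
  refine Continuous.subtype_mk (continuous_matrix fun i j => ?_) _
  fin_cases i <;> fin_cases j <;> simpa [coe_rotZ] using by fun_prop

/-- The half-turn about the bisector of the second and the third axis. -/
def swapYZ : specialOrthogonalGroup (Fin 3) ℝ :=
  ⟨halfTurn (diagVec 1), (isHalfTurn_halfTurn (isUnit_diagVec 1)).mem⟩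

theorem coe_swapYZ : swapYZ.1 = !![-1, 0, 0; 0, 0, 1; 0, 1, 0] := by
  change halfTurn (diagVec 1) = _
  rw [halfTurn, two_mul, lineProj, diagVec_dot]
  ext i j
  fin_cases i <;> fin_cases j <;> simp [diagVec, axisVec, vecMulVec_apply] <;> norm_num

theorem exists_cos_sin_eq {a b : ℝ} (h : a ^ 2 + b ^ 2 = 1) :
    ∃ θ, Real.cos θ = a ∧ Real.sin θ = b := by
  have norm_eq : ‖(⟨a, b⟩ : ℂ)‖ = 1 := by
    rw [Complex.norm_def, Complex.normSq_mk, ← pow_two, ← pow_two, h, Real.sqrt_one]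
  refine ⟨Complex.arg ⟨a, b⟩, ?_, ?_⟩
  · simpa only [norm_eq, one_mul] using Complex.norm_mul_cos_arg ⟨a, b⟩
  · simpa only [norm_eq, one_mul] using Complex.norm_mul_sin_arg ⟨a, b⟩

theorem exists_eq_rotZ {A : specialOrthogonalGroup (Fin 3) ℝ}
    (h : A.1 *ᵥ axisVec 2 = axisVec 2) : ∃ γ : ℝ, A = rotZ (.ofAdd γ) := by
  obtain ⟨A, hA⟩ := A
  have h' : Aᵀ *ᵥ axisVec 2 = axisVec 2 := by
    conv_lhs => rw [← h, mulVec_mulVec, transpose_mul_of_mem hA, one_mulVec]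
  rw [axisVec, mulVec_single_one] at h h'
  have col (i) : A i 2 = (Pi.single 2 1 : Fin 3 → ℝ) i := congrFun h i
  have row (i) : A 2 i = (Pi.single 2 1 : Fin 3 → ℝ) i := congrFun h' i
  have adj (i j) : A.adjugate i j = A j i := congrFun₂ (adjugate_of_mem hA) i j
  have cos_eq : A 1 1 = A 0 0 := by simpa [adjugate_fin_three, col] using adj 0 0
  have sin_eq : A 0 1 = -A 1 0 := by
    simpa [adjugate_fin_three, col, neg_eq_iff_eq_neg] using adj 0 1
  have norm_eq : A 0 0 ^ 2 + A 1 0 ^ 2 = 1 := by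
    simpa [Matrix.mul_apply, Fin.sum_univ_three, row, ← pow_two] using
      congrFun₂ (transpose_mul_of_mem hA) 0 0
  obtain ⟨γ, hcos, hsin⟩ := exists_cos_sin_eq norm_eq
  refine ⟨γ, Subtype.ext ?_⟩
  ext i j
  fin_cases i <;> fin_cases j <;> simp [coe_rotZ, col, row, hcos, hsin, cos_eq, sin_eq]

theorem exists_rotZ_mul_mulVec {v : Fin 3 → ℝ} (hv : v ⬝ᵥ v = 1) : ∃ α β : ℝ,
    (rotZ (.ofAdd α) * (swapYZ * rotZ (.ofAdd β) * swapYZ)).1 *ᵥ axisVec 2 = v := by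
  have hr : v 2 ^ 2 + ‖(⟨v 0, v 1⟩ : ℂ)‖ ^ 2 = 1 := by
    rw [dotProduct, Fin.sum_univ_three] at hv
    rw [Complex.sq_norm, Complex.normSq_mk]
    linear_combination hv
  obtain ⟨β, hcos, hsin⟩ := exists_cos_sin_eq hr
  have h0 : ‖(⟨v 0, v 1⟩ : ℂ)‖ * _ = v 0 := Complex.norm_mul_cos_arg ⟨v 0, v 1⟩
  have h1 : ‖(⟨v 0, v 1⟩ : ℂ)‖ * _ = v 1 := Complex.norm_mul_sin_arg ⟨v 0, v 1⟩
  rw [← hsin, mul_comm] at h0 h1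
  refine ⟨Complex.arg ⟨v 0, v 1⟩, β, ?_⟩
  rw [axisVec, mulVec_single_one]
  ext i
  fin_cases i <;> simp [coe_rotZ, coe_swapYZ, hcos, h0, h1]

theorem exists_euler_angles (A : specialOrthogonalGroup (Fin 3) ℝ) : ∃ α β γ : ℝ,
    rotZ (.ofAdd α) * (swapYZ * rotZ (.ofAdd β) * swapYZ) * rotZ (.ofAdd γ) = A := by
  obtain ⟨α, β, h⟩ := exists_rotZ_mul_mulVec (v := A.1 *ᵥ axisVec 2) (by
    rw [mulVec_dotProduct_mulVec A.2, axisVec_dot, if_pos rfl])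
  obtain ⟨E, hE⟩ : ∃ E, E = rotZ (.ofAdd α) * (swapYZ * rotZ (.ofAdd β) * swapYZ) := ⟨_, rfl⟩
  obtain ⟨γ, hγ⟩ := exists_eq_rotZ (A := E⁻¹ * A) (by
    rw [Submonoid.coe_mul, ← mulVec_mulVec, ← h, ← hE, mulVec_mulVec, ← Submonoid.coe_mul,
      inv_mul_cancel, Submonoid.coe_one, one_mulVec])
  exact ⟨α, β, γ, by rw [← hE, ← hγ, mul_inv_cancel_left]⟩

theorem halfTurn_mul_eq_rotZ : halfTurn (![1, 2, 0] : Fin 3 → ℝ) * halfTurn (axisVec 0)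
    = (rotZ (.ofAdd (Real.arccos (-3 / 5)))).1 := by
  have hcos : Real.cos (Real.arccos (-3 / 5)) = -3 / 5 :=
    Real.cos_arccos (by norm_num) (by norm_num)
  have hsin : Real.sin (Real.arccos (-3 / 5)) = 4 / 5 := by
    rw [Real.sin_arccos, show (1 : ℝ) - (-3 / 5) ^ 2 = (4 / 5) ^ 2 by norm_num,
      Real.sqrt_sq (by norm_num)]
  have hdot : (![1, 2, 0] : Fin 3 → ℝ) ⬝ᵥ ![1, 2, 0] = 5 := by
    simp [dotProduct, Fin.sum_univ_three]; norm_num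
  rw [halfTurn, halfTurn, two_mul, two_mul, lineProj, lineProj, axisVec_dot, hdot, coe_rotZ, hcos,
    hsin]
  ext i j
  fin_cases i <;> fin_cases j <;>
    simp [axisVec, vecMulVec_apply, Matrix.mul_apply, Fin.sum_univ_three] <;> norm_num

theorem dense_of_arccos_mem {S : AddSubgroup ℝ} (hpi : 2 * Real.pi ∈ S)
    (harccos : Real.arccos (-3 / 5) ∈ S) : Dense (S : Set ℝ) := by
  rcases S.dense_or_cyclic with h | ⟨a, rfl⟩
  · exact h
  exfalso
  obtain ⟨k, hk⟩ := AddSubgroup.mem_closure_singleton.1 hpi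
  obtain ⟨l, hl⟩ := AddSubgroup.mem_closure_singleton.1 harccos
  rw [zsmul_eq_mul] at hk hl
  have hk0 : (k : ℝ) ≠ 0 := left_ne_zero_of_mul (hk ▸ Real.two_pi_pos.ne')
  have hcos : Real.cos (Real.arccos (-3 / 5)) = -3 / 5 :=
    Real.cos_arccos (by norm_num) (by norm_num)
  have rational_angle : Real.arccos (-3 / 5) = (2 * l / k : ℚ) * Real.pi := by
    push_cast
    rw [← hl, div_mul_eq_mul_div, eq_div_iff hk0]
    linear_combination (l : ℝ) * hk
  have := niven ⟨_, rational_angle⟩ ⟨-3 / 5, by rw [hcos]; norm_num⟩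
  rw [hcos] at this
  norm_num at this

theorem dense_of_mem {H : Subgroup (specialOrthogonalGroup (Fin 3) ℝ)} (hswap : swapYZ ∈ H)
    (hrot : rotZ (.ofAdd (Real.arccos (-3 / 5))) ∈ H) :
    Dense (H : Set (specialOrthogonalGroup (Fin 3) ℝ)) := by
  let S : AddSubgroup ℝ := Subgroup.toAddSubgroup' (H.comap rotZ)
  have mem_S {α : ℝ} : α ∈ S ↔ rotZ (.ofAdd α) ∈ H := Iff.rfl
  have hS : Dense (S : Set ℝ) :=
    dense_of_arccos_mem (mem_S.2 (rotZ_two_pi ▸ H.one_mem)) (mem_S.2 hrot)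
  let euler (p : ℝ × ℝ × ℝ) : specialOrthogonalGroup (Fin 3) ℝ :=
    rotZ (.ofAdd p.1) * (swapYZ * rotZ (.ofAdd p.2.1) * swapYZ) * rotZ (.ofAdd p.2.2)
  have continuous_euler : Continuous euler :=
    ((continuous_rotZ.comp continuous_fst).mul ((continuous_const.mul
      (continuous_rotZ.comp (continuous_fst.comp continuous_snd))).mul continuous_const)).mul
      (continuous_rotZ.comp (continuous_snd.comp continuous_snd))
  have surjective_euler : Function.Surjective euler := fun A => by
    obtain ⟨α, β, γ, h⟩ := exists_euler_angles A
    exact ⟨(α, β, γ), h⟩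
  refine (surjective_euler.denseRange.dense_image continuous_euler (hS.prod (hS.prod hS))).mono ?_
  rintro _ ⟨⟨α, β, γ⟩, ⟨hα, hβ, hγ⟩, rfl⟩
  exact H.mul_mem (H.mul_mem hα (H.mul_mem (H.mul_mem hswap hβ) hswap)) hγ

theorem continuous_equivSO_symm : Continuous (PO3.equivSO (R := ℝ)).symm := by
  have mem (A : specialOrthogonalGroup (Fin 3) ℝ) : A.1 ∈ orthogonalGroup (Fin 3) ℝ :=
    (mem_specialOrthogonalGroup_iff.1 A.2).1
  have symm_eq (A) : (PO3.equivSO (R := ℝ)).symm A = QuotientGroup.mk (⟨A.1, mem A⟩ : O3 ℝ) := by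
    rw [MulEquiv.symm_apply_eq]
    refine Subtype.ext (Eq.symm (?_ : A.1.det • A.1 = A.1))
    rw [det_of_mem A.2, one_smul]
  rw [funext symm_eq]
  exact continuous_quotient_mk'.comp (continuous_subtype_val.subtype_mk mem)

theorem denseRange_of_halfTurns {Γ : Type} [Group Γ] {ρ : Γ →* PO3 ℝ} {u v w : Γ}
    (hu : repMat ρ u = halfTurn (axisVec 0)) (hv : repMat ρ v = halfTurn (diagVec 1))
    (hw : repMat ρ w = halfTurn ![1, 2, 0]) : DenseRange ρ := by
  have dense := dense_of_mem (H := (PO3.equivSO.toMonoidHom.comp ρ).range)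
    ⟨v, Subtype.ext hv⟩ ⟨w * u, Subtype.ext (by
      rw [← halfTurn_mul_eq_rotZ, ← hw, ← hu, ← repMat_mul]; rfl)⟩
  refine (PO3.equivSO.symm.surjective.denseRange.dense_image continuous_equivSO_symm dense).mono ?_
  rintro _ ⟨_, ⟨γ, rfl⟩, rfl⟩
  exact ⟨γ, (PO3.equivSO.symm_apply_apply _).symm⟩

end Density

namespace Config

open Matrix

variable {m : ℕ} {c : Config m}

theorem isUnit_map_nondegenerate (hc : ∀ t ∈ c.terms, ∀ x : Fin m → ℚ, t.eval x ≠ 0) {B : Type*}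
    [CommRing B] (f : B →+* ℚ) (x : Fin m → B) : IsUnit (f (c.nondegenerate x)) := by
  rw [map_nondegenerate, nondegenerate, IsUnit.prod_iff]
  exact fun t ht => isUnit_iff_ne_zero.2 (dotProduct_self_eq_zero.not.2 (hc t ht _))

theorem IsSolution.denseRange_rep {x : Fin m → ℝ} (hx : c.IsSolution x) {t : VecTerm m}
    (ht : t ∈ c.terms) (heval : t.eval x = ![1, 2, 0]) : DenseRange hx.rep := by
  have hu : repMat hx.rep (c.gen (.axis 0)) = halfTurn (axisVec 0) := hx.repMat_rep (c.axis_mem 0)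
  have hv : repMat hx.rep (c.gen (.diag 1)) = halfTurn (diagVec 1) := hx.repMat_rep (c.diag_mem 1)
  have hw : repMat hx.rep (c.gen t) = halfTurn ![1, 2, 0] := by rw [hx.repMat_rep ht, heval]
  exact denseRange_of_halfTurns hu hv hw

end Config

end KM

end

theorem theorem4p1 (B : Type) [CommRing B] [Algebra ℚ B] [Algebra.FiniteType ℚ B]
    (x : B →ₐ[ℚ] ℚ) :
    ∃ (X' : (Spec (CommRingCat.of B)).Opens)
      (n : ℕ) (M : CoxeterMatrix (Fin n)) (ρc : M.Group →* KM.PO3 ℝ),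
      -- the edges of the Coxeter graph (pairs with `M i j ≠ 0`) have label 2 or 4
      (∀ i j, i ≠ j → M i j = 0 ∨ M i j = 2 ∨ M i j = 4) ∧
      KM.StandingAssumption M ∧
      DenseRange ρc ∧
      -- `X_o` is an open subscheme of the character scheme
      ∃ Xo : (KM.charScheme M.Group).Opens,
        (Xo : Set (KM.charScheme M.Group)) = KM.charOSet M ∧
        -- `X'` is isomorphic over `ℚ` to an open subscheme `S` of `X_o`, with `x ↦ [ρc]`
        (∃ (S : (KM.charScheme M.Group).Opens) (f : X'.toScheme ≅ S.toScheme)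
          (x' : Spec (CommRingCat.of ℚ) ⟶ X'.toScheme),
          S ≤ Xo ∧
          f.hom ≫ S.ι ≫ KM.charSchemeToSpec M.Group =
            X'.ι ≫ Spec.map (CommRingCat.ofHom (algebraMap ℚ B)) ∧
          x' ≫ X'.ι = Spec.map (CommRingCat.ofHom x.toRingHom) ∧
          Spec.map (CommRingCat.ofHom (algebraMap ℚ ℂ)) ≫ x' ≫ f.hom ≫ S.ι =
            KM.homPoint (KM.complexify ρc) ≫ KM.quotientMap M.Group) ∧
        -- the action on `Hom_o` has a cross-section containing `ρc`
        ∃ (Sc : Scheme.{0}) (ι : Sc ⟶ (KM.homO M).toScheme),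
          KM.IsCrossSection M Xo ι ∧
          ∃ s : Spec (CommRingCat.of ℂ) ⟶ Sc,
            s ≫ ι ≫ (KM.homO M).ι = KM.homPoint (KM.complexify ρc) := by
  obtain ⟨m, c, y, hy, hne, t, ht, heval⟩ := KM.exists_config_presents B
  have hunit := KM.Config.isUnit_map_nondegenerate hne x.toRingHom y
  obtain ⟨x', hx'⟩ : ∃ x' : Localization.Away (c.nondegenerate y) →ₐ[ℚ] ℚ,
      x'.comp (IsScalarTower.toAlgHom ℚ B _) = x :=
    ⟨IsLocalization.Away.liftAlgHom _ hunit,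
      AlgHom.ext fun b => IsLocalization.Away.lift_eq _ hunit b⟩
  have hz := hy.isUniversalSolution
  let ρc := (hz.isSolution.map ((Algebra.ofId ℚ ℝ).comp x' : _ →+* ℝ)).rep
  have hρ : KM.pointOf ρc = (Algebra.ofId ℚ ℝ).comp
      ((x'.comp hz.isSolution.sliceHom).comp (Ideal.Quotient.mkₐ ℚ c.sliceIdeal)) := by
    rw [AlgHom.comp_assoc, hz.isSolution.sliceHom_comp_mkₐ, ← AlgHom.comp_assoc, ← KM.pointOf_map,
      hz.isSolution.map_rep]
  obtain ⟨Xo, hXo, hsection⟩ :=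
    c.isSlice.exists_crossSection c.hasLabels.injOnElementary_repAt_iff hρ
  obtain ⟨X', S, f, x₀, hS, hf, hx, hpoint⟩ := c.isSlice.exists_iso_opens
    c.hasLabels.injOnElementary_repAt_iff (IsScalarTower.toAlgHom ℚ B _)
    (IsOpenImmersion.of_isLocalization (c.nondegenerate y)) _ hz.isOpenImmersion x' hρ
  rw [hx'] at hx
  exact ⟨X', _, c.coxeter, ρc, c.hasLabels,
    KM.IsSlice.standingAssumption c.hasLabels c.isSlice,
    KM.Config.IsSolution.denseRange_rep _ ht (heval _), Xo, hXo,
    ⟨S, f, x₀, hS.trans_eq hXo.symm, hf, hx, hpoint⟩, hsection⟩
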